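/- **Setting.** Let $0<k<n$ and let $Q$ be a positive definite integral (integer-valued) quadratic form on $\mathbb Z^n$, with bilinear form $B_Q$. Identify $\mathbb R^k$ with $\mathbb R^k\times\{0\}\subset\mathbb R^n$ and let $(\mathbb R^k)^{\perp}$ be its $Q$-orthogonal complement. For a commutative ring $R$ let $G_1(R)=\mathrm{Spin}_Q(R)$ be the spin group of $Q$ over $R$: the even units $x$ of the Clifford algebra $R\otimes_{\mathbb Z}\mathrm{Cl}(Q)$ whose reversal is $x^{-1}$ and which satisfy $xR^nx^{-1}=R^n$, acting on $R^n$ by conjugation. Let $$G_2(R)=\mathbf P_{n,k}(R)=\left\{\begin{pmatrix}A&B\\0&D\end{pmatrix}\in \mathrm{SL}_n(R): \det A=\det D,\ (\det A)^2=1\right\},$$ where $A$ is a $k\times k$ block, and put $G=G_1\times G_2$. Let $\mathbb A=\mathbb R\times\mathbb A_f$ be the adeles of $\mathbb Q$, $Y_{\mathbb A}=G(\mathbb A)/G(\mathbb Q)$, $\mathcal U=G(\mathbb R\times\widehat{\mathbb Z})G(\mathbb Q)\subset Y_{\mathbb A}$, and let $A_Q(\mathbb R)$ be the stabilizer of $\mathbb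 R^k$ in $\mathrm{Spin}_Q(\mathbb R)$, which embeds diagonally in $G(\mathbb R)$. Let $$\Phi:\mathcal U\to A_Q(\mathbb R)\backslash G(\mathbb R)/G(\mathbb Z),\qquad bG(\mathbb Q)\mapsto A_Q(\mathbb R)\,b_\infty\, G(\mathbb Z)\quad (b\in G(\mathbb R\times\widehat{\mathbb Z})).$$ Let $\mathcal G(\mathbb R)=A_Q(\mathbb R)\backslash\mathbf P_{n,k}(\mathbb R)/\mathbf P_{n,k}(\mathbb Z)$ and $X_{n,k}=\mathrm{Gr}_{n,k}(\mathbb R)\times\mathcal G(\mathbb R)$, on which $G_1(\mathbb Z)$ acts through the first factor. The double cosets are mapped to $G_1(\mathbb Z)\backslash X_{n,k}$ by $$\iota:\ A_Q(\mathbb R)(g_1,g_2)G(\mathbb Z)\ \mapsto\ G_1(\mathbb Z)\big(g_1^{-1}\mathbb R^k,\ A_Q(\mathbb R)g_2\mathbf P_{n,k}(\mathbb Z)\big).$$ For a $k$-dimensional rational subspace $L\subset\mathbb Q^n$ choose $g_L\in\mathrm{SL}_n(\mathbb Z)$ whose first $k$ columns form a basis of $L(\mathbb Z)=L\cap\mathbb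 Z^n$; $\rho_L\in \mathrm{Spin}_Q(\mathbb R)$ with $\rho_L(L\otimes\mathbb R)=\mathbb R^k$; and $a_L\in\mathrm{SL}_n(\mathbb R)$ acting as a scalar $\lambda>0$ on $\mathbb R^k$ and as $\lambda^{-k/(n-k)}$ on $(\mathbb R^k)^{\perp}$, such that $a_L\rho_Lg_L\in\mathbf P_{n,k}(\mathbb R)$. The grid of $L$ is $\mathbf g(L)=A_Q(\mathbb R)a_L\rho_Lg_L\mathbf P_{n,k}(\mathbb Z)\in\mathcal G(\mathbb R)$. Let $F_L(R)$ be the stabilizer of $L$ in $\mathrm{Spin}_Q(R)$, let $T_L(R)=\{(h,g_L^{-1}hg_L):h\in F_L(R)\}\subset G(R)$, let $\mu_L$ be a Haar measure on the orbit $T_L(\mathbb A)G(\mathbb Q)\subset Y_{\mathbb A}$ (normalized to mass one if it is finite), let $\mu_L|_{\mathcal U}$ be its normalized restriction $\mu_L|_{\mathcal U}(E)=\mu_L(\mathcal U)^{-1}\mu_L(E\cap\mathcal U)$, and let $\alpha_L=(\rho_L,a_L\rho_Lg_L)\in G(\mathbb R)\subset G(\mathbb A)$. The packet of $L$ is $$\mathrm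 P(L)=\Phi\big(\alpha_LT_L(\mathbb A)G(\mathbb Q)\cap\mathcal U\big),\qquad\text{and}\qquad \gamma_L:=\Phi_*\big(\alpha_L\,\mu_L|_{\mathcal U}\big).$$ **Proposition.** Let $L\subset\mathbb Q^n$ be a rational subspace of dimension $k$, with any choice of $g_L,\rho_L,a_L$ as above. Then: 1. $\mathrm P(L)$ is finite, $\iota$ is injective on $\mathrm P(L)$, and for every $x\in\mathrm P(L)$ the point $\iota(x)$ is of the form $G_1(\mathbb Z)(\hat L,\mathbf g(\hat L))$ for some $k$-dimensional rational subspace $\hat L$ of $\mathbb Q^n$ (and some choice of the data defining $\mathbf g(\hat L)$). 2. For $x\in\mathrm P(L)$ and every $\hat L$ with $\iota(x)=G_1(\mathbb Z)(\hat L,\mathbf g(\hat L))$ the group $F_{\hat L}(\mathbb Z)$ is finite, and $w_x:=|F_{\hat L}(\mathbb Z)|^{-1}$ depends only on $x$. 3. The Haar measure $\mu_L$ exists, and for every such $\mu_L$ $$\gamma_L=\sum_{x\in\mathrm P(L)}\frac{w_x}{w_L}\,\delta_x,\qquad w_L=\sum_{x\in\mathrm P(L)}w_x .$$ -/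

import Mathlib

open scoped TensorProduct
open MeasureTheory

noncomputable section

namespace Packets

/-! Throughout `n = k + m`; coordinates of `R ^ n` are indexed by `Fin k ⊕ Fin m`, so that
`R ^ k × {0}` consists of the vectors supported on `Fin k`. -/

/-- The index set of the `n = k + m` coordinates. -/
abbrev Idx (k m : ℕ) : Type := Fin k ⊕ Fin m

/-- The finite adeles `𝔸_f` of `ℚ`. -/
abbrev FinAdele : Type := IsDedekindDomain.FiniteAdeleRing ℤ ℚ

/-- The subring `Ẑ` of everywhere integral finite adeles. -/
def zhat : Subring FinAdele where
  carrier := {x | ∀ v, x v ∈ v.adicCompletionIntegers ℚ}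
  mul_mem' hx hy v := mul_mem (hx v) (hy v)
  one_mem' v := one_mem (v.adicCompletionIntegers ℚ)
  add_mem' hx hy v := add_mem (hx v) (hy v)
  zero_mem' v := zero_mem (v.adicCompletionIntegers ℚ)
  neg_mem' hx v := neg_mem (hx v)

section Spin

variable {k m : ℕ} (Q : QuadraticForm ℤ (Idx k m → ℤ))

/-- The Clifford algebra `Cl(Q_R) = R ⊗ Cl(Q)` of the base change of `Q` to `R`. -/
abbrev Cl (R : Type) [CommRing R] : Type := R ⊗[ℤ] CliffordAlgebra Q

/-- The inclusion `R ^ n → Cl(Q_R)`. -/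
def vec {R : Type} [CommRing R] (v : Idx k m → R) : Cl Q R :=
  ∑ i, v i ⊗ₜ[ℤ] CliffordAlgebra.ι Q (Pi.single i 1)

/-- The reversal anti-automorphism of `Cl(Q_R)`. -/
def rev (R : Type) [CommRing R] : Cl Q R →+ Cl Q R :=
  ((CliffordAlgebra.reverse (Q := Q)).lTensor R).toAddMonoidHom

theorem rev_tmul {R : Type} [CommRing R] (r : R) (c : CliffordAlgebra Q) :
    rev Q R (r ⊗ₜ[ℤ] c) = r ⊗ₜ[ℤ] CliffordAlgebra.reverse c := rfl

/-- The even part of `Cl(Q_R)`. -/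
def evenPart (R : Type) [CommRing R] : Subalgebra ℤ (Cl Q R) :=
  (Algebra.TensorProduct.map (AlgHom.id ℤ R) (CliffordAlgebra.even Q).val).range

variable {Q} in
theorem rev_mul {R : Type} [CommRing R] (x y : Cl Q R) :
    rev Q R (x * y) = rev Q R y * rev Q R x := by
  induction x using TensorProduct.induction_on with
  | zero => simp
  | add a b ha hb => simp [add_mul, mul_add, ha, hb]
  | tmul r c =>
    induction y using TensorProduct.induction_on with
    | zero => simp
    | add a b ha hb => simp [add_mul, mul_add, ha, hb]
    | tmul s d => simp [rev_tmul, CliffordAlgebra.reverse.map_mul, mul_comm]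

variable {Q} in
theorem rev_rev {R : Type} [CommRing R] (x : Cl Q R) : rev Q R (rev Q R x) = x := by
  induction x using TensorProduct.induction_on with
  | zero => simp
  | add a b ha hb => simp [ha, hb]
  | tmul r c => simp [rev_tmul]

theorem rev_one (R : Type) [CommRing R] : rev Q R 1 = 1 := by
  rw [Algebra.TensorProduct.one_def, rev_tmul, CliffordAlgebra.reverse.map_one]

/-- `Spin_Q(R)`: the even units `x` of `Cl(Q_R)` with `rev x = x⁻¹` such that
`x v x⁻¹ ∈ R ^ n` for all `v ∈ R ^ n`. The group is recorded together with the matrix `M`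
by which `x` acts on `R ^ n`, i.e. `x v x⁻¹ = M v`; it is determined by `x`, and `(x, M) ↦ M` is
the covering map to the special orthogonal group. -/
def spinGroup (R : Type) [CommRing R] :
    Subgroup ((Cl Q R)ˣ × Matrix.SpecialLinearGroup (Idx k m) R) where
  carrier := {g | g.1 ∈ (evenPart Q R).toSubmonoid.units ∧
    rev Q R (g.1 : Cl Q R) = ((g.1⁻¹ : (Cl Q R)ˣ) : Cl Q R) ∧
    ∀ v : Idx k m → R, (g.1 : Cl Q R) * vec Q v = vec Q (g.2.1.mulVec v) * (g.1 : Cl Q R)}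
  mul_mem' := by
    rintro ⟨x, M⟩ ⟨y, N⟩ ⟨hx, hx', hx''⟩ ⟨hy, hy', hy''⟩
    refine ⟨mul_mem hx hy, ?_, fun v => ?_⟩
    · simp only [Prod.fst_mul, Units.val_mul, rev_mul, mul_inv_rev] at *
      rw [hx', hy']
    · have h1 := hx'' (N.1.mulVec v)
      have h2 := hy'' v
      simp only [Prod.fst_mul, Prod.snd_mul, Units.val_mul] at *
      rw [mul_assoc, h2, ← mul_assoc, h1, mul_assoc, Matrix.mulVec_mulVec]
      rfl
  one_mem' := by
    refine ⟨one_mem _, ?_, fun v => ?_⟩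
    · simp [rev_one]
    · simp
  inv_mem' := by
    rintro ⟨x, M⟩ ⟨hx, hx', hx''⟩
    refine ⟨inv_mem hx, ?_, fun v => ?_⟩
    · simp only [Prod.fst_inv, inv_inv] at *
      rw [← hx', rev_rev]
    · have h1 := hx'' ((M⁻¹).1.mulVec v)
      have h2 : M.1.mulVec ((M⁻¹).1.mulVec v) = v := by
        rw [Matrix.mulVec_mulVec,
          show M.1 * (M⁻¹).1 = 1 from congrArg Subtype.val (mul_inv_cancel M), Matrix.one_mulVec]
      simp only [Prod.fst_inv, Prod.snd_inv] at *
      rw [h2] at h1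
      rw [Units.inv_mul_eq_iff_eq_mul, ← mul_assoc, Units.eq_mul_inv_iff_mul_eq]
      exact h1.symm

/-- The group `G₁(R) = Spin_Q(R)`. -/
abbrev Spin (R : Type) [CommRing R] : Type := spinGroup Q R

/-- The covering map `Spin_Q(R) → SO_Q(R)`. -/
def spinMat (R : Type) [CommRing R] : Spin Q R →* Matrix.SpecialLinearGroup (Idx k m) R :=
  (MonoidHom.snd _ _).comp (spinGroup Q R).subtype

/-- Base change `Cl(Q_R) → Cl(Q_S)`. -/
def clMap {R S : Type} [CommRing R] [CommRing S] (f : R →+* S) : Cl Q R →ₐ[ℤ] Cl Q S :=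
  Algebra.TensorProduct.map f.toIntAlgHom (AlgHom.id ℤ (CliffordAlgebra Q))

theorem clMap_rev {R S : Type} [CommRing R] [CommRing S] (f : R →+* S) (x : Cl Q R) :
    clMap Q f (rev Q R x) = rev Q S (clMap Q f x) := by
  induction x using TensorProduct.induction_on with
  | zero => simp
  | add a b ha hb => simp [ha, hb]
  | tmul r c => simp [rev_tmul, clMap]

theorem clMap_even {R S : Type} [CommRing R] [CommRing S] (f : R →+* S) {x : Cl Q R}
    (hx : x ∈ evenPart Q R) : clMap Q f x ∈ evenPart Q S := by
  obtain ⟨y, rfl⟩ := hx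
  refine ⟨Algebra.TensorProduct.map f.toIntAlgHom (AlgHom.id ℤ _) y, ?_⟩
  induction y using TensorProduct.induction_on with
  | zero => simp
  | add a b ha hb => simpa using congrArg₂ (· + ·) ha hb
  | tmul r c => simp [clMap]

theorem vec_eq {R S : Type} [CommRing R] [CommRing S] (f : R →+* S) (v : Idx k m → S) :
    vec Q v = ∑ j, (v j ⊗ₜ[ℤ] (1 : CliffordAlgebra Q)) * clMap Q f (vec Q (Pi.single j 1)) := by
  classical
  refine Finset.sum_congr rfl fun j _ => ?_
  rw [vec, Finset.sum_eq_single j]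
  · simp [clMap]
  · intro b _ hb
    simp [hb]
  · simp

theorem clMap_vec {R S : Type} [CommRing R] [CommRing S] (f : R →+* S) (v : Idx k m → R) :
    clMap Q f (vec Q v) = vec Q (fun i => f (v i)) := by
  simp [vec, clMap]

/-- Base change `Spin_Q(R) → Spin_Q(S)`. -/
def spinMap {R S : Type} [CommRing R] [CommRing S] (f : R →+* S) : Spin Q R →* Spin Q S :=
  ((((Units.map (clMap Q f : Cl Q R →* Cl Q S)).prodMap
    (Matrix.SpecialLinearGroup.map f)).comp (spinGroup Q R).subtype).codRestrict
      (spinGroup Q S)) (by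
    rintro ⟨⟨x, M⟩, ⟨hx₁, hx₂⟩, hx', hx''⟩
    refine ⟨⟨clMap_even Q f hx₁, ?_⟩, ?_, fun v => ?_⟩
    · have := clMap_even Q f hx₂
      simpa using this
    · have := congrArg (clMap Q f) hx'
      rw [clMap_rev] at this
      simpa using this
    · simp only [MonoidHom.comp_apply, Subgroup.coe_subtype, MonoidHom.prodMap_def,
        MonoidHom.prod_apply, MonoidHom.coe_fst, MonoidHom.coe_snd, Units.coe_map]
      have key : ∀ j, clMap Q f x * clMap Q f (vec Q (Pi.single j 1)) =
          clMap Q f (vec Q (M.1.col j)) * clMap Q f x := by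
        intro j
        have := congrArg (clMap Q f) (hx'' (Pi.single j 1))
        simpa using this
      have hM : vec Q ((Matrix.SpecialLinearGroup.map f M).1.mulVec v) =
          ∑ j, (v j ⊗ₜ[ℤ] (1 : CliffordAlgebra Q)) * clMap Q f (vec Q (M.1.col j)) := by
        simp only [clMap_vec]
        simp only [vec, Finset.mul_sum, Algebra.TensorProduct.tmul_mul_tmul, one_mul]
        rw [Finset.sum_comm]
        refine Finset.sum_congr rfl fun i _ => ?_
        rw [← TensorProduct.sum_tmul]
        congr 1
        simp [Matrix.mulVec, dotProduct, mul_comm]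
      change clMap Q f x * vec Q v =
        vec Q ((Matrix.SpecialLinearGroup.map f M).1.mulVec v) * clMap Q f x
      rw [hM, vec_eq Q f v, Finset.mul_sum, Finset.sum_mul]
      refine Finset.sum_congr rfl fun j _ => ?_
      have hc : ∀ z : Cl Q S, z * (v j ⊗ₜ[ℤ] (1 : CliffordAlgebra Q)) =
          (v j ⊗ₜ[ℤ] (1 : CliffordAlgebra Q)) * z := by
        intro z
        induction z using TensorProduct.induction_on with
        | zero => simp
        | add a b ha hb => simp [add_mul, mul_add, ha, hb]
        | tmul r c => simp [mul_comm]
      rw [← mul_assoc, hc, mul_assoc, key j, mul_assoc])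

/-- The groups `Spin_Q(R)` carry the topology of `Cl(Q_R) × M_n(R)`, where the finite free
`R`-module `Cl(Q_R)` has its canonical topology. -/
instance spinTopology (R : Type) [CommRing R] [TopologicalSpace R] :
    TopologicalSpace (Spin Q R) :=
  @TopologicalSpace.induced _ (Cl Q R × Matrix (Idx k m) (Idx k m) R)
    (fun h => ((h.1.1 : Cl Q R), h.1.2.1))
    (@instTopologicalSpaceProd _ _ (moduleTopology R (Cl Q R)) inferInstance)

end Spin

section Parabolic

/-- `P_{n,k}(R)`: the matrices `(A, B; 0, D)` in `SL_n(R)` with `det A = det D` and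
`(det A)² = 1`, i.e. `det A = det D = ±1` if `R` is a domain. -/
def parabolic (k m : ℕ) (R : Type) [CommRing R] :
    Subgroup (Matrix.SpecialLinearGroup (Idx k m) R) where
  carrier := {M | M.1.toBlocks₂₁ = 0 ∧ M.1.toBlocks₁₁.det = M.1.toBlocks₂₂.det ∧
    M.1.toBlocks₁₁.det ^ 2 = 1}
  mul_mem' := by
    rintro M N ⟨h1, h2, h3⟩ ⟨h1', h2', h3'⟩
    have hM := Matrix.fromBlocks_toBlocks M.1
    have hN := Matrix.fromBlocks_toBlocks N.1
    rw [h1] at hM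
    rw [h1'] at hN
    have hMN : (M * N).1 = M.1 * N.1 := rfl
    simp only [Set.mem_ofPred_eq]
    rw [hMN, ← hM, ← hN, Matrix.fromBlocks_multiply]
    simp only [Matrix.toBlocks_fromBlocks₂₁, Matrix.toBlocks_fromBlocks₁₁,
      Matrix.toBlocks_fromBlocks₂₂]
    simp only [Matrix.zero_mul, Matrix.mul_zero, add_zero, zero_add, Matrix.det_mul]
    refine ⟨trivial, by rw [h2, h2'], by rw [mul_pow, h3, h3', one_mul]⟩
  one_mem' := by
    have h : (1 : Matrix.SpecialLinearGroup (Idx k m) R).1 = Matrix.fromBlocks 1 0 0 1 :=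
      Matrix.fromBlocks_one.symm
    simp only [Set.mem_ofPred_eq]
    rw [h, Matrix.toBlocks_fromBlocks₂₁, Matrix.toBlocks_fromBlocks₁₁,
      Matrix.toBlocks_fromBlocks₂₂]
    simp
  inv_mem' := by
    rintro M ⟨h1, h2, h3⟩
    have hM := Matrix.fromBlocks_toBlocks M.1
    have hN := Matrix.fromBlocks_toBlocks (M⁻¹).1
    have h : (M⁻¹).1 * M.1 = Matrix.fromBlocks 1 0 0 1 :=
      (congrArg Subtype.val (inv_mul_cancel M)).trans Matrix.fromBlocks_one.symm
    rw [h1] at hM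
    rw [← hM, ← hN, Matrix.fromBlocks_multiply, Matrix.fromBlocks_inj] at h
    simp only [Matrix.mul_zero, add_zero] at h
    obtain ⟨e1, -, e3, e4⟩ := h
    have hA : IsUnit M.1.toBlocks₁₁ := by
      rw [Matrix.isUnit_iff_isUnit_det]
      exact IsUnit.of_mul_eq_one _ (by rw [← sq]; exact h3)
    have h0 : (M⁻¹).1.toBlocks₂₁ = 0 := by
      have := congrArg (· * M.1.toBlocks₁₁⁻¹) e3
      simpa [Matrix.mul_assoc,
        Matrix.mul_nonsing_inv _ ((Matrix.isUnit_iff_isUnit_det _).mp hA)] using this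
    rw [h0, Matrix.zero_mul, zero_add] at e4
    have d1 := congrArg Matrix.det e1
    have d4 := congrArg Matrix.det e4
    rw [Matrix.det_mul, Matrix.det_one] at d1 d4
    rw [← h2] at d4
    have d1' : (M⁻¹).1.toBlocks₁₁.det = M.1.toBlocks₁₁.det := by
      linear_combination M.1.toBlocks₁₁.det * d1 - (M⁻¹).1.toBlocks₁₁.det * h3
    have d4' : (M⁻¹).1.toBlocks₂₂.det = M.1.toBlocks₁₁.det := by
      linear_combination M.1.toBlocks₁₁.det * d4 - (M⁻¹).1.toBlocks₂₂.det * h3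
    exact ⟨h0, by rw [d1', d4'], by rw [d1', h3]⟩

/-- The group `G₂(R) = P_{n,k}(R)`. -/
abbrev Par (k m : ℕ) (R : Type) [CommRing R] : Type := parabolic k m R

/-- Base change `P_{n,k}(R) → P_{n,k}(S)`. -/
def parMap (k m : ℕ) {R S : Type} [CommRing R] [CommRing S] (f : R →+* S) :
    Par k m R →* Par k m S :=
  (((Matrix.SpecialLinearGroup.map f).comp (parabolic k m R).subtype).codRestrict
    (parabolic k m S)) (by
    rintro ⟨M, h1, h2, h3⟩
    refine ⟨?_, ?_, ?_⟩
    · ext i j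
      have := congrArg f (congrFun (congrFun h1 i) j)
      simpa [Matrix.toBlocks₂₁] using this
    · have := congrArg f h2
      rw [f.map_det, f.map_det] at this
      exact this
    · have := congrArg f h3
      rw [map_pow, f.map_det, map_one] at this
      exact this)

end Parabolic

section Groups

variable {k m : ℕ} (Q : QuadraticForm ℤ (Idx k m → ℤ))

/-- `G(R) = G₁(R) × G₂(R) = Spin_Q(R) × P_{n,k}(R)`. -/
abbrev Grp (R : Type) [CommRing R] : Type := Spin Q R × Par k m R

/-- Base change `G(R) → G(S)`. -/
def grpMap {R S : Type} [CommRing R] [CommRing S] (f : R →+* S) : Grp Q R →* Grp Q S :=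
  (spinMap Q f).prodMap (parMap k m f)

/-- `G(𝔸) = G(ℝ) × G(𝔸_f)`. -/
abbrev GrpA : Type := Grp Q ℝ × Grp Q FinAdele

/-- `G(ℚ)`, diagonally embedded in `G(𝔸)`. -/
def ratPts : Subgroup (GrpA Q) :=
  ((grpMap Q (algebraMap ℚ ℝ)).prod (grpMap Q (algebraMap ℚ FinAdele))).range

/-- `G(ℝ × Ẑ)`. -/
def openPts : Subgroup (GrpA Q) := (⊤ : Subgroup (Grp Q ℝ)).prod (grpMap Q zhat.subtype).range

/-- `G(ℤ)` as a subgroup of `G(ℝ)`. -/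
def intGrp : Subgroup (Grp Q ℝ) := (grpMap Q (Int.castRingHom ℝ)).range

/-- The homogeneous space `Y_𝔸 = G(𝔸) / G(ℚ)`. -/
def YA : Type := GrpA Q ⧸ ratPts Q

instance : TopologicalSpace (YA Q) := inferInstanceAs (TopologicalSpace (GrpA Q ⧸ ratPts Q))

instance : MulAction (GrpA Q) (YA Q) := inferInstanceAs (MulAction (GrpA Q) (GrpA Q ⧸ ratPts Q))

instance : MeasurableSpace (YA Q) := borel _

/-- The coset `g G(ℚ)`. -/
def YA.mk (g : GrpA Q) : YA Q := (QuotientGroup.mk g : GrpA Q ⧸ ratPts Q)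

/-- The set `𝒰 = G(ℝ × Ẑ) G(ℚ)` in `Y_𝔸`. -/
def openOrbit : Set (YA Q) := YA.mk Q '' (openPts Q : Set (GrpA Q))

/-- The stabilizer in `Spin_Q(R)` of a submodule `W` of `R ^ n`. -/
def stab {R : Type} [CommRing R] (W : Submodule R (Idx k m → R)) : Subgroup (Spin Q R) where
  carrier := {h | W.map (Matrix.toLin' (spinMat Q R h).1) = W}
  mul_mem' := by
    intro a b ha hb
    simp only [Set.mem_ofPred_eq] at *
    have : (spinMat Q R (a * b)).1 = (spinMat Q R a).1 * (spinMat Q R b).1 := by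
      rw [map_mul]; rfl
    rw [this, Matrix.toLin'_mul, Submodule.map_comp, hb, ha]
  one_mem' := by
    have : (spinMat Q R 1).1 = 1 := by rw [map_one]; rfl
    simp only [Set.mem_ofPred_eq]
    rw [this, Matrix.toLin'_one, Submodule.map_id]
  inv_mem' := by
    intro a ha
    simp only [Set.mem_ofPred_eq] at *
    have : (spinMat Q R a⁻¹).1 * (spinMat Q R a).1 = 1 := by
      rw [map_inv]; exact congrArg Subtype.val (inv_mul_cancel (spinMat Q R a))
    calc W.map (Matrix.toLin' (spinMat Q R a⁻¹).1)
        = (W.map (Matrix.toLin' (spinMat Q R a).1)).map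
            (Matrix.toLin' (spinMat Q R a⁻¹).1) := by rw [ha]
      _ = W := by
        rw [← Submodule.map_comp, ← Matrix.toLin'_mul, this, Matrix.toLin'_one, Submodule.map_id]

/-- `R ^ k × {0}` inside `R ^ n`. -/
def stdSpace (k m : ℕ) (R : Type) [CommRing R] : Submodule R (Idx k m → R) where
  carrier := {v | ∀ j, v (Sum.inr j) = 0}
  add_mem' hv hw j := by simp [hv j, hw j]
  zero_mem' _ := rfl
  smul_mem' c v hv j := by simp [hv j]

/-- The extension of scalars `L_R ⊆ R ^ n` of a rational subspace `L`. -/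
def ext {k m : ℕ} (R : Type) [CommRing R] [Algebra ℚ R] (L : Submodule ℚ (Idx k m → ℚ)) :
    Submodule R (Idx k m → R) :=
  Submodule.span R ((fun v i => algebraMap ℚ R (v i)) '' (L : Set (Idx k m → ℚ)))

/-- `L(ℤ) = L ∩ ℤ ^ n`. -/
def latticePts {k m : ℕ} (L : Submodule ℚ (Idx k m → ℚ)) : Submodule ℤ (Idx k m → ℤ) :=
  (L.restrictScalars ℤ).comap ((Algebra.linearMap ℤ ℚ).compLeft (Idx k m))

/-- `F_L(R)`, the stabilizer of `L` in `Spin_Q(R)`. -/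
def stabL (L : Submodule ℚ (Idx k m → ℚ)) (R : Type) [CommRing R] [Algebra ℚ R] :
    Subgroup (Spin Q R) := stab Q (ext R L)

/-- `F_L(ℤ)`, the stabilizer of `L` in `Spin_Q(ℤ)`. -/
def stabZ (L : Submodule ℚ (Idx k m → ℚ)) : Subgroup (Spin Q ℤ) :=
  (stab Q L).comap (spinMap Q (Int.castRingHom ℚ))

/-- An integral matrix of determinant one over the ring `R`. -/
abbrev castSL {k m : ℕ} (R : Type) [CommRing R] (g : Matrix.SpecialLinearGroup (Idx k m) ℤ) :
    Matrix.SpecialLinearGroup (Idx k m) R :=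
  Matrix.SpecialLinearGroup.map (Int.castRingHom R) g

/-- `T_L(R) = {(h, g⁻¹ h g) : h ∈ F_L(R)}`. -/
def torusGrp (L : Submodule ℚ (Idx k m → ℚ)) (g : Matrix.SpecialLinearGroup (Idx k m) ℤ)
    (R : Type) [CommRing R] [Algebra ℚ R] : Subgroup (Grp Q R) where
  carrier := {t | t.1 ∈ stabL Q L R ∧
    t.2.1 = (castSL R g)⁻¹ * spinMat Q R t.1 * castSL R g}
  mul_mem' := by
    rintro a b ⟨ha, ha'⟩ ⟨hb, hb'⟩
    refine ⟨mul_mem ha hb, ?_⟩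
    have : (a * b).2.1 = a.2.1 * b.2.1 := rfl
    rw [this, ha', hb', Prod.fst_mul, map_mul]
    group
  one_mem' := by
    refine ⟨one_mem _, ?_⟩
    have : (1 : Grp Q R).2.1 = 1 := rfl
    rw [this, Prod.fst_one, map_one]
    group
  inv_mem' := by
    rintro a ⟨ha, ha'⟩
    refine ⟨inv_mem ha, ?_⟩
    have : (a⁻¹).2.1 = (a.2.1)⁻¹ := rfl
    rw [this, ha', Prod.fst_inv, map_inv]
    group

/-- `T_L(𝔸) = T_L(ℝ) × T_L(𝔸_f)`. -/
def torusA (L : Submodule ℚ (Idx k m → ℚ)) (g : Matrix.SpecialLinearGroup (Idx k m) ℤ) :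
    Subgroup (GrpA Q) := (torusGrp Q L g ℝ).prod (torusGrp Q L g FinAdele)

/-- The orbit `T_L(𝔸) G(ℚ)` in `Y_𝔸`. -/
def orbitL (L : Submodule ℚ (Idx k m → ℚ)) (g : Matrix.SpecialLinearGroup (Idx k m) ℤ) :
    Set (YA Q) := YA.mk Q '' (torusA Q L g : Set (GrpA Q))

/-- `μ` is the Haar measure on the orbit `T_L(𝔸) G(ℚ)`: a nonzero `T_L(𝔸)`-invariant Borel
measure carried by the orbit, finite on images of compact subsets of `T_L(𝔸)`, and normalized to
be a probability measure as soon as it is finite. -/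
structure IsOrbitHaar (L : Submodule ℚ (Idx k m → ℚ))
    (g : Matrix.SpecialLinearGroup (Idx k m) ℤ) (μ : Measure (YA Q)) : Prop where
  ne_zero : μ ≠ 0
  invariant : ∀ t ∈ torusA Q L g, μ.map (fun y => t • y) = μ
  carried : μ (orbitL Q L g)ᶜ = 0
  finite_image : ∀ S : Set (GrpA Q), IsCompact S → S ⊆ torusA Q L g → μ (YA.mk Q '' S) < ⊤
  normalized : μ Set.univ < ⊤ → μ Set.univ = 1

/-- `A_Q(ℝ)`, the stabilizer of `ℝ ^ k` in `Spin_Q(ℝ)`. -/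
def stabStd : Subgroup (Spin Q ℝ) := stab Q (stdSpace k m ℝ)

/-- `A_Q(ℝ)`, diagonally embedded in `G(ℝ)`. -/
def diagA : Subgroup (Grp Q ℝ) where
  carrier := {s | s.1 ∈ stabStd Q ∧ s.2.1 = spinMat Q ℝ s.1}
  mul_mem' := by
    rintro a b ⟨ha, ha'⟩ ⟨hb, hb'⟩
    refine ⟨mul_mem ha hb, ?_⟩
    have : (a * b).2.1 = a.2.1 * b.2.1 := rfl
    rw [this, ha', hb', Prod.fst_mul, map_mul]
  one_mem' := ⟨one_mem _, by rw [Prod.fst_one, map_one]; rfl⟩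
  inv_mem' := by
    rintro a ⟨ha, ha'⟩
    refine ⟨inv_mem ha, ?_⟩
    have : (a⁻¹).2.1 = (a.2.1)⁻¹ := rfl
    rw [this, ha', Prod.fst_inv, map_inv]

/-- The double coset space `A_Q(ℝ) \ G(ℝ) / G(ℤ)`. -/
def DC : Type := DoubleCoset.Quotient (diagA Q : Set (Grp Q ℝ)) (intGrp Q : Set (Grp Q ℝ))

/-- The double coset `A_Q(ℝ) g G(ℤ)`. -/
def DC.mk (g : Grp Q ℝ) : DC Q := DoubleCoset.mk (diagA Q) (intGrp Q) g

/-- The quotient topology. -/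
instance : TopologicalSpace (DC Q) := TopologicalSpace.coinduced (DC.mk Q) inferInstance

instance : MeasurableSpace (DC Q) := borel _

open Classical in
/-- The map `Φ : 𝒰 → A_Q(ℝ) \ G(ℝ) / G(ℤ)`, `b G(ℚ) ↦ A_Q(ℝ) b_∞ G(ℤ)` for `b ∈ G(ℝ × Ẑ)`,
extended by an irrelevant constant to all of `Y_𝔸`. -/
def Phi (y : YA Q) : DC Q :=
  if h : ∃ b ∈ openPts Q, YA.mk Q b = y then DC.mk Q h.choose.1 else DC.mk Q 1

/-- The bilinear form `B_Q` on `ℝ ^ n`, with `B_Q(v, v) = Q(v)`. -/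
def bilin (v w : Idx k m → ℝ) : ℝ :=
  ∑ i, ∑ j, v i * w j * ((QuadraticMap.polar Q (Pi.single i 1) (Pi.single j 1) : ℤ) : ℝ) / 2

/-- The choices `g_L`, `ρ_L`, `a_L` attached to a rational subspace `L`: the first `k` columns of
`g_L ∈ SL_n(ℤ)` are a basis of `L(ℤ)`, `ρ_L ∈ Spin_Q(ℝ)` maps `L` to `ℝ ^ k`, and `a_L` acts on
`ℝ ^ k` as a scalar `λ > 0` and on its `Q`-orthogonal complement as `λ ^ (-k / (n - k))`, such that
`a_L ρ_L g_L ∈ P_{n,k}(ℝ)`. -/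
structure GridData (L : Submodule ℚ (Idx k m → ℚ)) where
  g : Matrix.SpecialLinearGroup (Idx k m) ℤ
  g_span : Submodule.span ℤ (Set.range fun i : Fin k => g.1.col (Sum.inl i)) = latticePts L
  ρ : Spin Q ℝ
  ρ_map : (ext ℝ L).map (Matrix.toLin' (spinMat Q ℝ ρ).1) = stdSpace k m ℝ
  lam : ℝ
  lam_pos : 0 < lam
  a : Matrix.SpecialLinearGroup (Idx k m) ℝ
  a_std : ∀ v ∈ stdSpace k m ℝ, a.1.mulVec v = lam • v
  a_perp : ∀ w : Idx k m → ℝ, (∀ v ∈ stdSpace k m ℝ, bilin Q v w = 0) →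
    a.1.mulVec w = (lam ^ (-((k : ℝ) / (m : ℝ)))) • w
  mem : a * spinMat Q ℝ ρ * castSL ℝ g ∈ parabolic k m ℝ

variable {Q}

/-- The element `a_L ρ_L g_L` of `P_{n,k}(ℝ)`. -/
def GridData.par {L : Submodule ℚ (Idx k m → ℚ)} (d : GridData Q L) : Par k m ℝ :=
  ⟨d.a * spinMat Q ℝ d.ρ * castSL ℝ d.g, d.mem⟩

/-- `α_L = (ρ_L, a_L ρ_L g_L) ∈ G(ℝ)`, as an element of `G(𝔸)` trivial at the finite places. -/
def GridData.alpha {L : Submodule ℚ (Idx k m → ℚ)} (d : GridData Q L) : GrpA Q :=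
  ((d.ρ, d.par), 1)

/-- The packet `P(L) = Φ(α_L T_L(𝔸) G(ℚ) ∩ 𝒰)`. -/
def packet {L : Submodule ℚ (Idx k m → ℚ)} (d : GridData Q L) : Set (DC Q) :=
  Phi Q '' ((fun y => d.alpha • y) '' orbitL Q L d.g ∩ openOrbit Q)

/-- The measure `Φ_*(α_L (μ|_𝒰))`, where `μ|_𝒰` is the normalized restriction of `μ` to `𝒰`. -/
def gammaL {L : Submodule ℚ (Idx k m → ℚ)} (d : GridData Q L) (μ : Measure (YA Q)) :
    Measure (DC Q) :=
  ((((μ (openOrbit Q))⁻¹ • μ.restrict (openOrbit Q)).map (fun y => d.alpha • y))).map (Phi Q)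

variable (Q)

/-- The Grassmannian `Gr_{n,k}(ℝ)`. -/
abbrev GrR (k m : ℕ) : Type :=
  {W : Submodule ℝ (Idx k m → ℝ) // Module.finrank ℝ W = k}

/-- The moduli space of grids `A_Q(ℝ) \ P_{n,k}(ℝ) / P_{n,k}(ℤ)`. -/
abbrev Grids : Type :=
  DoubleCoset.Quotient
    ((((stabStd Q).map (spinMat Q ℝ)).subgroupOf (parabolic k m ℝ) : Subgroup (Par k m ℝ)) :
      Set (Par k m ℝ))
    ((parMap k m (Int.castRingHom ℝ)).range : Set (Par k m ℝ))

/-- The double coset `A_Q(ℝ) p P_{n,k}(ℤ)`. -/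
def gridMk (p : Par k m ℝ) : Grids Q :=
  DoubleCoset.mk (((stabStd Q).map (spinMat Q ℝ)).subgroupOf (parabolic k m ℝ))
    (parMap k m (Int.castRingHom ℝ)).range p

/-- Two points of `X_{n,k} = Gr_{n,k}(ℝ) × Grids` in the same orbit of `G₁(ℤ)`, which acts on the
first factor only. -/
def sameOrbit (x y : GrR k m × Grids Q) : Prop :=
  (∃ η : Spin Q ℤ, y.1.1 =
    x.1.1.map (Matrix.toLin' (spinMat Q ℝ (spinMap Q (Int.castRingHom ℝ) η)).1)) ∧ y.2 = x.2

/-- `G₁(ℤ) \ X_{n,k}`. -/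
def XZ : Type := Quot (sameOrbit Q)

theorem finrank_std : Module.finrank ℝ (stdSpace k m ℝ) = k := by
  have h : stdSpace k m ℝ = LinearMap.range
      ((LinearEquiv.sumArrowLequivProdArrow (Fin k) (Fin m) ℝ ℝ).symm.toLinearMap ∘ₗ
        LinearMap.inl ℝ (Fin k → ℝ) (Fin m → ℝ)) := by
    ext v
    constructor
    · intro hv
      refine ⟨fun i => v (Sum.inl i), ?_⟩
      ext (i | j)
      · simp
      · simpa using (hv j).symm
    · rintro ⟨w, rfl⟩ j
      simp
  rw [h, LinearMap.finrank_range_of_inj]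
  · simp
  · intro x y hxy
    simpa using hxy

theorem finrank_map {R : Type} [Field R] (M : Matrix.SpecialLinearGroup (Idx k m) R)
    (W : Submodule R (Idx k m → R)) :
    Module.finrank R (W.map (Matrix.toLin' M.1)) = Module.finrank R W :=
  LinearEquiv.finrank_map_eq (Matrix.SpecialLinearGroup.toLin' M) W

/-- The map `A_Q(ℝ) \ G(ℝ) / G(ℤ) → G₁(ℤ) \ X_{n,k}`,
`(g₁, g₂) ↦ (g₁⁻¹ ℝ ^ k, A_Q(ℝ) g₂ P_{n,k}(ℤ))`. -/
def toX : DC Q → XZ Q :=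
  Quotient.lift (s := DoubleCoset.setoid (diagA Q : Set (Grp Q ℝ)) (intGrp Q : Set (Grp Q ℝ)))
    (fun g => Quot.mk _ (⟨(stdSpace k m ℝ).map (Matrix.toLin' (spinMat Q ℝ g.1⁻¹).1),
      by rw [finrank_map, finrank_std]⟩, gridMk Q g.2)) (by
    intro g h hgh
    obtain ⟨s, hs, c, hc, rfl⟩ := DoubleCoset.rel_iff.mp hgh
    obtain ⟨η, rfl⟩ := hc
    refine Quot.sound ⟨⟨η.1⁻¹, ?_⟩, ?_⟩
    · have hs' : (stdSpace k m ℝ).map (Matrix.toLin' (spinMat Q ℝ s.1⁻¹).1) = stdSpace k m ℝ :=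
        inv_mem hs.1
      have e : (s * g * grpMap Q (Int.castRingHom ℝ) η).1⁻¹ =
          spinMap Q (Int.castRingHom ℝ) η.1⁻¹ * (g.1⁻¹ * s.1⁻¹) := by
        rw [map_inv, ← mul_inv_rev, ← mul_inv_rev]
        rfl
      have hmul : ∀ a b : Spin Q ℝ,
          (spinMat Q ℝ (a * b)).1 = (spinMat Q ℝ a).1 * (spinMat Q ℝ b).1 := by
        intro a b
        rw [map_mul]
        rfl
      change (stdSpace k m ℝ).map (Matrix.toLin' (spinMat Q ℝ
        (s * g * grpMap Q (Int.castRingHom ℝ) η).1⁻¹).1) = _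
      rw [e, hmul, hmul, Matrix.toLin'_mul, Matrix.toLin'_mul, Submodule.map_comp,
        Submodule.map_comp, hs']
    · change gridMk Q (s * g * grpMap Q (Int.castRingHom ℝ) η).2 = gridMk Q g.2
      refine ((DoubleCoset.eq _ _ _ _).mpr ⟨s.2, ?_, (grpMap Q (Int.castRingHom ℝ) η).2, ?_,
        rfl⟩).symm
      · exact ⟨s.1, hs.1, hs.2.symm⟩
      · exact ⟨η.2, rfl⟩)

/-- The point `G₁(ℤ) (L, 𝐠(L))` of `G₁(ℤ) \ X_{n,k}`, where `𝐠(L)` is the grid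
`A_Q(ℝ) a_L ρ_L g_L P_{n,k}(ℤ)`. -/
def gridPt {L : Submodule ℚ (Idx k m → ℚ)} (d : GridData Q L) : XZ Q :=
  Quot.mk _ (⟨ext ℝ L, by
    rw [← finrank_map (spinMat Q ℝ d.ρ), d.ρ_map, finrank_std]⟩, gridMk Q d.par)

end Groups

end Packets
end

/-!
The proof turns all objects into double cosets of the torus. A point of the packet is the value at
`α_L b` of `Φ`, where `b ∈ G(ℝ × Ẑ)` lies in `T_L(𝔸) q` for a rational `q` (`mem_packet_iff`,
`mk_mem_orbitL_iff`). Let `P` be the orthogonal projection onto `L` and `g = g_L`. The torus is the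
stabilizer of the rational point `(P, g)` for an action of `G` on pairs of matrices (`pairAct`,
`mem_torusGrp_iff`, `mul_inv_mem_torusGrp_iff`). Hence `b⁻¹ (P, g) = q⁻¹ (P, g)` is a rational
point, and its second component is integral because `b` is integral at the finite places
(`exists_castSL_eq`). This component has determinant one, and together with `ρ_L b_∞` and `a_L` it
exhibits the point `ι(x)` as the class of the subspace `q⁻¹ L` with its grid (`exists_gridData`).
If two points of the packet have the same image under `ι`, then their subspaces are equivalent
under `Spin_Q(ℤ)`; an element of `Spin_Q(ℤ)` carrying one to the other completes to an element of
`G(ℤ)`, so the two points have the same double coset (`exists_integral_of_mem_stabL`, `injOn_toX`).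

*Finiteness.* The group `Spin_Q(ℝ)` is compact: `Q` being positive definite, averaging a positive
form over an orthogonal basis gives a positive definite form on the real Clifford algebra for which
reversal is the adjoint (`exists_adjoint_form`, `compactSpace_spin_real`), so that its elements have
bounded coordinates. Therefore `Spin_Q(ℤ)` is finite and `Spin_Q(ℝ × Ẑ)` is compact. The orthogonal
projections onto the subspaces `q⁻¹ L` lie in a compact orbit and have rational entries; as `ℚ ^ N`
is discrete in `𝔸 ^ N`, there are finitely many of them, and they determine the points of the packet
(`finite_packet`). No finiteness theorem for class numbers of general groups is needed.

*Unimodularity.* `F_L(𝔸)` is unimodular (`mulEquivHaarChar_conj`). More generally every isometry of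
`𝔸_f ^ n` preserving `L` induces an automorphism of `F_L(𝔸)` preserving Haar measure
(`isoKer_eq_top`). Reflections induce involutions, and isometries which are integral together with
their inverses preserve a compact open subgroup; both have modulus one. An isometry is non-integral
at finitely many places only, and there it is a product of reflections preserving `L`, as in the
theorem of Cartan and Dieudonné. Working with idempotents of the ring of finite adeles treats these
places simultaneously.

*Measures.* In a unimodular group the measure of an orbit of a compact open subgroup, multiplied by
the order of the isotropy group of its base point, does not depend on the base point
(`exists_measure_orbit_mul_card`). The compact open subgroup of integral points of the torus acts
transitively on the points of `𝒰` in the orbit lying over a given point `x` of the packet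
(`fibre_eq`), and the isotropy group is isomorphic to the stabilizer of `q⁻¹ L` in `Spin_Q(ℤ)`
(`card_isotropy_eq`, `card_isotropy_tor`). So the measure of the fibre over `x` is proportional to
`w_x` (`exists_measure_fibre_eq`), which is the formula for `γ_L` after normalization
(`gammaL_eq`). An invariant measure on the orbit is obtained by pushing forward the product of a
Haar measure with a partition of unity along the discrete subgroup of rational points
(`exists_periodization_eq_one`, `exists_invariant_measure`, `exists_isOrbitHaar`).
-/


noncomputable section

namespace Packets

/-! ### Finite adeles -/

section Adeles

open IsDedekindDomain IsDedekindDomain.HeightOneSpectrum RestrictedProduct Filter Topology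

instance : T2Space FinAdele := inferInstanceAs <|
  T2Space <| Πʳ v : HeightOneSpectrum ℤ, [v.adicCompletion ℚ, v.adicCompletionIntegers ℚ]

theorem isOpen_adicIntegers (v : HeightOneSpectrum ℤ) :
    IsOpen (v.adicCompletionIntegers ℚ : Set (v.adicCompletion ℚ)) :=
  Valued.isOpen_valuationSubring _

instance compactSpace_adicIntegers (v : HeightOneSpectrum ℤ) :
    CompactSpace (v.adicCompletionIntegers ℚ : Set (v.adicCompletion ℚ)) := by
  have : Fact (Nat.Prime (Rat.HeightOneSpectrum.primesEquiv v : ℕ)) :=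
    ⟨(Rat.HeightOneSpectrum.primesEquiv v).2⟩
  rw [← isCompact_iff_compactSpace]
  have hc : IsCompact (PadicInt.subring (Rat.HeightOneSpectrum.primesEquiv v : ℕ) :
      Set ℚ_[(Rat.HeightOneSpectrum.primesEquiv v : ℕ)]) :=
    isCompact_iff_compactSpace.mpr
      (PadicInt.compactSpace (Rat.HeightOneSpectrum.primesEquiv v : ℕ))
  have hb := Rat.HeightOneSpectrum.adicCompletion.padicEquiv_bijOn v
  let e := (Rat.HeightOneSpectrum.adicCompletion.padicEquiv v).toHomeomorph
  have he : (v.adicCompletionIntegers ℚ : Set (v.adicCompletion ℚ)) = e ⁻¹'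
      (PadicInt.subring (Rat.HeightOneSpectrum.primesEquiv v : ℕ)) := by
    ext x
    refine ⟨fun hx => hb.mapsTo hx, fun hx => ?_⟩
    obtain ⟨y, hy, hyx⟩ := hb.surjOn hx
    rwa [← e.injective hyx]
  rw [he]
  exact e.isCompact_preimage.mpr hc

theorem isOpen_zhat : IsOpen (zhat : Set FinAdele) :=
  RestrictedProduct.isOpen_forall_mem (R := fun v : HeightOneSpectrum ℤ => v.adicCompletion ℚ)
    (A := fun v => (v.adicCompletionIntegers ℚ : Set (v.adicCompletion ℚ))) isOpen_adicIntegers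

theorem isCompact_zhat : IsCompact (zhat : Set FinAdele) := by
  have h := isCompact_range (RestrictedProduct.isEmbedding_structureMap
    (R := fun v : HeightOneSpectrum ℤ => v.adicCompletion ℚ)
    (A := fun v => (v.adicCompletionIntegers ℚ : Set (v.adicCompletion ℚ)))
    (𝓕 := cofinite)).continuous
  rw [RestrictedProduct.range_structureMap] at h
  exact h

theorem algebraMap_mem_zhat_iff {q : ℚ} :
    algebraMap ℚ FinAdele q ∈ zhat ↔ ∃ z : ℤ, (z : ℚ) = q := by
  have h : algebraMap ℚ FinAdele q ∈ zhat ↔ ∀ v : HeightOneSpectrum ℤ, v.valuation ℚ q ≤ 1 := by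
    refine forall_congr' fun v => ?_
    rw [FiniteAdeleRing.algebraMap_apply, mem_adicCompletionIntegers,
      valuedAdicCompletion_eq_valuation']
  rw [h]
  constructor
  · intro hq
    obtain ⟨z, hz⟩ := IsDedekindDomain.HeightOneSpectrum.mem_integers_of_valuation_le_one ℚ q hq
    exact ⟨z, by simpa using hz⟩
  · rintro ⟨z, rfl⟩ v
    exact v.valuation_le_one z

theorem algebraMap_finAdele_injective : Function.Injective (algebraMap ℚ FinAdele) := by
  have : Nontrivial FinAdele := by
    refine ⟨0, 1, fun h => ?_⟩
    have h2 : Nat.Prime 2 := Nat.prime_two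
    let v := (Rat.HeightOneSpectrum.primesEquiv (R := ℤ)).symm ⟨2, h2⟩
    have := congrArg (fun x : FinAdele => x v) h
    exact zero_ne_one this
  exact (algebraMap ℚ FinAdele).injective

/-- The finite adeles are the localization `ℚ ⊗ Ẑ`: only finitely many components of `x` have a
denominator, and these denominators are cleared by the product of local ones. -/
theorem exists_mul_mem_zhat (x : FinAdele) : ∃ N : ℕ, 0 < N ∧ (N : FinAdele) * x ∈ zhat := by
  classical
  have hfin : {v | x v ∉ v.adicCompletionIntegers ℚ}.Finite := by
    have := x.2
    rwa [eventually_cofinite] at this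
  have hloc : ∀ v : HeightOneSpectrum ℤ, ∃ N : ℕ, 0 < N ∧
      (N : v.adicCompletion ℚ) * x v ∈ v.adicCompletionIntegers ℚ := by
    intro v
    obtain ⟨z, hz, hx⟩ := adicCompletion.mul_nonZeroDivisor_mem_adicCompletionIntegers v (x v)
    refine ⟨z.natAbs, Int.natAbs_pos.mpr (nonZeroDivisors.ne_zero hz), ?_⟩
    have hz' : (algebraMap ℤ (v.adicCompletion ℚ)) z = (z : v.adicCompletion ℚ) := eq_intCast _ z
    change x v * algebraMap ℤ (v.adicCompletion ℚ) z ∈ v.adicCompletionIntegers ℚ at hx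
    rw [mul_comm, hz'] at hx
    rcases Int.natAbs_eq z with h | h
    · rw [h, Int.cast_natCast] at hx
      exact hx
    · rw [h, Int.cast_neg, Int.cast_natCast, neg_mul] at hx
      exact neg_mem_iff.mp hx
  choose N hN hN' using hloc
  refine ⟨∏ v ∈ hfin.toFinset, N v, Finset.prod_pos fun v _ => hN v, fun v => ?_⟩
  have hm : (((∏ v ∈ hfin.toFinset, N v : ℕ) : FinAdele) * x) v =
    ((∏ v ∈ hfin.toFinset, N v : ℕ) : v.adicCompletion ℚ) * x v := rfl
  rw [hm]
  by_cases hv : x v ∈ v.adicCompletionIntegers ℚ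
  · exact mul_mem (natCast_mem _ _) hv
  · rw [← Finset.prod_erase_mul _ _ (hfin.mem_toFinset.mpr hv), Nat.cast_mul, mul_assoc]
    exact mul_mem (natCast_mem _ _) (hN' v)

theorem isUnit_natCast_finAdele {N : ℕ} (hN : 0 < N) : IsUnit (N : FinAdele) := by
  have h : IsUnit (N : ℚ) := (Nat.cast_ne_zero.mpr hN.ne').isUnit
  simpa using h.map (algebraMap ℚ FinAdele)

instance : SigmaCompactSpace FinAdele := by
  refine ⟨⟨fun N => {x | ((N + 1 : ℕ) : FinAdele) * x ∈ zhat}, fun N => ?_, ?_⟩⟩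
  · obtain ⟨u, hu⟩ := isUnit_natCast_finAdele N.succ_pos
    have : {x : FinAdele | ((N + 1 : ℕ) : FinAdele) * x ∈ zhat} =
        Units.mulLeft u⁻¹ '' (zhat : Set FinAdele) := by
      ext x
      rw [← Nat.succ_eq_add_one, ← hu]
      constructor
      · intro hx
        exact ⟨_, hx, by simp⟩
      · rintro ⟨y, hy, rfl⟩
        simpa using hy
    change IsCompact {x : FinAdele | ((N + 1 : ℕ) : FinAdele) * x ∈ zhat}
    rw [this]
    exact isCompact_zhat.image (continuous_const.mul continuous_id)
  · refine Set.eq_univ_of_forall fun x => ?_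
    obtain ⟨N, hN, hx⟩ := exists_mul_mem_zhat x
    refine Set.mem_iUnion.mpr ⟨N - 1, ?_⟩
    change ((N - 1 + 1 : ℕ) : FinAdele) * x ∈ zhat
    rwa [Nat.sub_add_cancel hN]

/-- The diagonal embedding of `ℚ ^ ι` into `𝔸 ^ ι`. -/
def ratVec (ι : Type) : (ι → ℚ) →+ (ι → ℝ) × (ι → FinAdele) where
  toFun q := (fun i => algebraMap ℚ ℝ (q i), fun i => algebraMap ℚ FinAdele (q i))
  map_zero' := by ext <;> simp
  map_add' p q := by ext <;> simp

/-- `ℚ ^ ι` is discrete in `𝔸 ^ ι`; stated in the form that each of its subsets is closed. -/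
theorem isClosed_image_ratVec {ι : Type} [Finite ι] (A : Set (ι → ℚ)) :
    IsClosed (ratVec ι '' A) := by
  let D := (ratVec ι).range
  have hV : IsOpen {x : (ι → ℝ) × (ι → FinAdele) | (∀ i, |x.1 i| < 1) ∧ ∀ i, x.2 i ∈ zhat} := by
    simp only [Set.ofPred_and, Set.ofPred_forall]
    refine (isOpen_iInter_of_finite fun i => ?_).inter (isOpen_iInter_of_finite fun i => ?_)
    · exact isOpen_lt (by fun_prop) continuous_const
    · exact isOpen_zhat.preimage ((continuous_apply i).comp continuous_snd)
  have hD : DiscreteTopology D := by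
    refine discreteTopology_of_isOpen_singleton_zero ?_
    convert hV.preimage (continuous_subtype_val (p := (· ∈ D)))
    ext ⟨x, q, rfl⟩
    simp only [Set.mem_singleton_iff, Set.mem_preimage, Set.mem_ofPred_eq]
    constructor
    · intro h
      have h0 := congrArg Subtype.val h
      simp only [AddSubgroup.coe_zero] at h0
      rw [h0]
      exact ⟨fun i => by simp, fun i => zero_mem _⟩
    · rintro ⟨h1, h2⟩
      have : q = 0 := by
        funext i
        obtain ⟨z, hz⟩ := algebraMap_mem_zhat_iff.mp (h2 i)
        have h3 := h1 i
        simp only [ratVec, AddMonoidHom.coe_mk, ZeroHom.coe_mk, ← hz, eq_ratCast,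
          Rat.cast_intCast] at h3
        have h4 : |z| < 1 := by exact_mod_cast h3
        rw [← hz, Int.abs_lt_one_iff.mp h4]
        simp
      subst this
      exact Subtype.ext (map_zero _)
  have hcl : IsClosed (D : Set ((ι → ℝ) × (ι → FinAdele))) := AddSubgroup.isClosed_of_discrete
  have key : IsClosed (Subtype.val '' (Subtype.val ⁻¹' (ratVec ι '' A) : Set D)) :=
    hcl.isClosedEmbedding_subtypeVal.isClosedMap _ (isClosed_discrete _)
  have hA : (Subtype.val '' (Subtype.val ⁻¹' (ratVec ι '' A) : Set D)) = ratVec ι '' A := by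
    rw [Set.image_preimage_eq_inter_range, Set.inter_eq_left]
    rintro _ ⟨q, -, rfl⟩
    exact ⟨⟨_, q, rfl⟩, rfl⟩
  rwa [hA] at key

theorem ratVec_injective {ι : Type} : Function.Injective (ratVec ι) := by
  intro p q h
  funext i
  exact algebraMap_finAdele_injective (congrFun (congrArg Prod.snd h) i)

open Classical in
/-- For a finite set of finite adeles there is an idempotent `e` such that the adeles are
integral away from `e`, while the `e`-part of `𝔸_f` is von Neumann regular. -/
theorem exists_idempotent_integral_away {ι : Type*} [Finite ι] (x : ι → FinAdele) :
    ∃ e : FinAdele, e * e = e ∧ (∀ i, (1 - e) * x i ∈ zhat) ∧ e ∈ zhat ∧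
      ∀ a : FinAdele, ∃ y, e * (a * y * a) = e * a := by
  have hfin : {v | ∃ i, x i v ∉ v.adicCompletionIntegers ℚ}.Finite := by
    rw [Set.ofPred_exists]
    refine Set.finite_iUnion fun i => ?_
    have := (x i).2
    rwa [eventually_cofinite] at this
  set S := {v | ∃ i, x i v ∉ v.adicCompletionIntegers ℚ}
  let e : FinAdele := ⟨fun v => if v ∈ S then 1 else 0, .of_forall fun v => by
    dsimp only
    split_ifs
    exacts [one_mem _, zero_mem _]⟩
  have he : ∀ v, e v = if v ∈ S then 1 else 0 := fun v => rfl
  refine ⟨e, ?_, ?_, ?_, ?_⟩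
  · refine FiniteAdeleRing.ext ℚ fun v => ?_
    change e v * e v = e v
    rw [he]
    split_ifs <;> simp
  · intro i v
    change (1 - e v) * x i v ∈ _
    rw [he]
    split_ifs with h
    · simp
    · simp only [S, Set.mem_ofPred_eq, not_exists, not_not] at h
      simpa using h i
  · intro v
    rw [he]
    split_ifs
    exacts [one_mem _, zero_mem _]
  · intro a
    refine ⟨⟨fun v => if v ∈ S then (a v)⁻¹ else 0, ?_⟩, ?_⟩
    · rw [eventually_cofinite]
      refine hfin.subset fun v hv => ?_
      by_contra h
      simp [h] at hv
    · refine FiniteAdeleRing.ext ℚ fun v => ?_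
      change e v * (a v * (if v ∈ S then (a v)⁻¹ else 0) * a v) = e v * a v
      rw [he]
      split_ifs
      · simp
      · simp

end Adeles

/-! ### The Clifford algebra in coordinates -/

section Clifford

variable {k m : ℕ} (Q : QuadraticForm ℤ (Idx k m → ℤ))

/-- The module `Cl(Q)` is free over `ℤ`, being linearly isomorphic to the exterior algebra through a
change of form; this uses that `Q` comes from a (not necessarily symmetric) bilinear form over `ℤ`.
-/
theorem exists_basis_clifford :
    ∃ (n : ℕ), Nonempty (Module.Basis (Fin n) ℤ (CliffordAlgebra Q)) := by
  obtain ⟨B, hB⟩ := LinearMap.BilinMap.toQuadraticMap_surjective (0 - Q)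
  let e : CliffordAlgebra Q ≃ₗ[ℤ] ExteriorAlgebra ℤ (Idx k m → ℤ) :=
    CliffordAlgebra.changeFormEquiv hB
  let b : Module.Basis (Idx k m) ℤ (Idx k m → ℤ) := Pi.basisFun ℤ _
  let b' : Module.Basis (Fin (k + m)) ℤ (Idx k m → ℤ) := b.reindex finSumFinEquiv
  let c := b'.ExteriorAlgebra.map e.symm
  exact ⟨_, ⟨c.reindex (Fintype.equivFin _)⟩⟩

/-- The rank of the free `ℤ`-module `Cl(Q)`. -/
def clRank : ℕ := (exists_basis_clifford Q).choose

/-- A `ℤ`-basis of `Cl(Q)`, fixed once and for all; it gives compatible coordinates on `Cl(Q_R)` for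
all `R`, so that integrality and boundedness can be read off from coordinates. -/
def clBasis : Module.Basis (Fin (clRank Q)) ℤ (CliffordAlgebra Q) :=
  (exists_basis_clifford Q).choose_spec.some

instance : Module.Finite ℤ (CliffordAlgebra Q) := .of_basis (clBasis Q)

/-- Coordinates on `Cl(Q_R)`. -/
def clCrd (R : Type) [CommRing R] : Cl Q R ≃ₗ[R] (Fin (clRank Q) → R) :=
  ((clBasis Q).baseChange R).equivFun

variable {Q}

theorem clCrd_tmul {R : Type} [CommRing R] (r : R) (c : CliffordAlgebra Q)
    (i : Fin (clRank Q)) : clCrd Q R (r ⊗ₜ c) i = ((clBasis Q).repr c i : ℤ) * r := by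
  simp [clCrd, Module.Basis.baseChange_repr_tmul]

theorem clCrd_clMap {R S : Type} [CommRing R] [CommRing S] (f : R →+* S) (x : Cl Q R)
    (i : Fin (clRank Q)) : clCrd Q S (clMap Q f x) i = f (clCrd Q R x i) := by
  induction x using TensorProduct.induction_on with
  | zero => simp
  | add a b ha hb => simp [ha, hb]
  | tmul r c => simp [clMap, clCrd_tmul]

theorem clMap_injective {R S : Type} [CommRing R] [CommRing S] {f : R →+* S}
    (hf : Function.Injective f) : Function.Injective (clMap Q f) := by
  intro x y h
  refine (clCrd Q R).injective (funext fun i => hf ?_)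
  rw [← clCrd_clMap, ← clCrd_clMap, h]

theorem exists_clMap_eq {R S : Type} [CommRing R] [CommRing S] {f : R →+* S} {x : Cl Q S}
    (hx : ∀ i, clCrd Q S x i ∈ f.range) : ∃ y, clMap Q f y = x := by
  choose c hc using hx
  refine ⟨(clCrd Q R).symm c, (clCrd Q S).injective (funext fun i => ?_)⟩
  rw [clCrd_clMap, LinearEquiv.apply_symm_apply, hc]

theorem scalar_comm {R : Type} [CommRing R] (r : R) (z : Cl Q R) :
    z * (r ⊗ₜ[ℤ] (1 : CliffordAlgebra Q)) = (r ⊗ₜ[ℤ] (1 : CliffordAlgebra Q)) * z := by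
  induction z using TensorProduct.induction_on with
  | zero => simp
  | add a b ha hb => simp [add_mul, mul_add, ha, hb]
  | tmul r c => simp [mul_comm]

/-- Base change of a `ℤ`-linear endomorphism of `Cl(Q)` is compatible with `clMap`. -/
theorem baseChange_clMap {R S : Type} [CommRing R] [CommRing S] (f : R →+* S)
    (φ : CliffordAlgebra Q →ₗ[ℤ] CliffordAlgebra Q) (x : Cl Q R) :
    φ.baseChange S (clMap Q f x) = clMap Q f (φ.baseChange R x) := by
  induction x using TensorProduct.induction_on with
  | zero => simp
  | add a b ha hb => simp [ha, hb]
  | tmul r c => simp [clMap]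

variable (Q)

/-- The projection of `Cl(Q)` onto its even part. -/
def evenProj : CliffordAlgebra Q →ₗ[ℤ] CliffordAlgebra Q :=
  GradedAlgebra.proj (CliffordAlgebra.evenOdd Q) 0

variable {Q}

theorem evenProj_mem (c : CliffordAlgebra Q) : evenProj Q c ∈ CliffordAlgebra.even Q :=
  (DirectSum.decompose (CliffordAlgebra.evenOdd Q) c 0).2

theorem evenProj_of_mem {c : CliffordAlgebra Q} (hc : c ∈ CliffordAlgebra.even Q) :
    evenProj Q c = c :=
  DirectSum.decompose_of_mem_same (CliffordAlgebra.evenOdd Q)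
    (show c ∈ CliffordAlgebra.evenOdd Q 0 from hc)

theorem mem_evenPart_iff {R : Type} [CommRing R] {x : Cl Q R} :
    x ∈ evenPart Q R ↔ (evenProj Q).baseChange R x = x := by
  constructor
  · rintro ⟨y, rfl⟩
    induction y using TensorProduct.induction_on with
    | zero => simp
    | add a b ha hb => simpa using congrArg₂ (· + ·) ha hb
    | tmul r c => simp [evenProj_of_mem c.2]
  · intro h
    rw [← h]
    clear h
    induction x using TensorProduct.induction_on with
    | zero => simp
    | add a b ha hb => rw [map_add]; exact add_mem ha hb
    | tmul r c => exact ⟨r ⊗ₜ ⟨_, evenProj_mem c⟩, by simp⟩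

theorem rev_mem_evenPart {R : Type} [CommRing R] {x : Cl Q R} (hx : x ∈ evenPart Q R) :
    rev Q R x ∈ evenPart Q R := by
  obtain ⟨y, rfl⟩ := hx
  induction y using TensorProduct.induction_on with
  | zero => simp
  | add a b ha hb => simpa using add_mem ha hb
  | tmul r c =>
    refine ⟨r ⊗ₜ ⟨CliffordAlgebra.reverse c.1, ?_⟩, ?_⟩
    · exact (CliffordAlgebra.reverse_mem_evenOdd_iff Q).mpr c.2
    · simp [rev_tmul]

/-- An element of `Spin_Q(R)` from its defining equations. -/
def mkSpin {R : Type} [CommRing R] (x : Cl Q R) (M : Matrix (Idx k m) (Idx k m) R)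
    (hx : x ∈ evenPart Q R) (h1 : x * rev Q R x = 1) (h2 : rev Q R x * x = 1)
    (hM : M.det = 1) (hv : ∀ v, x * vec Q v = vec Q (M.mulVec v) * x) : Spin Q R :=
  ⟨(⟨x, rev Q R x, h1, h2⟩, ⟨M, hM⟩), ⟨hx, rev_mem_evenPart hx⟩, rfl, hv⟩

theorem spin_mul_rev {R : Type} [CommRing R] (h : Spin Q R) :
    (h.1.1 : Cl Q R) * rev Q R h.1.1 = 1 := by
  rw [h.2.2.1]
  exact Units.mul_inv _

theorem spin_rev_mul {R : Type} [CommRing R] (h : Spin Q R) :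
    rev Q R h.1.1 * (h.1.1 : Cl Q R) = 1 := by
  rw [h.2.2.1]
  exact Units.inv_mul _

theorem spin_mul_vec {R : Type} [CommRing R] (h : Spin Q R) (v : Idx k m → R) :
    (h.1.1 : Cl Q R) * vec Q v = vec Q ((spinMat Q R h).1.mulVec v) * (h.1.1 : Cl Q R) :=
  h.2.2.2 v

theorem spin_ext {R : Type} [CommRing R] {g h : Spin Q R}
    (h1 : (g.1.1 : Cl Q R) = h.1.1) (h2 : (spinMat Q R g).1 = (spinMat Q R h).1) : g = h :=
  Subtype.ext (Prod.ext (Units.ext h1) (Subtype.ext h2))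

variable (Q) in
/-- The index set of the coordinates of `Cl(Q_R) × M_n(R)`. -/
abbrev SpinIdx : Type := Fin (clRank Q) ⊕ (Idx k m × Idx k m)

variable (Q) in
/-- The coordinates of an element of `Spin_Q(R)`. -/
def spinCrd (R : Type) [CommRing R] (h : Spin Q R) : SpinIdx Q → R :=
  Sum.elim (clCrd Q R h.1.1) fun p => (spinMat Q R h).1 p.1 p.2

theorem spinCrd_injective {R : Type} [CommRing R] : Function.Injective (spinCrd Q R) := by
  intro g h e
  refine spin_ext ((clCrd Q R).injective (funext fun i => congrFun e (.inl i))) ?_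
  ext i j
  exact congrFun e (.inr (i, j))

theorem spinCrd_spinMap {R S : Type} [CommRing R] [CommRing S] (f : R →+* S) (h : Spin Q R)
    (i : SpinIdx Q) : spinCrd Q S (spinMap Q f h) i = f (spinCrd Q R h i) := by
  rcases i with i | p
  · exact clCrd_clMap f _ i
  · rfl

/-- An element of `Spin_Q(S)` all of whose coordinates lie in a subring `R` of `S` is defined
over `R`. -/
theorem exists_spinMap_eq {R S : Type} [CommRing R] [CommRing S] {f : R →+* S}
    (hf : Function.Injective f) {h : Spin Q S} (hh : ∀ i, spinCrd Q S h i ∈ f.range) :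
    ∃ h', spinMap Q f h' = h := by
  obtain ⟨x, hx⟩ := exists_clMap_eq (x := (h.1.1 : Cl Q S)) fun i => hh (.inl i)
  choose M hM using fun i j => hh (.inr (i, j))
  have hM' : f.mapMatrix (Matrix.of M) = (spinMat Q S h).1 := by
    ext i j
    exact hM i j
  have hf' := clMap_injective (Q := Q) hf
  refine ⟨mkSpin x (Matrix.of M) ?_ ?_ ?_ ?_ fun v => ?_, spin_ext hx hM'⟩
  · rw [mem_evenPart_iff]
    apply hf'
    rw [← baseChange_clMap, hx]
    exact mem_evenPart_iff.mp h.2.1.1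
  · apply hf'
    rw [map_mul, clMap_rev, hx, spin_mul_rev, map_one]
  · apply hf'
    rw [map_mul, clMap_rev, hx, spin_rev_mul, map_one]
  · apply hf
    rw [RingHom.map_det, hM', map_one]
    exact (spinMat Q S h).2
  · apply hf'
    rw [map_mul, map_mul, clMap_vec, clMap_vec, hx, spin_mul_vec, ← hM']
    congr 2
    ext i
    exact (RingHom.map_mulVec f (Matrix.of M) v i).symm

end Clifford

section SpinTopology

variable {k m : ℕ} {Q : QuadraticForm ℤ (Idx k m → ℤ)}
variable {R : Type} [CommRing R] [TopologicalSpace R] [IsTopologicalRing R]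

/-- The canonical topology of `Cl(Q_R)`. -/
local instance clTopology : TopologicalSpace (Cl Q R) := moduleTopology R (Cl Q R)

local instance : IsModuleTopology R (Cl Q R) := ⟨rfl⟩

local instance : IsTopologicalRing (Cl Q R) := IsModuleTopology.isTopologicalRing R _

theorem continuous_clCrd : Continuous (clCrd Q R) :=
  IsModuleTopology.continuous_of_linearMap (clCrd Q R).toLinearMap

theorem continuous_clCrd_symm : Continuous (clCrd Q R).symm :=
  IsModuleTopology.continuous_of_linearMap (clCrd Q R).symm.toLinearMap

theorem continuous_rev : Continuous (rev Q R) :=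
  IsModuleTopology.continuous_of_linearMap ((CliffordAlgebra.reverse (Q := Q)).baseChange R)

omit [IsTopologicalRing R] in
theorem isInducing_spin : Topology.IsInducing
    (fun h : Spin Q R => ((h.1.1 : Cl Q R), (h.1.2.1 : Matrix (Idx k m) (Idx k m) R))) := ⟨rfl⟩

instance : IsTopologicalGroup (Spin Q R) where
  continuous_mul := by
    rw [isInducing_spin.continuous_iff]
    have h1 := (isInducing_spin (Q := Q) (R := R)).continuous
    exact (((continuous_fst.comp h1).comp continuous_fst).mul
      ((continuous_fst.comp h1).comp continuous_snd)).prodMk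
      (((continuous_snd.comp h1).comp continuous_fst).mul
      ((continuous_snd.comp h1).comp continuous_snd))
  continuous_inv := by
    rw [isInducing_spin.continuous_iff]
    have h1 := (isInducing_spin (Q := Q) (R := R)).continuous
    have h2 : Continuous fun h : Spin Q R => (h.1.2.1).adjugate :=
      (continuous_snd.comp h1).matrix_adjugate
    refine ((continuous_rev.comp (continuous_fst.comp h1)).prodMk h2).congr fun h => ?_
    refine Prod.ext h.2.2.1 ?_
    exact (Matrix.SpecialLinearGroup.coe_inv h.1.2).symm

omit [IsTopologicalRing R] in
theorem continuous_spinMat : Continuous (spinMat Q R) :=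
  continuous_induced_rng.mpr (continuous_snd.comp isInducing_spin.continuous)

/-- The homeomorphism of `Cl(Q_R) × M_n(R)` with affine space given by the coordinates. -/
def crdHomeo : Cl Q R × Matrix (Idx k m) (Idx k m) R ≃ₜ (SpinIdx Q → R) where
  toFun p := Sum.elim (clCrd Q R p.1) fun q => p.2 q.1 q.2
  invFun c := ((clCrd Q R).symm fun i => c (.inl i), Matrix.of fun i j => c (.inr (i, j)))
  left_inv p := by
    refine Prod.ext ?_ ?_
    · simp
    · ext i j
      simp
  right_inv c := by
    ext (i | p) <;> simp
  continuous_toFun := by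
    refine continuous_pi fun i => ?_
    rcases i with i | q
    · exact (continuous_apply i).comp (continuous_clCrd.comp continuous_fst)
    · exact continuous_snd.matrix_elem q.1 q.2
  continuous_invFun := by
    refine (continuous_clCrd_symm.comp (by fun_prop)).prodMk ?_
    exact continuous_matrix fun i j => by fun_prop

variable [T2Space R]

/-- The group `Spin_Q(R)` is a closed subset of affine space: the inverse of an element is its
reversal, so all defining conditions are closed conditions on `(x, M)`. -/
theorem isClosedEmbedding_spinCrd : Topology.IsClosedEmbedding (spinCrd Q R) := by
  have hT2 : T2Space (Cl Q R) :=
    T2Space.of_injective_continuous (clCrd Q R).injective continuous_clCrd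
  have hind : Topology.IsInducing (spinCrd Q R) := by
    have h1 := (crdHomeo (Q := Q) (R := R)).isInducing.comp
      (isInducing_spin (Q := Q) (R := R))
    have h2 : spinCrd Q R = crdHomeo ∘
      fun h : Spin Q R => ((h.1.1 : Cl Q R), (h.1.2.1 : Matrix (Idx k m) (Idx k m) R)) := by
      funext h
      rfl
    rw [h2]
    exact h1
  refine ⟨⟨hind, spinCrd_injective⟩, ?_⟩
  have : Set.range (spinCrd Q R) = crdHomeo.symm ⁻¹'
      {p : Cl Q R × Matrix (Idx k m) (Idx k m) R |
        (((evenProj Q).baseChange R p.1 = p.1 ∧ p.1 * rev Q R p.1 = 1) ∧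
          (rev Q R p.1 * p.1 = 1 ∧ p.2.det = 1)) ∧
        ∀ v, p.1 * vec Q v = vec Q (p.2.mulVec v) * p.1} := by
    ext c
    constructor
    · rintro ⟨h, rfl⟩
      have : crdHomeo.symm (spinCrd Q R h) = ((h.1.1 : Cl Q R), (spinMat Q R h).1) :=
        crdHomeo.symm_apply_apply ((h.1.1 : Cl Q R), (spinMat Q R h).1)
      rw [Set.mem_preimage, this]
      exact ⟨⟨⟨mem_evenPart_iff.mp h.2.1.1, spin_mul_rev h⟩, spin_rev_mul h, (spinMat Q R h).2⟩,
        spin_mul_vec h⟩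
    · rintro ⟨⟨⟨h1, h2⟩, h3, h4⟩, h5⟩
      exact ⟨mkSpin _ _ (mem_evenPart_iff.mpr h1) h2 h3 h4 h5, crdHomeo.apply_symm_apply c⟩
  rw [this]
  have hr : Continuous fun p : Cl Q R × Matrix (Idx k m) (Idx k m) R => rev Q R p.1 :=
    continuous_rev.comp continuous_fst
  have hvec : Continuous fun v : Idx k m → R => vec Q v := by
    have : ∀ v : Idx k m → R, vec Q v = ∑ i, v i • ((1 : R) ⊗ₜ[ℤ]
        CliffordAlgebra.ι Q (Pi.single i 1)) := by
      intro v
      simp [vec, TensorProduct.smul_tmul']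
    simp only [this]
    fun_prop
  refine IsClosed.preimage crdHomeo.symm.continuous ?_
  refine (((isClosed_eq ?_ continuous_fst).inter (isClosed_eq ?_ continuous_const)).inter
    ((isClosed_eq ?_ continuous_const).inter (isClosed_eq ?_ continuous_const))).inter ?_
  · exact (IsModuleTopology.continuous_of_linearMap
      ((evenProj Q).baseChange R)).comp continuous_fst
  · exact continuous_fst.mul hr
  · exact hr.mul continuous_fst
  · exact continuous_snd.matrix_det
  · change IsClosed {p : Cl Q R × Matrix (Idx k m) (Idx k m) R |
      ∀ v, p.1 * vec Q v = vec Q (p.2.mulVec v) * p.1}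
    rw [Set.ofPred_forall]
    refine isClosed_iInter fun v => isClosed_eq (by fun_prop) ?_
    exact (hvec.comp (continuous_snd.matrix_mulVec continuous_const)).mul continuous_fst

end SpinTopology

/-! ### The Gram matrix -/

section Gram

variable {k m : ℕ} (Q : QuadraticForm ℤ (Idx k m → ℤ))

/-- The Gram matrix over `R` of the polar form of `Q`, i.e. of `2 B_Q`. -/
def gram (R : Type) [CommRing R] : Matrix (Idx k m) (Idx k m) R :=
  Matrix.of fun i j => ((QuadraticMap.polar Q (Pi.single i 1) (Pi.single j 1) : ℤ) : R)

variable {Q}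

theorem gram_map {R S : Type} [CommRing R] [CommRing S] (f : R →+* S) :
    f.mapMatrix (gram Q R) = gram Q S := by
  ext i j
  simp [gram]

theorem gram_transpose {R : Type} [CommRing R] : (gram Q R).transpose = gram Q R := by
  ext i j
  simp [gram, QuadraticMap.polar_comm]

/-- The Clifford relation, polarized: `v w + w v` is the scalar `2 B_Q(v, w)`. -/
theorem vec_mul_vec_add {R : Type} [CommRing R] (v w : Idx k m → R) :
    vec Q v * vec Q w + vec Q w * vec Q v =
      (v ⬝ᵥ (gram Q R).mulVec w) ⊗ₜ[ℤ] (1 : CliffordAlgebra Q) := by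
  have h1 : ∀ v w : Idx k m → R, vec Q v * vec Q w = ∑ i, ∑ j, (v i * w j) ⊗ₜ[ℤ]
      (CliffordAlgebra.ι Q (Pi.single i 1) * CliffordAlgebra.ι Q (Pi.single j 1)) := by
    intro v w
    rw [vec, vec, Finset.sum_mul_sum]
    simp only [Algebra.TensorProduct.tmul_mul_tmul]
  rw [h1, h1 w v, Finset.sum_comm (f := fun i j => (w i * v j) ⊗ₜ[ℤ]
      (CliffordAlgebra.ι Q (Pi.single i 1) * CliffordAlgebra.ι Q (Pi.single j 1))),
    ← Finset.sum_add_distrib]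
  simp only [dotProduct, Matrix.mulVec, Finset.mul_sum, TensorProduct.sum_tmul]
  refine Finset.sum_congr rfl fun i _ => ?_
  rw [← Finset.sum_add_distrib]
  refine Finset.sum_congr rfl fun j _ => ?_
  rw [mul_comm (w j), ← TensorProduct.tmul_add, CliffordAlgebra.ι_mul_ι_add_swap,
    Algebra.algebraMap_eq_smul_one, TensorProduct.tmul_smul, TensorProduct.smul_tmul']
  congr 1
  simp [gram]
  ring

/-- Some coordinate of `1 ∈ Cl(Q)` is a nonzero integer, which is invertible in a `ℚ`-algebra. -/
theorem scalar_injective {R : Type} [CommRing R] [Algebra ℚ R] :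
    Function.Injective fun r : R => r ⊗ₜ[ℤ] (1 : CliffordAlgebra Q) := by
  obtain ⟨B, hB⟩ := LinearMap.BilinMap.toQuadraticMap_surjective (0 - Q)
  let e : CliffordAlgebra Q ≃ₗ[ℤ] ExteriorAlgebra ℤ (Idx k m → ℤ) :=
    CliffordAlgebra.changeFormEquiv hB
  have h1 : (1 : CliffordAlgebra Q) ≠ 0 := by
    intro h
    have := congrArg e h
    rw [map_zero, CliffordAlgebra.changeFormEquiv_apply, CliffordAlgebra.changeForm_one] at this
    exact one_ne_zero this
  obtain ⟨i, hi⟩ : ∃ i, (clBasis Q).repr 1 i ≠ 0 := by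
    by_contra! h
    exact h1 ((clBasis Q).repr.injective (by ext i; simpa using h i))
  intro r s h
  have h2 := congrFun (congrArg (clCrd Q R) h) i
  simp only [clCrd_tmul] at h2
  have hu : IsUnit (((clBasis Q).repr 1 i : ℤ) : R) := by
    have : IsUnit (((clBasis Q).repr 1 i : ℤ) : ℚ) := (Int.cast_ne_zero.mpr hi).isUnit
    simpa using this.map (algebraMap ℚ R)
  exact hu.mul_left_cancel h2

theorem matrix_eq_of_dotProduct {R : Type} [CommRing R] {A B : Matrix (Idx k m) (Idx k m) R}
    (h : ∀ v w, v ⬝ᵥ A.mulVec w = v ⬝ᵥ B.mulVec w) : A = B := by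
  ext i j
  have := h (Pi.single i 1) (Pi.single j 1)
  simpa using this

/-- `Spin_Q(R)` acts on `R ^ n` by isometries of `Q`. -/
theorem spinMat_gram {R : Type} [CommRing R] [Algebra ℚ R] (h : Spin Q R) :
    (spinMat Q R h).1.transpose * gram Q R * (spinMat Q R h).1 = gram Q R := by
  refine matrix_eq_of_dotProduct fun v w => ?_
  set M := (spinMat Q R h).1
  have h0 : ∀ v w, (h.1.1 : Cl Q R) * (vec Q v * vec Q w) =
      vec Q (M.mulVec v) * vec Q (M.mulVec w) * (h.1.1 : Cl Q R) := by
    intro v w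
    have e1 : (h.1.1 : Cl Q R) * vec Q v = vec Q (M.mulVec v) * h.1.1 := spin_mul_vec h v
    have e2 : (h.1.1 : Cl Q R) * vec Q w = vec Q (M.mulVec w) * h.1.1 := spin_mul_vec h w
    rw [← mul_assoc, e1, mul_assoc, e2, mul_assoc]
  have h1 : (h.1.1 : Cl Q R) * (vec Q v * vec Q w + vec Q w * vec Q v) =
      (vec Q (M.mulVec v) * vec Q (M.mulVec w) + vec Q (M.mulVec w) * vec Q (M.mulVec v)) *
        (h.1.1 : Cl Q R) := by
    rw [mul_add, add_mul, h0, h0]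
  rw [vec_mul_vec_add, vec_mul_vec_add, scalar_comm] at h1
  have h2 := scalar_injective (h.1.1.isUnit.mul_right_cancel h1)
  rw [h2, ← Matrix.mulVec_mulVec, ← Matrix.mulVec_mulVec, Matrix.dotProduct_mulVec v,
    Matrix.vecMul_transpose]

theorem dotProduct_gram_self (z : Idx k m → ℤ) : z ⬝ᵥ (gram Q ℤ).mulVec z = 2 * Q z := by
  have h := LinearMap.BilinMap.toQuadraticMap_apply (QuadraticMap.polarBilin Q) z
  rw [QuadraticMap.toQuadraticMap_polarBilin] at h
  have hz : z = ∑ i, z i • (Pi.single i 1 : Idx k m → ℤ) := by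
    simpa using (pi_eq_sum_univ' z)
  have h2 : QuadraticMap.polarBilin Q z z = z ⬝ᵥ (gram Q ℤ).mulVec z := by
    conv_lhs => rw [hz]
    simp only [map_sum, LinearMap.sum_apply, map_smul, LinearMap.smul_apply, dotProduct,
      Matrix.mulVec, Finset.mul_sum, smul_eq_mul]
    rw [Finset.sum_comm]
    refine Finset.sum_congr rfl fun i _ => Finset.sum_congr rfl fun j _ => ?_
    simp [gram]
    ring
  rw [← h2, ← h]
  simp

/-- Positivity on `ℤ ^ n` passes to `ℚ ^ n` by clearing denominators. -/
theorem gram_posDef (hQ : Q.PosDef) (v : Idx k m → ℚ) (hv : v ≠ 0) :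
    0 < v ⬝ᵥ (gram Q ℚ).mulVec v := by
  obtain ⟨N, hN⟩ := IsLocalization.exist_integer_multiples_of_finite (nonZeroDivisors ℤ) v
  choose z hz using hN
  have hN0 : ((N : ℤ) : ℚ) ≠ 0 := Int.cast_ne_zero.mpr (nonZeroDivisors.ne_zero N.2)
  have hzv : ∀ i, ((z i : ℤ) : ℚ) = ((N : ℤ) : ℚ) * v i := by
    intro i
    have := hz i
    simpa [Submonoid.smul_def] using this
  have hz0 : z ≠ 0 := by
    rintro rfl
    refine hv (funext fun i => ?_)
    have := hzv i
    simpa [hN0] using this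
  have h1 : ((z ⬝ᵥ (gram Q ℤ).mulVec z : ℤ) : ℚ) =
      ((N : ℤ) : ℚ) ^ 2 * (v ⬝ᵥ (gram Q ℚ).mulVec v) := by
    simp only [dotProduct, Matrix.mulVec, Finset.mul_sum, gram, Matrix.of_apply]
    push_cast
    refine Finset.sum_congr rfl fun i _ => Finset.sum_congr rfl fun j _ => ?_
    rw [hzv, hzv]
    ring
  have h2 : (0 : ℚ) < ((z ⬝ᵥ (gram Q ℤ).mulVec z : ℤ) : ℚ) := by
    rw [dotProduct_gram_self]
    have := hQ z hz0
    exact_mod_cast (by omega : 0 < 2 * Q z)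
  rw [h1] at h2
  exact pos_of_mul_pos_right h2 (sq_nonneg _)

end Gram

section Adapted

variable {k m : ℕ} {Q : QuadraticForm ℤ (Idx k m → ℤ)} {L : Submodule ℚ (Idx k m → ℚ)}

variable (Q L) in
/-- A rational `Q`-orthogonal basis of `ℚ ^ n`, given by the columns of `U`, whose first `k`
members span `L` and whose other members span the orthogonal complement of `L`. The number `c i` is
the value of the polar form, i.e. of `2 Q`, at the `i`-th basis vector. -/
structure AdaptedBasis where
  U : Matrix (Idx k m) (Idx k m) ℚ
  c : Idx k m → ℚ
  c_pos : ∀ i, 0 < c i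
  orth : U.transpose * gram Q ℚ * U = Matrix.diagonal c
  span : Submodule.span ℚ (Set.range fun i : Fin k => U.col (Sum.inl i)) = L

theorem exists_adaptedBasis (hQ : Q.PosDef) (hL : Module.finrank ℚ L = k) :
    Nonempty (AdaptedBasis Q L) := by
  let B : LinearMap.BilinForm ℚ (Idx k m → ℚ) := Matrix.toBilin' (gram Q ℚ)
  have hB : ∀ v w, B v w = v ⬝ᵥ (gram Q ℚ).mulVec w := fun v w => Matrix.toBilin'_apply' _ _ _
  have hsymm : B.IsSymm := by
    refine ⟨fun v w => ?_⟩
    simp only [hB]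
    rw [Matrix.dotProduct_mulVec, ← Matrix.mulVec_transpose, gram_transpose, dotProduct_comm]
  have hpos : ∀ v, v ≠ 0 → 0 < B v v := fun v hv => by
    rw [hB]
    exact gram_posDef hQ v hv
  have hnd : B.Nondegenerate := by
    refine ⟨fun v hv => ?_, fun v hv => ?_⟩ <;>
    · by_contra h
      exact (hpos v h).ne' (hv v)
  have hLo : Module.finrank ℚ (B.orthogonal L) = m := by
    rw [LinearMap.BilinForm.finrank_orthogonal hnd, hL]
    simp
  obtain ⟨b₁, hb₁⟩ := LinearMap.BilinForm.exists_orthogonal_basis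
    (B := B.restrict L) ⟨fun v w => hsymm.eq v w⟩
  obtain ⟨b₂, hb₂⟩ := LinearMap.BilinForm.exists_orthogonal_basis
    (B := B.restrict (B.orthogonal L)) ⟨fun v w => hsymm.eq v w⟩
  let u₁ : Fin k → L := fun i => b₁ (Fin.cast hL.symm i)
  let u₂ : Fin m → B.orthogonal L := fun i => b₂ (Fin.cast hLo.symm i)
  let u : Idx k m → Idx k m → ℚ := Sum.elim (fun i => (u₁ i).1) fun j => (u₂ j).1
  have hu0 : ∀ i, u i ≠ 0 := by
    rintro (i | j) h
    · exact b₁.ne_zero _ (Subtype.ext h)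
    · exact b₂.ne_zero _ (Subtype.ext h)
  have horth : ∀ i j, i ≠ j → B (u i) (u j) = 0 := by
    rintro (i | i) (j | j) hij
    · exact hb₁ fun h => hij (by simpa using h)
    · exact (u₂ j).2 _ (u₁ i).2
    · exact (hsymm.eq _ _).symm.trans ((u₂ i).2 _ (u₁ j).2)
    · exact hb₂ fun h => hij (by simpa using h)
  refine ⟨⟨Matrix.of fun i j => u j i, fun i => B (u i) (u i), fun i => hpos _ (hu0 i), ?_, ?_⟩⟩
  · ext i j
    have : ((Matrix.of fun i j => u j i).transpose * gram Q ℚ * Matrix.of fun i j => u j i) i j =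
        B (u i) (u j) := by
      rw [hB, Matrix.mul_assoc]
      simp [Matrix.mul_apply, dotProduct, Matrix.mulVec]
    rw [this]
    by_cases hij : i = j
    · subst hij
      simp
    · rw [Matrix.diagonal_apply_ne _ hij, horth _ _ hij]
  · have h1 : (Set.range fun i : Fin k => (Matrix.of fun i j => u j i).col (Sum.inl i)) =
        L.subtype '' Set.range b₁ := by
      ext v
      constructor
      · rintro ⟨i, rfl⟩
        exact ⟨_, ⟨_, rfl⟩, rfl⟩
      · rintro ⟨_, ⟨i, rfl⟩, rfl⟩
        exact ⟨Fin.cast hL i, rfl⟩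
    rw [h1, Submodule.span_image, b₁.span_eq, Submodule.map_top, Submodule.range_subtype]

/-- The coordinate projection of `R ^ n` onto `R ^ k`. -/
def stdProj (k m : ℕ) (R : Type) [CommRing R] : Matrix (Idx k m) (Idx k m) R :=
  Matrix.fromBlocks 1 0 0 0

theorem stdProj_eq_diagonal (R : Type) [CommRing R] :
    stdProj k m R = Matrix.diagonal (Sum.elim (fun _ => 1) fun _ => 0) := by
  ext (i | i) (j | j) <;> simp [stdProj, Matrix.one_apply, Matrix.diagonal_apply]

theorem stdProj_map {R S : Type} [CommRing R] [CommRing S] (f : R →+* S) :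
    f.mapMatrix (stdProj k m R) = stdProj k m S := by
  simp [stdProj, Matrix.fromBlocks_map]

theorem mem_stdSpace_iff {R : Type} [CommRing R] {v : Idx k m → R} :
    v ∈ stdSpace k m R ↔ (stdProj k m R).mulVec v = v := by
  rw [stdProj_eq_diagonal]
  constructor
  · intro hv
    ext (i | j)
    · simp [Matrix.mulVec_diagonal]
    · simp [Matrix.mulVec_diagonal, hv j]
  · intro hv j
    rw [← hv]
    simp [Matrix.mulVec_diagonal]

namespace AdaptedBasis

variable (u : AdaptedBasis Q L)

theorem det_ne_zero : u.U.det ≠ 0 ∧ (gram Q ℚ).det ≠ 0 := by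
  have h := congrArg Matrix.det u.orth
  rw [Matrix.det_mul, Matrix.det_mul, Matrix.det_diagonal] at h
  have h1 : ∏ i, u.c i ≠ 0 := Finset.prod_ne_zero_iff.mpr fun i _ => (u.c_pos i).ne'
  rw [← h] at h1
  exact ⟨right_ne_zero_of_mul h1, right_ne_zero_of_mul (left_ne_zero_of_mul h1)⟩

theorem mul_inv : u.U * u.U⁻¹ = 1 := Matrix.mul_nonsing_inv _ (isUnit_iff_ne_zero.mpr u.det_ne_zero.1)

theorem inv_mul : u.U⁻¹ * u.U = 1 := Matrix.nonsing_inv_mul _ (isUnit_iff_ne_zero.mpr u.det_ne_zero.1)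

/-- The `Q`-orthogonal projection onto `L`. -/
def P : Matrix (Idx k m) (Idx k m) ℚ := u.U * stdProj k m ℚ * u.U⁻¹

theorem P_mul_U : u.P * u.U = u.U * stdProj k m ℚ := by
  rw [P, Matrix.mul_assoc, u.inv_mul, Matrix.mul_one]

theorem P_sq : u.P * u.P = u.P := by
  have h : stdProj k m ℚ * stdProj k m ℚ = stdProj k m ℚ := by
    simp [stdProj, Matrix.fromBlocks_multiply]
  rw [P, Matrix.mul_assoc _ _ u.U⁻¹, Matrix.mul_assoc u.U, Matrix.mul_assoc _ u.U⁻¹,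
    ← Matrix.mul_assoc u.U⁻¹, u.inv_mul, Matrix.one_mul, ← Matrix.mul_assoc (stdProj k m ℚ), h]

/-- The projection `P` is self-adjoint. -/
theorem gram_mul_P : gram Q ℚ * u.P = u.P.transpose * gram Q ℚ := by
  have hU : IsUnit u.U := (Matrix.isUnit_iff_isUnit_det _).mpr (isUnit_iff_ne_zero.mpr u.det_ne_zero.1)
  have hUt : IsUnit u.U.transpose := Matrix.isUnit_transpose _ |>.mpr hU
  refine hUt.mul_left_cancel (hU.mul_right_cancel ?_)
  have h2 : u.U.transpose * u.P.transpose = stdProj k m ℚ * u.U.transpose := by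
    rw [← Matrix.transpose_mul, P_mul_U, Matrix.transpose_mul, stdProj_eq_diagonal,
      Matrix.diagonal_transpose]
  calc u.U.transpose * (gram Q ℚ * u.P) * u.U
      = (u.U.transpose * gram Q ℚ * u.U) * stdProj k m ℚ := by
        simp only [Matrix.mul_assoc, P_mul_U]
    _ = stdProj k m ℚ * (u.U.transpose * gram Q ℚ * u.U) := by
        rw [u.orth, stdProj_eq_diagonal, Matrix.diagonal_mul_diagonal,
          Matrix.diagonal_mul_diagonal]
        simp only [mul_comm]
    _ = u.U.transpose * (u.P.transpose * gram Q ℚ) * u.U := by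
        rw [← Matrix.mul_assoc, ← Matrix.mul_assoc, ← Matrix.mul_assoc u.U.transpose, h2]

theorem mem_iff {v : Idx k m → ℚ} : v ∈ L ↔ u.P.mulVec v = v := by
  have hcol : ∀ i : Fin k, u.P.mulVec (u.U.col (Sum.inl i)) = u.U.col (Sum.inl i) := by
    intro i
    have h := congrArg (fun M => Matrix.col M (Sum.inl i)) u.P_mul_U
    have h1 : (u.P * u.U).col (Sum.inl i) = u.P.mulVec (u.U.col (Sum.inl i)) := by
      ext j
      simp [Matrix.mul_apply, Matrix.mulVec, dotProduct]
    have h2 : (u.U * stdProj k m ℚ).col (Sum.inl i) = u.U.col (Sum.inl i) := by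
      ext j
      simp [stdProj_eq_diagonal]
    rw [← h1, ← h2]
    exact h
  constructor
  · intro hv
    rw [← u.span] at hv
    induction hv using Submodule.span_induction with
    | mem x hx => obtain ⟨i, rfl⟩ := hx; exact hcol i
    | zero => simp
    | add x y _ _ hx hy => rw [Matrix.mulVec_add, hx, hy]
    | smul a x _ hx => rw [Matrix.mulVec_smul, hx]
  · intro hv
    rw [← hv, P, ← Matrix.mulVec_mulVec, ← Matrix.mulVec_mulVec]
    set w := (stdProj k m ℚ).mulVec (u.U⁻¹.mulVec v) with hw
    have h0 : ∀ j, w (Sum.inr j) = 0 := by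
      intro j
      rw [hw, stdProj_eq_diagonal, Matrix.mulVec_diagonal]
      simp
    have : u.U.mulVec w = ∑ i : Fin k, w (Sum.inl i) • u.U.col (Sum.inl i) := by
      ext j
      simp [Matrix.mulVec, dotProduct, h0, mul_comm]
    rw [this]
    exact u.span.le (Submodule.sum_mem _ fun i _ => Submodule.smul_mem _ _
      (Submodule.subset_span ⟨i, rfl⟩))

section Ring

variable (R : Type) [CommRing R] [Algebra ℚ R]

/-- The projection onto `L_R`. -/
def PR : Matrix (Idx k m) (Idx k m) R := (algebraMap ℚ R).mapMatrix u.P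

theorem PR_sq : u.PR R * u.PR R = u.PR R := by
  rw [PR, ← map_mul, u.P_sq]

theorem gram_mul_PR : gram Q R * u.PR R = (u.PR R).transpose * gram Q R := by
  have := congrArg (algebraMap ℚ R).mapMatrix u.gram_mul_P
  rw [map_mul, map_mul, gram_map] at this
  exact this

variable {R}

theorem mem_ext_iff {v : Idx k m → R} : v ∈ ext R L ↔ (u.PR R).mulVec v = v := by
  constructor
  · intro hv
    induction hv using Submodule.span_induction with
    | mem x hx =>
      obtain ⟨y, hy, rfl⟩ := hx
      ext i
      have := congrArg (fun z => algebraMap ℚ R (z i)) (u.mem_iff.mp hy)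
      simp only [RingHom.map_mulVec] at this
      exact this
    | zero => simp
    | add x y _ _ hx hy => rw [Matrix.mulVec_add, hx, hy]
    | smul a x _ hx => rw [Matrix.mulVec_smul, hx]
  · intro hv
    rw [← hv]
    have : (u.PR R).mulVec v = ∑ j, v j • fun i => algebraMap ℚ R (u.P.col j i) := by
      ext i
      simp [Matrix.mulVec, dotProduct, PR, mul_comm]
    rw [this]
    refine Submodule.sum_mem _ fun j _ => Submodule.smul_mem _ _ (Submodule.subset_span ⟨_, ?_, rfl⟩)
    refine u.mem_iff.mpr ?_
    have h := congrArg (fun M => Matrix.col M j) u.P_sq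
    have h1 : (u.P * u.P).col j = u.P.mulVec (u.P.col j) := by
      ext i
      simp [Matrix.mul_apply, Matrix.mulVec, dotProduct]
    rw [← h1]
    exact h

include u in
theorem isUnit_gram_det : IsUnit (gram Q R).det := by
  rw [← gram_map (algebraMap ℚ R), ← RingHom.map_det]
  exact (isUnit_iff_ne_zero.mpr u.det_ne_zero.2).map _

/-- An isometry stabilizes `L_R` if and only if it commutes with the orthogonal projection onto
`L_R`. -/
theorem map_ext_eq_iff (M : Matrix.SpecialLinearGroup (Idx k m) R)
    (hM : M.1.transpose * gram Q R * M.1 = gram Q R) :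
    (ext R L).map (Matrix.toLin' M.1) = ext R L ↔ M.1 * u.PR R = u.PR R * M.1 := by
  have hinv : (M⁻¹).1 * M.1 = 1 := congrArg Subtype.val (inv_mul_cancel M)
  have hinv' : M.1 * (M⁻¹).1 = 1 := congrArg Subtype.val (mul_inv_cancel M)
  have hcol : ∀ A : Matrix (Idx k m) (Idx k m) R,
      (∀ v, (u.PR R).mulVec (A.mulVec v) = A.mulVec v) → u.PR R * A = A := by
    intro A hA
    refine Matrix.ext_of_mulVec_single fun i => ?_
    rw [← Matrix.mulVec_mulVec, hA]
  constructor
  · intro h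
    have h1 : u.PR R * (M.1 * u.PR R) = M.1 * u.PR R := by
      refine hcol _ fun v => ?_
      rw [← u.mem_ext_iff, ← Matrix.mulVec_mulVec, ← h]
      refine ⟨(u.PR R).mulVec v, u.mem_ext_iff.mpr ?_, by simp⟩
      rw [Matrix.mulVec_mulVec, u.PR_sq]
    have h2 : u.PR R * ((M⁻¹).1 * u.PR R) = (M⁻¹).1 * u.PR R := by
      refine hcol _ fun v => ?_
      rw [← u.mem_ext_iff, ← Matrix.mulVec_mulVec]
      have : (u.PR R).mulVec v ∈ ext R L := by
        rw [u.mem_ext_iff, Matrix.mulVec_mulVec, u.PR_sq]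
      rw [← h] at this
      obtain ⟨w, hw, hwv⟩ := this
      rw [← hwv, Matrix.toLin'_apply, Matrix.mulVec_mulVec, hinv, Matrix.one_mulVec]
      exact hw
    have hG : IsUnit (gram Q R) := (Matrix.isUnit_iff_isUnit_det _).mpr u.isUnit_gram_det
    have h3 : (M⁻¹).1.transpose * gram Q R = gram Q R * M.1 := by
      have := congrArg (fun A => (M⁻¹).1.transpose * A) hM
      simp only [← Matrix.mul_assoc, ← Matrix.transpose_mul, hinv', Matrix.transpose_one,
        Matrix.one_mul] at this
      exact this.symm
    have h4 := congrArg (fun A => A.transpose * gram Q R) h2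
    simp only [Matrix.transpose_mul, Matrix.mul_assoc] at h4
    rw [← u.gram_mul_PR, ← Matrix.mul_assoc (M⁻¹).1.transpose, h3] at h4
    simp only [← Matrix.mul_assoc] at h4
    rw [← u.gram_mul_PR] at h4
    simp only [Matrix.mul_assoc] at h4
    rw [← h1]
    exact hG.mul_left_cancel h4
  · intro h
    have h' : (M⁻¹).1 * u.PR R = u.PR R * (M⁻¹).1 := by
      calc (M⁻¹).1 * u.PR R = (M⁻¹).1 * (u.PR R * M.1) * (M⁻¹).1 := by
            rw [Matrix.mul_assoc, Matrix.mul_assoc, hinv', Matrix.mul_one]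
        _ = u.PR R * (M⁻¹).1 := by rw [← h, ← Matrix.mul_assoc, hinv, Matrix.one_mul]
    refine le_antisymm ?_ fun v hv => ⟨(M⁻¹).1.mulVec v, ?_, ?_⟩
    · rintro _ ⟨v, hv, rfl⟩
      rw [u.mem_ext_iff, Matrix.toLin'_apply, Matrix.mulVec_mulVec, ← h, ← Matrix.mulVec_mulVec,
        u.mem_ext_iff.mp hv]
    · refine u.mem_ext_iff.mpr ?_
      rw [Matrix.mulVec_mulVec, ← h', ← Matrix.mulVec_mulVec, u.mem_ext_iff.mp hv]
    · rw [Matrix.toLin'_apply, Matrix.mulVec_mulVec, hinv', Matrix.one_mulVec]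

theorem mem_stabL_iff {h : Spin Q R} :
    h ∈ stabL Q L R ↔ (spinMat Q R h).1 * u.PR R = u.PR R * (spinMat Q R h).1 :=
  u.map_ext_eq_iff _ (spinMat_gram h)

end Ring

end AdaptedBasis
end Adapted

/-! ### The torus as the stabilizer of a rational point -/

section Orbit

variable {k m : ℕ} {Q : QuadraticForm ℤ (Idx k m → ℤ)} {L : Submodule ℚ (Idx k m → ℚ)}

theorem mem_latticePts_iff {z : Idx k m → ℤ} :
    z ∈ latticePts L ↔ (fun i => (z i : ℚ)) ∈ L := Iff.rfl

theorem exists_smul_mem_latticePts {x : Idx k m → ℚ} (hx : x ∈ L) :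
    ∃ (N : ℤ) (z : Idx k m → ℤ), N ≠ 0 ∧ z ∈ latticePts L ∧ ∀ i, (z i : ℚ) = N * x i := by
  obtain ⟨N, hN⟩ := IsLocalization.exist_integer_multiples_of_finite (nonZeroDivisors ℤ) x
  choose z hz using hN
  have hzv : ∀ i, ((z i : ℤ) : ℚ) = ((N : ℤ) : ℚ) * x i := by
    intro i
    have := hz i
    simpa [Submonoid.smul_def] using this
  refine ⟨N, z, nonZeroDivisors.ne_zero N.2, ?_, hzv⟩
  rw [mem_latticePts_iff]
  have : (fun i => (z i : ℚ)) = ((N : ℤ) : ℚ) • x := by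
    ext i
    simp [hzv]
  rw [this]
  exact L.smul_mem _ hx

theorem castSL_map {R S : Type} [CommRing R] [CommRing S] (f : R →+* S)
    (g : Matrix.SpecialLinearGroup (Idx k m) ℤ) :
    f.mapMatrix (castSL R g).1 = (castSL S g).1 := by
  ext i j
  simp

theorem SL_inv_mul {R : Type} [CommRing R] (M : Matrix.SpecialLinearGroup (Idx k m) R) :
    (M⁻¹).1 * M.1 = 1 := congrArg Subtype.val (inv_mul_cancel M)

theorem SL_mul_inv {R : Type} [CommRing R] (M : Matrix.SpecialLinearGroup (Idx k m) R) :
    M.1 * (M⁻¹).1 = 1 := congrArg Subtype.val (mul_inv_cancel M)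

theorem SL_map_inv {R S : Type} [CommRing R] [CommRing S] (f : R →+* S)
    (M : Matrix.SpecialLinearGroup (Idx k m) R) :
    f.mapMatrix (M⁻¹).1 = ((Matrix.SpecialLinearGroup.map f M)⁻¹).1 := by
  rw [← map_inv]
  rfl

namespace AdaptedBasis

variable (u : AdaptedBasis Q L) {g : Matrix.SpecialLinearGroup (Idx k m) ℤ}
  (hg : Submodule.span ℤ (Set.range fun i : Fin k => g.1.col (Sum.inl i)) = latticePts L)

include hg

/-- The matrix `g` maps `ℚ ^ k` into `L`. -/
theorem P_mul_g_mul_E : u.P * (castSL ℚ g).1 * stdProj k m ℚ = (castSL ℚ g).1 * stdProj k m ℚ := by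
  refine Matrix.ext_of_mulVec_single fun i => ?_
  rw [stdProj_eq_diagonal, ← Matrix.mulVec_mulVec, ← Matrix.mulVec_mulVec, ← Matrix.mulVec_mulVec]
  rcases i with i | i
  · have h1 : (Matrix.diagonal (Sum.elim (fun _ : Fin k => (1 : ℚ)) fun _ : Fin m => 0)).mulVec
        (Pi.single (Sum.inl i) 1) = Pi.single (Sum.inl i) 1 := by
      ext j
      by_cases h : j = Sum.inl i
      · subst h
        simp [Matrix.mulVec_diagonal]
      · simp [Matrix.mulVec_diagonal, h]
    rw [h1, ← u.mem_iff]
    have h2 : g.1.col (Sum.inl i) ∈ latticePts L := by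
      rw [← hg]
      exact Submodule.subset_span ⟨i, rfl⟩
    rw [mem_latticePts_iff] at h2
    convert h2 using 1
    ext j
    simp
  · have h1 : (Matrix.diagonal (Sum.elim (fun _ : Fin k => (1 : ℚ)) fun _ : Fin m => 0)).mulVec
        (Pi.single (Sum.inr i) 1) = 0 := by
      ext j
      by_cases h : j = Sum.inr i
      · subst h
        simp [Matrix.mulVec_diagonal]
      · simp [Matrix.mulVec_diagonal, h]
    rw [h1]
    simp

/-- The matrix `g⁻¹` maps `L` into `ℚ ^ k`. -/
theorem E_mul_ginv_mul_P :
    stdProj k m ℚ * ((castSL ℚ g)⁻¹).1 * u.P = ((castSL ℚ g)⁻¹).1 * u.P := by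
  have key : ∀ x ∈ L, (stdProj k m ℚ).mulVec (((castSL ℚ g)⁻¹).1.mulVec x) =
      ((castSL ℚ g)⁻¹).1.mulVec x := by
    intro x hx
    obtain ⟨N, z, hN, hz, hzx⟩ := exists_smul_mem_latticePts hx
    have h1 : (stdProj k m ℚ).mulVec (((castSL ℚ g)⁻¹).1.mulVec (fun i => (z i : ℚ))) =
        ((castSL ℚ g)⁻¹).1.mulVec (fun i => (z i : ℚ)) := by
      rw [← hg] at hz
      clear hzx
      induction hz using Submodule.span_induction with
      | mem z hz =>
        obtain ⟨i, rfl⟩ := hz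
        have h2 : (fun j => ((g.1.col (Sum.inl i) j : ℤ) : ℚ)) =
            (castSL ℚ g).1.mulVec (Pi.single (Sum.inl i) 1) := by
          ext j
          simp
        change (stdProj k m ℚ).mulVec (((castSL ℚ g)⁻¹).1.mulVec
          (fun j => ((g.1.col (Sum.inl i) j : ℤ) : ℚ))) =
          ((castSL ℚ g)⁻¹).1.mulVec (fun j => ((g.1.col (Sum.inl i) j : ℤ) : ℚ))
        rw [h2, Matrix.mulVec_mulVec _ _ (castSL ℚ g).1, SL_inv_mul, Matrix.one_mulVec,
          ← mem_stdSpace_iff]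
        intro j
        simp
      | zero =>
        have : (fun i : Idx k m => (((0 : Idx k m → ℤ) i : ℤ) : ℚ)) = 0 := by
          ext i
          simp
        rw [this]
        simp
      | add x y _ _ hx hy =>
        have : (fun i : Idx k m => (((x + y) i : ℤ) : ℚ)) =
            (fun i => (x i : ℚ)) + fun i => (y i : ℚ) := by
          ext i
          simp
        rw [this, Matrix.mulVec_add, Matrix.mulVec_add, hx, hy]
      | smul a x _ hx =>
        have : (fun i : Idx k m => (((a • x) i : ℤ) : ℚ)) = (a : ℚ) • fun i => (x i : ℚ) := by
          ext i
          simp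
        rw [this, Matrix.mulVec_smul, Matrix.mulVec_smul, hx]
    have h3 : (fun i => (z i : ℚ)) = (N : ℚ) • x := by
      ext i
      simp [hzx]
    rw [h3, Matrix.mulVec_smul, Matrix.mulVec_smul] at h1
    exact smul_right_injective _ (Int.cast_ne_zero.mpr hN : (N : ℚ) ≠ 0) h1
  refine Matrix.ext_of_mulVec_single fun i => ?_
  rw [← Matrix.mulVec_mulVec, ← Matrix.mulVec_mulVec, ← Matrix.mulVec_mulVec]
  refine key _ (u.mem_iff.mpr ?_)
  rw [Matrix.mulVec_mulVec, u.P_sq]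

variable {R : Type} [CommRing R] [Algebra ℚ R]

/-- A matrix of determinant one stabilizing `L` and preserving `Q` becomes, in the basis of columns
of `g`, an element of the parabolic group. The lower left block vanishes because `L` is stable; the
upper left block is an isometry of the nondegenerate restriction of `Q` to `L`, so its determinant
squares to one. -/
theorem conj_mem_parabolic (hQ : Q.PosDef) {M : Matrix.SpecialLinearGroup (Idx k m) R}
    (hM : M.1.transpose * gram Q R * M.1 = gram Q R)
    (hP : M.1 * u.PR R = u.PR R * M.1) :
    (castSL R g)⁻¹ * M * castSL R g ∈ parabolic k m R := by
  have hE1 : u.PR R * ((castSL R g).1 * stdProj k m R) =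
      (castSL R g).1 * stdProj k m R := by
    have := congrArg (algebraMap ℚ R).mapMatrix (u.P_mul_g_mul_E hg)
    simp only [map_mul, castSL_map, stdProj_map, Matrix.mul_assoc] at this
    exact this
  have hE2 : stdProj k m R * (((castSL R g)⁻¹).1 * u.PR R) = ((castSL R g)⁻¹).1 * u.PR R := by
    have := congrArg (algebraMap ℚ R).mapMatrix (u.E_mul_ginv_mul_P hg)
    simp only [map_mul, SL_map_inv, stdProj_map, Matrix.mul_assoc] at this
    have h2 : Matrix.SpecialLinearGroup.map (algebraMap ℚ R) (castSL ℚ g) = castSL R g :=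
      Subtype.ext (castSL_map _ _)
    rw [h2] at this
    exact this
  set N : Matrix.SpecialLinearGroup (Idx k m) R := (castSL R g)⁻¹ * M * castSL R g with hN
  have hN1 : N.1 = ((castSL R g)⁻¹).1 * M.1 * (castSL R g).1 := rfl
  have hgN : (castSL R g).1 * N.1 = M.1 * (castSL R g).1 := by
    rw [hN1, ← Matrix.mul_assoc, ← Matrix.mul_assoc, SL_mul_inv, Matrix.one_mul]
  -- `N` maps `R ^ k` into itself
  have hENE : stdProj k m R * (N.1 * stdProj k m R) = N.1 * stdProj k m R := by
    have h1 : N.1 * stdProj k m R =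
        ((castSL R g)⁻¹).1 * u.PR R * (M.1 * ((castSL R g).1 * stdProj k m R)) := by
      calc N.1 * stdProj k m R
          = ((castSL R g)⁻¹).1 * (M.1 * ((castSL R g).1 * stdProj k m R)) := by
            rw [hN1]
            simp only [Matrix.mul_assoc]
        _ = ((castSL R g)⁻¹).1 * ((M.1 * u.PR R) * ((castSL R g).1 * stdProj k m R)) := by
            rw [Matrix.mul_assoc M.1, hE1]
        _ = _ := by
            rw [hP]
            simp only [Matrix.mul_assoc]
    rw [h1, ← Matrix.mul_assoc (stdProj k m R), hE2]
  obtain ⟨A, B, C, D, hbl⟩ : ∃ A B C D, N.1 = Matrix.fromBlocks A B C D :=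
    ⟨_, _, _, _, (Matrix.fromBlocks_toBlocks N.1).symm⟩
  have hC : C = 0 := by
    rw [hbl] at hENE
    simp only [stdProj, Matrix.fromBlocks_multiply] at hENE
    have := (Matrix.fromBlocks_inj.mp hENE).2.2.1
    simpa using this.symm
  -- `H` is the Gram matrix of the restriction of `Q` to `L`; it is nonsingular by positivity
  let H : Matrix (Fin k) (Fin k) ℚ :=
    ((castSL ℚ g).1.transpose * gram Q ℚ * (castSL ℚ g).1).toBlocks₁₁
  have hH : IsUnit ((algebraMap ℚ R).mapMatrix H).det := by
    rw [← RingHom.map_det]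
    refine (isUnit_iff_ne_zero.mpr fun h0 => ?_).map _
    obtain ⟨x, hx0, hx⟩ := Matrix.exists_mulVec_eq_zero_iff.mpr h0
    let y : Idx k m → ℚ := Sum.elim x 0
    have hy : (castSL ℚ g).1.mulVec y ≠ 0 := by
      intro h
      have h1 := congrArg ((castSL ℚ g)⁻¹).1.mulVec h
      rw [Matrix.mulVec_mulVec, SL_inv_mul, Matrix.one_mulVec, Matrix.mulVec_zero] at h1
      exact hx0 (funext fun i => congrFun h1 (Sum.inl i))
    have h2 := gram_posDef hQ _ hy
    have h3 : (castSL ℚ g).1.mulVec y ⬝ᵥ (gram Q ℚ).mulVec ((castSL ℚ g).1.mulVec y) =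
        x ⬝ᵥ H.mulVec x := by
      rw [Matrix.mulVec_mulVec, ← Matrix.vecMul_transpose, ← Matrix.dotProduct_mulVec,
        Matrix.mulVec_mulVec, ← Matrix.mul_assoc]
      rw [← Matrix.fromBlocks_toBlocks
        ((castSL ℚ g).1.transpose * gram Q ℚ * (castSL ℚ g).1)]
      simp only [y, Matrix.fromBlocks_mulVec, dotProduct, Fintype.sum_sum_type]
      simp [H, Sum.elim_comp_inl]
    rw [h3, hx] at h2
    simp at h2
  have hiso : N.1.transpose * ((castSL R g).1.transpose * gram Q R * (castSL R g).1) * N.1 =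
      (castSL R g).1.transpose * gram Q R * (castSL R g).1 := by
    calc N.1.transpose * ((castSL R g).1.transpose * gram Q R * (castSL R g).1) * N.1
        = ((castSL R g).1 * N.1).transpose * gram Q R * ((castSL R g).1 * N.1) := by
          rw [Matrix.transpose_mul]
          simp only [Matrix.mul_assoc]
      _ = (castSL R g).1.transpose * (M.1.transpose * gram Q R * M.1) * (castSL R g).1 := by
          rw [hgN, Matrix.transpose_mul]
          simp only [Matrix.mul_assoc]
      _ = _ := by rw [hM]
  have hHR : ((castSL R g).1.transpose * gram Q R * (castSL R g).1).toBlocks₁₁ =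
      (algebraMap ℚ R).mapMatrix H := by
    have h1 : (castSL R g).1.transpose * gram Q R * (castSL R g).1 = (algebraMap ℚ R).mapMatrix
        ((castSL ℚ g).1.transpose * gram Q ℚ * (castSL ℚ g).1) := by
      rw [map_mul, map_mul, castSL_map, gram_map, ← castSL_map (algebraMap ℚ R)]
      rfl
    rw [h1]
    rfl
  have hA : A.det ^ 2 = 1 := by
    set W := (castSL R g).1.transpose * gram Q R * (castSL R g).1
    rw [← Matrix.fromBlocks_toBlocks W, hbl, hC, Matrix.fromBlocks_transpose,
      Matrix.fromBlocks_multiply, Matrix.fromBlocks_multiply] at hiso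
    have h1 := (Matrix.fromBlocks_inj.mp hiso).1
    simp only [Matrix.transpose_zero, Matrix.zero_mul, Matrix.mul_zero, add_zero] at h1
    have h2 := congrArg Matrix.det h1
    rw [Matrix.det_mul, Matrix.det_mul, Matrix.det_transpose, hHR] at h2
    refine hH.mul_right_cancel ?_
    rw [one_mul]
    linear_combination h2
  have hdet : A.det * D.det = 1 := by
    have := N.2
    rw [hbl, hC, Matrix.det_fromBlocks_zero₂₁] at this
    exact this
  refine ⟨?_, ?_, ?_⟩
  · rw [hbl, hC]
    simp
  · rw [hbl]
    simp only [Matrix.toBlocks_fromBlocks₁₁, Matrix.toBlocks_fromBlocks₂₂]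
    linear_combination D.det * hA - A.det * hdet
  · rw [hbl]
    simpa using hA

end AdaptedBasis

/-- The right action `(w₁, w₂) · (h₁, h₂) = (h₁⁻¹ w₁ h₁, h₁⁻¹ w₂ h₂)` of `G(R)` on pairs of matrices.
The torus is the stabilizer of `(P, g)`. -/
def pairAct {R : Type} [CommRing R] (h : Grp Q R)
    (w : Matrix (Idx k m) (Idx k m) R × Matrix (Idx k m) (Idx k m) R) :
    Matrix (Idx k m) (Idx k m) R × Matrix (Idx k m) (Idx k m) R :=
  (((spinMat Q R h.1)⁻¹).1 * w.1 * (spinMat Q R h.1).1,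
    ((spinMat Q R h.1)⁻¹).1 * w.2 * h.2.1.1)

theorem pairAct_mul {R : Type} [CommRing R] (h h' : Grp Q R)
    (w : Matrix (Idx k m) (Idx k m) R × Matrix (Idx k m) (Idx k m) R) :
    pairAct (h * h') w = pairAct h' (pairAct h w) := by
  have h1 : (spinMat Q R (h * h').1).1 = (spinMat Q R h.1).1 * (spinMat Q R h'.1).1 := by
    rw [Prod.fst_mul, map_mul]
    rfl
  have h2 : ((spinMat Q R (h * h').1)⁻¹).1 =
      ((spinMat Q R h'.1)⁻¹).1 * ((spinMat Q R h.1)⁻¹).1 := by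
    rw [Prod.fst_mul, map_mul, mul_inv_rev]
    rfl
  have h3 : (h * h').2.1.1 = h.2.1.1 * h'.2.1.1 := rfl
  simp only [pairAct, h1, h2, h3, Matrix.mul_assoc]

theorem pairAct_one {R : Type} [CommRing R]
    (w : Matrix (Idx k m) (Idx k m) R × Matrix (Idx k m) (Idx k m) R) :
    pairAct (1 : Grp Q R) w = w := by
  have h1 : (spinMat Q R (1 : Grp Q R).1) = 1 := by rw [Prod.fst_one, map_one]
  have h3 : (1 : Grp Q R).2.1.1 = 1 := rfl
  simp only [pairAct, h1, h3, inv_one]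
  simp

theorem pairAct_map {R S : Type} [CommRing R] [CommRing S] (f : R →+* S) (h : Grp Q R)
    (w : Matrix (Idx k m) (Idx k m) R × Matrix (Idx k m) (Idx k m) R) :
    pairAct (grpMap Q f h) (Prod.map f.mapMatrix f.mapMatrix w) =
      Prod.map f.mapMatrix f.mapMatrix (pairAct h w) := by
  have h1 : f.mapMatrix (spinMat Q R h.1).1 = (spinMat Q S (grpMap Q f h).1).1 := rfl
  have h2 : f.mapMatrix ((spinMat Q R h.1)⁻¹).1 = ((spinMat Q S (grpMap Q f h).1)⁻¹).1 :=
    SL_map_inv f _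
  have h3 : f.mapMatrix h.2.1.1 = (grpMap Q f h).2.1.1 := rfl
  simp only [pairAct, Prod.map, map_mul, h1, h2, h3]

namespace AdaptedBasis

variable (u : AdaptedBasis Q L) (g : Matrix.SpecialLinearGroup (Idx k m) ℤ)
variable {R : Type} [CommRing R] [Algebra ℚ R]

variable (R) in
/-- The rational point `(P, g)` stabilized by the torus, where `P` is the orthogonal projection onto
`L`. -/
def basePair : Matrix (Idx k m) (Idx k m) R × Matrix (Idx k m) (Idx k m) R :=
  (u.PR R, (castSL R g).1)

theorem basePair_map {S : Type} [CommRing S] [Algebra ℚ S] (f : R →+* S) :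
    Prod.map f.mapMatrix f.mapMatrix (u.basePair g R) = u.basePair g S := by
  have hf : f.comp (algebraMap ℚ R) = algebraMap ℚ S := Subsingleton.elim _ _
  refine Prod.ext ?_ (castSL_map f g)
  ext i j
  exact congrArg (fun φ : ℚ →+* S => φ (u.P i j)) hf

/-- The image of `(P, g)` under the right action of `h`, written `h⁻¹ (P, g)` in comments. -/
def orbMap (h : Grp Q R) : Matrix (Idx k m) (Idx k m) R × Matrix (Idx k m) (Idx k m) R :=
  pairAct h (u.basePair g R)

theorem orbMap_grpMap {S : Type} [CommRing S] [Algebra ℚ S] (f : R →+* S) (h : Grp Q R) :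
    u.orbMap g (grpMap Q f h) = Prod.map f.mapMatrix f.mapMatrix (u.orbMap g h) := by
  rw [orbMap, ← u.basePair_map g f, pairAct_map]
  rfl

/-- The torus is the stabilizer of `(P, g)`: commuting with `P` means stabilizing `L`, and `h₁⁻¹ g
h₂ = g` means `h₂ = g⁻¹ h₁ g`. -/
theorem mem_torusGrp_iff {t : Grp Q R} :
    t ∈ torusGrp Q L g R ↔ u.orbMap g t = u.basePair g R := by
  have h0 : t ∈ torusGrp Q L g R ↔ t.1 ∈ stabL Q L R ∧
    t.2.1 = (castSL R g)⁻¹ * spinMat Q R t.1 * castSL R g := Iff.rfl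
  rw [h0, u.mem_stabL_iff, orbMap, pairAct, basePair, Prod.ext_iff]
  refine and_congr ⟨fun h => ?_, fun h => ?_⟩ ⟨fun h => ?_, fun h => ?_⟩
  · dsimp only
    rw [Matrix.mul_assoc, ← h, ← Matrix.mul_assoc, SL_inv_mul, Matrix.one_mul]
  · dsimp only at h
    conv_lhs => rw [← h]
    rw [← Matrix.mul_assoc, ← Matrix.mul_assoc, SL_mul_inv, Matrix.one_mul]
  · dsimp only
    have : ((spinMat Q R t.1)⁻¹ * castSL R g * t.2.1) = castSL R g := by
      rw [h]
      group
    exact congrArg Subtype.val this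
  · have : ((spinMat Q R t.1)⁻¹ * castSL R g * t.2.1) = castSL R g := Subtype.ext h
    rw [mul_assoc, inv_mul_eq_iff_eq_mul] at this
    rw [mul_assoc, ← this]
    group

/-- Points of the orbit of `(P, g)` are the cosets of the torus. -/
theorem mul_inv_mem_torusGrp_iff {h h' : Grp Q R} :
    h' * h⁻¹ ∈ torusGrp Q L g R ↔ u.orbMap g h' = u.orbMap g h := by
  rw [u.mem_torusGrp_iff, orbMap, pairAct_mul]
  constructor
  · intro e
    have := congrArg (pairAct h) e
    rw [← pairAct_mul, inv_mul_cancel, pairAct_one] at this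
    exact this
  · intro e
    change pairAct h⁻¹ (u.orbMap g h') = _
    rw [e, orbMap, ← pairAct_mul, mul_inv_cancel, pairAct_one]

end AdaptedBasis

end Orbit

/-! ### Compactness of the real spin group -/

section Compact

/-- Averaging a positive bilinear form over anticommuting elements with positive squares makes
these elements act by similitudes. -/
theorem exists_averaged_form {A ι : Type*} [Ring A] [Algebra ℝ A] (e : ι → A) (q : ι → ℝ)
    (hq : ∀ i, 0 < q i) (hsq : ∀ i, e i * e i = algebraMap ℝ A (q i))
    (hanti : ∀ i j, i ≠ j → e i * e j = -(e j * e i))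
    (B₀ : LinearMap.BilinForm ℝ A) (h0 : ∀ x, 0 ≤ B₀ x x) (s : Finset ι) :
    ∃ B : LinearMap.BilinForm ℝ A, (∀ x, B₀ x x ≤ B x x) ∧
      ∀ i ∈ s, ∀ x y, B (e i * x) (e i * y) = q i * B x y := by
  classical
  induction s using Finset.induction_on with
  | empty => exact ⟨B₀, fun x => le_rfl, by simp⟩
  | insert j s hj ih =>
    obtain ⟨B, hB, hBs⟩ := ih
    let B' : LinearMap.BilinForm ℝ A := B + (q j)⁻¹ •
      LinearMap.compl₁₂ B (LinearMap.mulLeft ℝ (e j)) (LinearMap.mulLeft ℝ (e j))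
    have hB' : ∀ x y, B' x y = B x y + (q j)⁻¹ * B (e j * x) (e j * y) := fun x y => rfl
    refine ⟨B', fun x => ?_, fun i hi x y => ?_⟩
    · rw [hB']
      have h1 := (h0 (e j * x)).trans (hB _)
      have h2 := mul_nonneg (inv_pos.mpr (hq j)).le h1
      linarith [hB x]
    · rw [hB', hB']
      rcases Finset.mem_insert.mp hi with rfl | hi
      · rw [← mul_assoc, ← mul_assoc, hsq, ← Algebra.smul_def, ← Algebra.smul_def]
        simp only [map_smul, LinearMap.smul_apply, smul_eq_mul]
        have := (hq i).ne'
        field_simp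
        ring
      · have hij : j ≠ i := by
          rintro rfl
          exact hj hi
        have h1 : ∀ x, e j * (e i * x) = -(e i * (e j * x)) := by
          intro x
          rw [← mul_assoc, hanti j i hij, neg_mul, mul_assoc]
        rw [h1, h1]
        simp only [map_neg, LinearMap.neg_apply, neg_neg]
        rw [hBs i hi, hBs i hi]
        ring

variable {k m : ℕ} {Q : QuadraticForm ℤ (Idx k m → ℤ)} {L : Submodule ℚ (Idx k m → ℚ)}

theorem vec_add {R : Type} [CommRing R] (v w : Idx k m → R) :
    vec Q (v + w) = vec Q v + vec Q w := by
  simp only [vec, Pi.add_apply, TensorProduct.add_tmul, Finset.sum_add_distrib]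

theorem vec_smul {R : Type} [CommRing R] (r : R) (v : Idx k m → R) :
    vec Q (r • v) = r • vec Q v := by
  simp only [vec, Pi.smul_apply, TensorProduct.smul_tmul', Finset.smul_sum]

variable (Q) in
/-- `v ↦ vec v` as a linear map. -/
def vecLin (R : Type) [CommRing R] : (Idx k m → R) →ₗ[R] Cl Q R where
  toFun := vec Q
  map_add' := vec_add
  map_smul' := vec_smul

variable (Q) in
/-- The polar form of `Q` over `R`. -/
def gdot {R : Type} [CommRing R] (v w : Idx k m → R) : R := v ⬝ᵥ (gram Q R).mulVec w

namespace AdaptedBasis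

variable (u : AdaptedBasis Q L)

section BaseVec

variable {R : Type} [CommRing R] [Algebra ℚ R]

variable (R) in
/-- The adapted basis over `R`. -/
def baseVec (i : Idx k m) : Idx k m → R := fun a => algebraMap ℚ R (u.U a i)

theorem gdot_baseVec (i j : Idx k m) :
    gdot Q (u.baseVec R i) (u.baseVec R j) = if i = j then algebraMap ℚ R (u.c i) else 0 := by
  have h := congrArg (fun M => algebraMap ℚ R (M i j)) u.orth
  simp only [Matrix.diagonal_apply] at h
  rw [apply_ite (algebraMap ℚ R), map_zero] at h
  rw [← h, Matrix.mul_assoc]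
  simp only [Matrix.mul_apply, gdot, dotProduct, Matrix.mulVec, baseVec, Matrix.transpose_apply,
    gram, Matrix.of_apply, map_sum, map_mul, map_intCast]

theorem exists_baseVec_combination (v : Idx k m → R) :
    ∃ w : Idx k m → R, v = ∑ i, w i • u.baseVec R i := by
  let UR := (algebraMap ℚ R).mapMatrix u.U
  let UI := (algebraMap ℚ R).mapMatrix u.U⁻¹
  have h : UR * UI = 1 := by
    rw [← map_mul, u.mul_inv, map_one]
  refine ⟨UI.mulVec v, ?_⟩
  have h2 : UR.mulVec (UI.mulVec v) = v := by
    rw [Matrix.mulVec_mulVec, h, Matrix.one_mulVec]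
  conv_lhs => rw [← h2]
  ext a
  simp only [Matrix.mulVec, dotProduct, Finset.sum_apply, Pi.smul_apply, smul_eq_mul, baseVec, UR,
    RingHom.mapMatrix_apply, Matrix.map_apply]
  exact Finset.sum_congr rfl fun i _ => mul_comm _ _

end BaseVec

include u

/-- There is a positive definite form on `Cl(Q_ℝ)` for which left multiplication by the reversal
of `c` is adjoint to left multiplication by `c`. -/
theorem exists_adjoint_form : ∃ B : LinearMap.BilinForm ℝ (Cl Q ℝ),
    (∀ x, ∑ i, clCrd Q ℝ x i ^ 2 ≤ B x x) ∧
    ∀ c x y : Cl Q ℝ, B (c * x) y = B x (rev Q ℝ c * y) := by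
  let e : Idx k m → Cl Q ℝ := fun i => vec Q (u.baseVec ℝ i)
  have halg : ∀ r : ℝ, algebraMap ℝ (Cl Q ℝ) r = r ⊗ₜ[ℤ] (1 : CliffordAlgebra Q) := fun r => rfl
  have hsum : ∀ i j, e i * e j + e j * e i =
      algebraMap ℝ (Cl Q ℝ) (if i = j then (u.c i : ℝ) else 0) := by
    intro i j
    have h := u.gdot_baseVec (R := ℝ) i j
    rw [gdot, eq_ratCast] at h
    rw [vec_mul_vec_add, h, halg]
  let q : Idx k m → ℝ := fun i => (u.c i : ℝ) / 2
  have hq : ∀ i, 0 < q i := fun i => half_pos (by exact_mod_cast u.c_pos i)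
  have hsq : ∀ i, e i * e i = algebraMap ℝ (Cl Q ℝ) (q i) := by
    intro i
    have h := hsum i i
    rw [if_pos rfl, ← two_smul ℝ] at h
    have h2 := congrArg ((2 : ℝ)⁻¹ • ·) h
    simp only [smul_smul] at h2
    rw [inv_mul_cancel₀ two_ne_zero, one_smul] at h2
    rw [h2, halg, halg, TensorProduct.smul_tmul', smul_eq_mul]
    congr 1
    simp only [q]
    ring
  have hanti : ∀ i j, i ≠ j → e i * e j = -(e j * e i) := by
    intro i j hij
    have h := hsum i j
    rw [if_neg hij, map_zero] at h
    exact eq_neg_of_add_eq_zero_left h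
  let B₀ : LinearMap.BilinForm ℝ (Cl Q ℝ) :=
    ∑ i, LinearMap.compl₁₂ (LinearMap.mul ℝ ℝ) (LinearMap.proj i ∘ₗ (clCrd Q ℝ).toLinearMap)
      (LinearMap.proj i ∘ₗ (clCrd Q ℝ).toLinearMap)
  have hB₀ : ∀ x, B₀ x x = ∑ i, clCrd Q ℝ x i ^ 2 := by
    intro x
    simp [B₀, sq]
  obtain ⟨B, hB, hBe⟩ := exists_averaged_form e q hq hsq hanti B₀
    (fun x => by rw [hB₀]; positivity) Finset.univ
  refine ⟨B, fun x => (hB₀ x) ▸ hB x, ?_⟩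
  have hself : ∀ i x y, B (e i * x) y = B x (e i * y) := by
    intro i x y
    have h := hBe i (Finset.mem_univ i) (e i * x) y
    rw [← mul_assoc, hsq, ← Algebra.smul_def, map_smul, LinearMap.smul_apply, smul_eq_mul] at h
    exact (mul_left_cancel₀ (hq i).ne' h).symm
  have hvec : ∀ v x y, B (vec Q v * x) y = B x (vec Q v * y) := by
    intro v x y
    obtain ⟨w, rfl⟩ := u.exists_baseVec_combination v
    have : vec Q (∑ i, w i • u.baseVec ℝ i) = ∑ i, w i • e i :=
      (map_sum (vecLin Q ℝ) _ _).trans (Finset.sum_congr rfl fun i _ => map_smul _ _ _)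
    rw [this]
    simp only [Finset.sum_mul, map_sum, LinearMap.sum_apply, smul_mul_assoc, map_smul,
      LinearMap.smul_apply, hself]
  have hcl : ∀ (c : CliffordAlgebra Q) (x y : Cl Q ℝ), B (((1 : ℝ) ⊗ₜ[ℤ] c) * x) y =
      B x (((1 : ℝ) ⊗ₜ[ℤ] CliffordAlgebra.reverse c) * y) := by
    intro c
    induction c using CliffordAlgebra.induction with
    | algebraMap z =>
      intro x y
      have : ((1 : ℝ) ⊗ₜ[ℤ] algebraMap ℤ (CliffordAlgebra Q) z) = (z : ℝ) • (1 : Cl Q ℝ) := by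
        rw [Algebra.algebraMap_eq_smul_one, TensorProduct.tmul_smul, TensorProduct.smul_tmul',
          zsmul_eq_mul, mul_one, Algebra.TensorProduct.one_def, TensorProduct.smul_tmul',
          smul_eq_mul, mul_one]
      rw [CliffordAlgebra.reverse.commutes, this, smul_mul_assoc, smul_mul_assoc, one_mul,
        one_mul, map_smul, map_smul, LinearMap.smul_apply]
    | ι v =>
      intro x y
      have : ((1 : ℝ) ⊗ₜ[ℤ] CliffordAlgebra.ι Q v) = vec Q (fun i => ((v i : ℤ) : ℝ)) := by
        have hv : v = ∑ i, v i • (Pi.single i 1 : Idx k m → ℤ) := by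
          simpa using (pi_eq_sum_univ' v)
        conv_lhs => rw [hv]
        rw [map_sum, TensorProduct.tmul_sum, vec]
        refine Finset.sum_congr rfl fun i _ => ?_
        rw [map_smul, TensorProduct.tmul_smul, TensorProduct.smul_tmul']
        simp
      rw [CliffordAlgebra.reverse_ι, this, hvec]
    | mul a b ha hb =>
      intro x y
      have : ∀ a b : CliffordAlgebra Q, ((1 : ℝ) ⊗ₜ[ℤ] (a * b)) = (1 ⊗ₜ a) * (1 ⊗ₜ b) := by simp
      rw [CliffordAlgebra.reverse.map_mul, this, this, mul_assoc, ha, hb, mul_assoc]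
    | add a b ha hb =>
      intro x y
      simp only [map_add, TensorProduct.tmul_add, add_mul, LinearMap.add_apply, ha, hb]
  intro c x y
  induction c using TensorProduct.induction_on with
  | zero => simp
  | add a b ha hb => simp only [map_add, add_mul, LinearMap.add_apply, ha, hb]
  | tmul r c =>
    have h1 : ∀ c : CliffordAlgebra Q, r ⊗ₜ[ℤ] c = r • ((1 : ℝ) ⊗ₜ[ℤ] c) := by
      intro c
      simp [TensorProduct.smul_tmul']
    rw [rev_tmul, h1 c, h1, smul_mul_assoc, smul_mul_assoc, map_smul, map_smul,
      LinearMap.smul_apply, hcl]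

/-- In the adapted basis an isometry of the positive definite form has bounded entries. -/
theorem exists_bound_isometry (a b : Idx k m) : ∃ r : ℝ, ∀ M : Matrix (Idx k m) (Idx k m) ℝ,
    M.transpose * gram Q ℝ * M = gram Q ℝ → |M a b| ≤ r := by
  let UR := (algebraMap ℚ ℝ).mapMatrix u.U
  let UI := (algebraMap ℚ ℝ).mapMatrix u.U⁻¹
  have h1 : UR * UI = 1 := by
    rw [← map_mul, u.mul_inv, map_one]
  have h2 : UR.transpose * gram Q ℝ * UR = Matrix.diagonal fun i => (u.c i : ℝ) := by
    have := congrArg (algebraMap ℚ ℝ).mapMatrix u.orth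
    rw [map_mul, map_mul, gram_map] at this
    refine this.trans ?_
    ext i j
    simp [Matrix.diagonal_apply, apply_ite (fun q : ℚ => (q : ℝ))]
  refine ⟨∑ i, ∑ j, |UR a i| * Real.sqrt (u.c j / u.c i) * |UI j b|, fun M hM => ?_⟩
  set W := UI * M * UR with hW
  have hMW : M = UR * W * UI := by
    rw [hW, ← Matrix.mul_assoc, ← Matrix.mul_assoc, h1, Matrix.one_mul, Matrix.mul_assoc, h1,
      Matrix.mul_one]
  have hURW : UR * W = M * UR := by
    rw [hW, ← Matrix.mul_assoc, ← Matrix.mul_assoc, h1, Matrix.one_mul]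
  have h3 : W.transpose * (Matrix.diagonal fun i => (u.c i : ℝ)) * W =
      Matrix.diagonal fun i => (u.c i : ℝ) := by
    calc W.transpose * (Matrix.diagonal fun i => (u.c i : ℝ)) * W
        = (UR * W).transpose * gram Q ℝ * (UR * W) := by
          rw [← h2, Matrix.transpose_mul UR W]
          simp only [Matrix.mul_assoc]
      _ = UR.transpose * (M.transpose * gram Q ℝ * M) * UR := by
          rw [hURW, Matrix.transpose_mul]
          simp only [Matrix.mul_assoc]
      _ = _ := by rw [hM, h2]
  have hWb : ∀ i j, |W i j| ≤ Real.sqrt (u.c j / u.c i) := by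
    intro i j
    have hc : (0 : ℝ) < u.c i := by exact_mod_cast u.c_pos i
    refine Real.abs_le_sqrt ((le_div_iff₀ hc).mpr ?_)
    have h4 := congrFun (congrFun h3 j) j
    rw [Matrix.diagonal_apply_eq, Matrix.mul_assoc, Matrix.mul_apply] at h4
    simp only [Matrix.transpose_apply, Matrix.diagonal_mul] at h4
    rw [← h4]
    have : W i j ^ 2 * u.c i = W i j * (u.c i * W i j) := by ring
    rw [this]
    refine Finset.single_le_sum (f := fun i => W i j * ((u.c i : ℝ) * W i j)) (fun l _ => ?_)
      (Finset.mem_univ i)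
    have hl : (0 : ℝ) < u.c l := by exact_mod_cast u.c_pos l
    have : W l j * ((u.c l : ℝ) * W l j) = (u.c l : ℝ) * W l j ^ 2 := by ring
    rw [this]
    positivity
  have hab : M a b = ∑ i, ∑ j, UR a i * W i j * UI j b := by
    conv_lhs => rw [hMW]
    rw [Matrix.mul_apply]
    simp only [Matrix.mul_apply, Finset.sum_mul]
    rw [Finset.sum_comm]
  rw [hab]
  refine (Finset.abs_sum_le_sum_abs _ _).trans (Finset.sum_le_sum fun i _ => ?_)
  refine (Finset.abs_sum_le_sum_abs _ _).trans (Finset.sum_le_sum fun j _ => ?_)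
  rw [abs_mul, abs_mul]
  gcongr
  exact hWb i j

/-- The reversal of an element of the spin group is its inverse, so left multiplication by it is an
isometry for the form of `exists_adjoint_form`; in particular the element has the length of `1`. -/
theorem exists_bound_spinCrd (i : SpinIdx Q) : ∃ r : ℝ, ∀ h : Spin Q ℝ, |spinCrd Q ℝ h i| ≤ r := by
  rcases i with i | ⟨a, b⟩
  · obtain ⟨B, hB, hadj⟩ := u.exists_adjoint_form
    refine ⟨Real.sqrt (B 1 1), fun h => Real.abs_le_sqrt ?_⟩
    have h1 : B (h.1.1 : Cl Q ℝ) (h.1.1 : Cl Q ℝ) = B 1 1 := by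
      have := hadj (h.1.1 : Cl Q ℝ) 1 (h.1.1 : Cl Q ℝ)
      rwa [mul_one, spin_rev_mul] at this
    rw [← h1]
    refine le_trans ?_ (hB _)
    exact Finset.single_le_sum (f := fun i => clCrd Q ℝ (h.1.1 : Cl Q ℝ) i ^ 2)
      (fun j _ => sq_nonneg _) (Finset.mem_univ i)
  · obtain ⟨r, hr⟩ := u.exists_bound_isometry a b
    exact ⟨r, fun h => hr _ (spinMat_gram h)⟩

/-- The coordinates embed `Spin_Q(ℝ)` as a closed and bounded set. -/
theorem compactSpace_spin_real : CompactSpace (Spin Q ℝ) := by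
  choose r hr using u.exists_bound_spinCrd
  have hK : IsCompact (Set.pi Set.univ fun i => Set.Icc (-r i) (r i)) :=
    isCompact_univ_pi fun i => isCompact_Icc
  rw [← isCompact_univ_iff, ← Set.preimage_univ (f := spinCrd Q ℝ)]
  have := isClosedEmbedding_spinCrd.isCompact_preimage hK (f := spinCrd Q ℝ)
  convert this using 1
  ext h
  simp only [Set.preimage_univ, Set.mem_univ, Set.mem_preimage, Set.mem_pi, true_iff]
  exact fun i _ => abs_le.mp (hr i h)

/-- The coordinates of elements of `Spin_Q(ℤ)` are bounded integers. -/
theorem finite_spin_int : Finite (Spin Q ℤ) := by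
  choose r hr using u.exists_bound_spinCrd
  have hfin : (Set.pi Set.univ fun i => Set.Icc (-⌈r i⌉) ⌈r i⌉ : Set (SpinIdx Q → ℤ)).Finite :=
    Set.Finite.pi fun i => Set.finite_Icc _ _
  refine Set.finite_univ_iff.mp ((hfin.preimage spinCrd_injective.injOn).subset fun h _ => ?_)
  intro i _
  have h1 := hr i (spinMap Q (Int.castRingHom ℝ) h)
  rw [spinCrd_spinMap] at h1
  have h2 := (abs_le.mp (h1.trans (Int.le_ceil (r i))))
  simp only [eq_intCast] at h2
  exact ⟨by exact_mod_cast h2.1, by exact_mod_cast h2.2⟩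

end AdaptedBasis
end Compact

/-! ### Topology and arithmetic of the adelic group -/

section Coordinates

variable {k m : ℕ} {Q : QuadraticForm ℤ (Idx k m → ℤ)}

theorem exists_parMap_eq {R S : Type} [CommRing R] [CommRing S] {f : R →+* S}
    (hf : Function.Injective f) {p : Par k m S} (hp : ∀ i j, p.1.1 i j ∈ f.range) :
    ∃ p', parMap k m f p' = p := by
  choose M hM using hp
  let M' : Matrix (Idx k m) (Idx k m) R := Matrix.of M
  have hM' : f.mapMatrix M' = p.1.1 := by
    ext i j
    exact hM i j
  have hdet : M'.det = 1 := by
    apply hf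
    rw [RingHom.map_det, hM', map_one]
    exact p.1.2
  have h11 : f.mapMatrix M'.toBlocks₁₁ = p.1.1.toBlocks₁₁ := by
    rw [← hM']
    rfl
  have h22 : f.mapMatrix M'.toBlocks₂₂ = p.1.1.toBlocks₂₂ := by
    rw [← hM']
    rfl
  refine ⟨⟨⟨M', hdet⟩, ?_, ?_, ?_⟩, Subtype.ext (Subtype.ext hM')⟩
  · ext i j
    apply hf
    have := congrFun (congrFun p.2.1 i) j
    rw [← hM'] at this
    rw [Matrix.zero_apply, map_zero]
    exact this
  · apply hf
    rw [RingHom.map_det, RingHom.map_det, h11, h22]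
    exact p.2.2.1
  · apply hf
    rw [map_pow, RingHom.map_det, h11, map_one]
    exact p.2.2.2

variable (Q) in
/-- The index set of the coordinates of an element of `G(R)`. -/
abbrev GrpIdx : Type := SpinIdx Q ⊕ (Idx k m × Idx k m)

variable (Q) in
/-- The coordinates of an element of `G(R)`. -/
def grpCrd (R : Type) [CommRing R] (h : Grp Q R) : GrpIdx Q → R :=
  Sum.elim (spinCrd Q R h.1) fun p => h.2.1.1 p.1 p.2

theorem grpCrd_injective {R : Type} [CommRing R] : Function.Injective (grpCrd Q R) := by
  intro g h e
  refine Prod.ext (spinCrd_injective (funext fun i => congrFun e (.inl i)))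
    (Subtype.ext (Subtype.ext ?_))
  ext i j
  exact congrFun e (.inr (i, j))

theorem grpCrd_grpMap {R S : Type} [CommRing R] [CommRing S] (f : R →+* S) (h : Grp Q R)
    (i : GrpIdx Q) : grpCrd Q S (grpMap Q f h) i = f (grpCrd Q R h i) := by
  rcases i with i | p
  · exact spinCrd_spinMap f _ i
  · rfl

theorem exists_grpMap_eq {R S : Type} [CommRing R] [CommRing S] {f : R →+* S}
    (hf : Function.Injective f) {h : Grp Q S} (hh : ∀ i, grpCrd Q S h i ∈ f.range) :
    ∃ h', grpMap Q f h' = h := by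
  obtain ⟨x, hx⟩ := exists_spinMap_eq hf fun i => hh (.inl i)
  obtain ⟨p, hp⟩ := exists_parMap_eq hf (p := h.2) fun i j => hh (.inr (i, j))
  exact ⟨(x, p), Prod.ext hx hp⟩

theorem grpMap_injective {R S : Type} [CommRing R] [CommRing S] {f : R →+* S}
    (hf : Function.Injective f) : Function.Injective (grpMap Q f) := by
  intro g h e
  refine grpCrd_injective (funext fun i => hf ?_)
  rw [← grpCrd_grpMap, ← grpCrd_grpMap, e]

theorem grpMap_comp {R S T : Type} [CommRing R] [CommRing S] [CommRing T] (f : R →+* S)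
    (f' : S →+* T) (h : Grp Q R) : grpMap Q f' (grpMap Q f h) = grpMap Q (f'.comp f) h := by
  refine grpCrd_injective (funext fun i => ?_)
  simp only [grpCrd_grpMap, RingHom.comp_apply]

instance : Countable (Grp Q ℚ) := grpCrd_injective.countable

theorem isClosedEmbedding_grpCrd {R : Type} [CommRing R] [TopologicalSpace R]
    [IsTopologicalRing R] [T2Space R] : Topology.IsClosedEmbedding (grpCrd Q R) := by
  have hpar : Topology.IsClosedEmbedding
      (fun p : Par k m R => fun q : Idx k m × Idx k m => p.1.1 q.1 q.2) := by
    have hind : Topology.IsInducing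
        (fun p : Par k m R => fun q : Idx k m × Idx k m => p.1.1 q.1 q.2) := by
      let e : Matrix (Idx k m) (Idx k m) R ≃ₜ (Idx k m × Idx k m → R) :=
        { toFun := fun M q => M q.1 q.2
          invFun := fun c => Matrix.of fun i j => c (i, j)
          left_inv := fun M => rfl
          right_inv := fun c => rfl
          continuous_toFun := continuous_pi fun q => continuous_id.matrix_elem _ _
          continuous_invFun := continuous_matrix fun i j => continuous_apply _ }
      exact e.isInducing.comp (Topology.IsInducing.subtypeVal.comp Topology.IsInducing.subtypeVal)
    refine ⟨⟨hind, fun p p' h => Subtype.ext (Subtype.ext ?_)⟩, ?_⟩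
    · ext i j
      exact congrFun h (i, j)
    · have hrange : Set.range (fun p : Par k m R => fun q : Idx k m × Idx k m => p.1.1 q.1 q.2) =
          (fun c : Idx k m × Idx k m → R => (Matrix.of fun i j => c (i, j))) ⁻¹'
            {M : Matrix (Idx k m) (Idx k m) R | M.det = 1 ∧ M.toBlocks₂₁ = 0 ∧
              M.toBlocks₁₁.det = M.toBlocks₂₂.det ∧ M.toBlocks₁₁.det ^ 2 = 1} := by
        ext c
        constructor
        · rintro ⟨p, rfl⟩
          exact ⟨p.1.2, p.2.1, p.2.2.1, p.2.2.2⟩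
        · rintro ⟨h0, h1, h2, h3⟩
          exact ⟨⟨⟨_, h0⟩, h1, h2, h3⟩, rfl⟩
      rw [hrange]
      have h11 : Continuous fun M : Matrix (Idx k m) (Idx k m) R => M.toBlocks₁₁ :=
        continuous_matrix fun i j => continuous_id.matrix_elem _ _
      have h21 : Continuous fun M : Matrix (Idx k m) (Idx k m) R => M.toBlocks₂₁ :=
        continuous_matrix fun i j => continuous_id.matrix_elem _ _
      have h22 : Continuous fun M : Matrix (Idx k m) (Idx k m) R => M.toBlocks₂₂ :=
        continuous_matrix fun i j => continuous_id.matrix_elem _ _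
      refine IsClosed.preimage (continuous_matrix fun i j => continuous_apply (i, j)) ?_
      exact (isClosed_eq continuous_id.matrix_det continuous_const).inter
        ((isClosed_eq h21 continuous_const).inter
          ((isClosed_eq h11.matrix_det h22.matrix_det).inter
            (isClosed_eq (h11.matrix_det.pow 2) continuous_const)))
  have hsum : grpCrd Q R = (Homeomorph.sumArrowHomeomorphProdArrow (ι := SpinIdx Q)
      (ι' := Idx k m × Idx k m) (X := R)).symm ∘ Prod.map (spinCrd Q R)
        (fun p : Par k m R => fun q : Idx k m × Idx k m => p.1.1 q.1 q.2) := by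
    funext h
    ext (i | i) <;> rfl
  rw [hsum]
  exact (Homeomorph.isClosedEmbedding _).comp (isClosedEmbedding_spinCrd.prodMap hpar)

end Coordinates

section Adelic

variable {k m : ℕ} (Q : QuadraticForm ℤ (Idx k m → ℤ))

/-- The coordinates of an adelic point. -/
def crdA (b : GrpA Q) : (GrpIdx Q → ℝ) × (GrpIdx Q → FinAdele) :=
  (grpCrd Q ℝ b.1, grpCrd Q FinAdele b.2)

theorem isClosedEmbedding_crdA : Topology.IsClosedEmbedding (crdA Q) :=
  isClosedEmbedding_grpCrd.prodMap isClosedEmbedding_grpCrd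

/-- The diagonal embedding of `G(ℚ)` into `G(𝔸)`. -/
def ratEmb : Grp Q ℚ →* GrpA Q :=
  (grpMap Q (algebraMap ℚ ℝ)).prod (grpMap Q (algebraMap ℚ FinAdele))

variable {Q}

theorem ratEmb_injective : Function.Injective (ratEmb Q) := fun _ _ h =>
  grpMap_injective (algebraMap ℚ ℝ).injective (congrArg Prod.fst h)

theorem crdA_ratEmb (q : Grp Q ℚ) : crdA Q (ratEmb Q q) = ratVec _ (grpCrd Q ℚ q) := by
  refine Prod.ext ?_ ?_ <;> funext i <;> exact grpCrd_grpMap _ _ _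

/-- Every set of rational points is closed in `G(𝔸)`. -/
theorem isClosed_image_ratEmb (A : Set (Grp Q ℚ)) : IsClosed (ratEmb Q '' A) := by
  have h : ratEmb Q '' A = crdA Q ⁻¹' (ratVec _ '' (grpCrd Q ℚ '' A)) := by
    ext b
    constructor
    · rintro ⟨q, hq, rfl⟩
      exact ⟨_, ⟨q, hq, rfl⟩, (crdA_ratEmb q).symm⟩
    · rintro ⟨_, ⟨q, hq, rfl⟩, h⟩
      exact ⟨q, hq, (isClosedEmbedding_crdA Q).injective ((crdA_ratEmb q).trans h)⟩
  rw [h]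
  exact (isClosed_image_ratVec _).preimage (isClosedEmbedding_crdA Q).continuous

/-- The group `G(ℚ)` is closed and discrete in `G(𝔸)`. -/
theorem isClosed_subset_ratPts {A : Set (GrpA Q)} (hA : A ⊆ ratPts Q) : IsClosed A := by
  have h : A = ratEmb Q '' (ratEmb Q ⁻¹' A) := by
    rw [Set.image_preimage_eq_inter_range, Set.inter_eq_left.mpr]
    exact hA
  rw [h]
  exact isClosed_image_ratEmb _

instance : IsClosed (ratPts Q : Set (GrpA Q)) := isClosed_subset_ratPts subset_rfl

instance : Countable (ratPts Q) := (Set.countable_range (ratEmb Q)).to_subtype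

/-- A compact set contains only finitely many rational points, by discreteness. -/
theorem finite_inter_ratPts {C : Set (GrpA Q)} (hC : IsCompact C) :
    (C ∩ ratPts Q).Finite := by
  have hc : IsCompact (C ∩ ratPts Q) := hC.inter_right inferInstance
  refine hc.finite (isDiscrete_iff_discreteTopology.mpr ?_)
  refine discreteTopology_iff_forall_isClosed.mpr fun A => ?_
  have := isClosed_subset_ratPts (A := Subtype.val '' A) (by
    rintro _ ⟨x, _, rfl⟩
    exact x.2.2)
  rw [← Set.preimage_image_eq A Subtype.val_injective]
  exact this.preimage continuous_subtype_val

theorem mem_openPts_iff {b : GrpA Q} : b ∈ openPts Q ↔ ∀ i, grpCrd Q FinAdele b.2 i ∈ zhat := by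
  constructor
  · rintro ⟨-, c, hc⟩ i
    rw [← hc, grpCrd_grpMap]
    exact (grpCrd Q zhat c i).2
  · intro h
    refine ⟨trivial, exists_grpMap_eq Subtype.val_injective fun i => ?_⟩
    exact ⟨⟨_, h i⟩, rfl⟩

theorem isOpen_openPts : IsOpen (openPts Q : Set (GrpA Q)) := by
  have h : (openPts Q : Set (GrpA Q)) = ⋂ i, {b | grpCrd Q FinAdele b.2 i ∈ zhat} := by
    ext b
    simp only [SetLike.mem_coe, mem_openPts_iff, Set.mem_iInter, Set.mem_ofPred_eq]
  rw [h]
  refine isOpen_iInter_of_finite fun i => isOpen_zhat.preimage ?_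
  exact (continuous_apply i).comp (isClosedEmbedding_grpCrd.continuous.comp continuous_snd)

/-- `G(ℚ) ∩ G(ℝ × Ẑ) = G(ℤ)`. -/
theorem exists_int_of_mem_openPts {q : Grp Q ℚ} (hq : ratEmb Q q ∈ openPts Q) :
    ∃ z : Grp Q ℤ, q = grpMap Q (Int.castRingHom ℚ) z := by
  rw [mem_openPts_iff] at hq
  obtain ⟨z, hz⟩ := exists_grpMap_eq (f := Int.castRingHom ℚ) (h := q)
    (Int.cast_injective) fun i => by
      have := hq i
      change grpCrd Q FinAdele (grpMap Q (algebraMap ℚ FinAdele) q) i ∈ zhat at this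
      rw [grpCrd_grpMap, algebraMap_mem_zhat_iff] at this
      exact this
  exact ⟨z, hz.symm⟩

theorem ratEmb_int_mem_openPts (z : Grp Q ℤ) :
    ratEmb Q (grpMap Q (Int.castRingHom ℚ) z) ∈ openPts Q := by
  rw [mem_openPts_iff]
  intro i
  change grpCrd Q FinAdele (grpMap Q (algebraMap ℚ FinAdele) _) i ∈ zhat
  rw [grpCrd_grpMap, algebraMap_mem_zhat_iff, grpCrd_grpMap]
  exact ⟨_, rfl⟩

theorem ratEmb_int_fst (z : Grp Q ℤ) :
    (ratEmb Q (grpMap Q (Int.castRingHom ℚ) z)).1 = grpMap Q (Int.castRingHom ℝ) z := by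
  change grpMap Q (algebraMap ℚ ℝ) _ = _
  rw [grpMap_comp]
  congr 1

theorem mk_eq_iff {b b' : GrpA Q} : YA.mk Q b = YA.mk Q b' ↔ ∃ q, b' = b * ratEmb Q q := by
  change (QuotientGroup.mk b : GrpA Q ⧸ ratPts Q) = QuotientGroup.mk b' ↔ _
  rw [QuotientGroup.eq]
  constructor
  · rintro ⟨q, hq⟩
    refine ⟨q, ?_⟩
    change ratEmb Q q = b⁻¹ * b' at hq
    rw [hq, mul_inv_cancel_left]
  · rintro ⟨q, rfl⟩
    exact ⟨q, by rw [inv_mul_cancel_left]; rfl⟩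

theorem smul_mk (b b' : GrpA Q) : b • YA.mk Q b' = YA.mk Q (b * b') := rfl

theorem continuous_mk : Continuous (YA.mk Q) := continuous_quot_mk

theorem isOpenMap_mk : IsOpenMap (YA.mk Q) := QuotientGroup.isOpenMap_coe

instance : BorelSpace (YA Q) := ⟨rfl⟩

instance : BorelSpace (DC Q) := ⟨rfl⟩

instance : T2Space (YA Q) := inferInstanceAs (T2Space (GrpA Q ⧸ ratPts Q))

instance : ContinuousConstSMul (GrpA Q) (YA Q) :=
  inferInstanceAs (ContinuousConstSMul (GrpA Q) (GrpA Q ⧸ ratPts Q))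

theorem isOpen_openOrbit : IsOpen (openOrbit Q) := isOpenMap_mk _ isOpen_openPts

theorem Phi_mk {b : GrpA Q} (hb : b ∈ openPts Q) : Phi Q (YA.mk Q b) = DC.mk Q b.1 := by
  have h : ∃ b' ∈ openPts Q, YA.mk Q b' = YA.mk Q b := ⟨b, hb, rfl⟩
  rw [Phi, dif_pos h]
  obtain ⟨h1, h2⟩ := h.choose_spec
  obtain ⟨q, hq⟩ := mk_eq_iff.mp h2
  have hq' : ratEmb Q q ∈ openPts Q := by
    have : ratEmb Q q = h.choose⁻¹ * b := eq_inv_mul_of_mul_eq hq.symm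
    rw [this]
    exact mul_mem (inv_mem h1) hb
  obtain ⟨z, rfl⟩ := exists_int_of_mem_openPts hq'
  refine (DoubleCoset.eq _ _ _ _).mpr ⟨1, one_mem _, grpMap Q (Int.castRingHom ℝ) z, ⟨z, rfl⟩, ?_⟩
  rw [one_mul, ← ratEmb_int_fst]
  exact congrArg Prod.fst hq

/-- On the open set `𝒰` the map is continuous, and on its complement it is constant by definition.
-/
theorem measurable_Phi : Measurable (Phi Q) := by
  refine measurable_of_isOpen fun V hV => ?_
  have hV' : IsOpen (DC.mk Q ⁻¹' V) := hV
  have h1 : Phi Q ⁻¹' V ∩ openOrbit Q =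
      YA.mk Q '' ((openPts Q : Set (GrpA Q)) ∩ Prod.fst ⁻¹' (DC.mk Q ⁻¹' V)) := by
    ext y
    constructor
    · rintro ⟨hy, b, hb, rfl⟩
      refine ⟨b, ⟨hb, ?_⟩, rfl⟩
      rwa [Set.mem_preimage, Phi_mk hb] at hy
    · rintro ⟨b, ⟨hb, hbV⟩, rfl⟩
      refine ⟨?_, b, hb, rfl⟩
      rwa [Set.mem_preimage, Phi_mk hb]
  have h2 : MeasurableSet (Phi Q ⁻¹' V ∩ openOrbit Q) := by
    rw [h1]
    exact (isOpenMap_mk _ (isOpen_openPts.inter (hV'.preimage continuous_fst))).measurableSet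
  have h3 : MeasurableSet (Phi Q ⁻¹' V \ openOrbit Q) := by
    have hc : ∀ y ∉ openOrbit Q, Phi Q y = DC.mk Q 1 := fun y hy => dif_neg hy
    by_cases h : DC.mk Q 1 ∈ V
    · have : Phi Q ⁻¹' V \ openOrbit Q = (openOrbit Q)ᶜ := by
        ext y
        refine ⟨fun hy => hy.2, fun hy => ⟨?_, hy⟩⟩
        rwa [Set.mem_preimage, hc y hy]
      rw [this]
      exact isOpen_openOrbit.measurableSet.compl
    · have : Phi Q ⁻¹' V \ openOrbit Q = ∅ := by
        ext y
        refine ⟨fun hy => h ?_, fun hy => hy.elim⟩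
        have := hy.1
        rwa [Set.mem_preimage, hc y hy.2] at this
      rw [this]
      exact MeasurableSet.empty
  rw [← Set.inter_union_sdiff (Phi Q ⁻¹' V) (openOrbit Q)]
  exact h2.union h3

end Adelic

/-! ### Rational subspaces in a packet -/

section SpinAct

variable {k m : ℕ} {Q : QuadraticForm ℤ (Idx k m → ℤ)} {R : Type} [CommRing R]

/-- The image of a submodule of `R ^ n` under an element of the spin group. -/
def spinAct (s : Spin Q R) (W : Submodule R (Idx k m → R)) : Submodule R (Idx k m → R) :=
  W.map (Matrix.toLin' (spinMat Q R s).1)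

theorem spinAct_mul (s t : Spin Q R) (W : Submodule R (Idx k m → R)) :
    spinAct (s * t) W = spinAct s (spinAct t W) := by
  have : (spinMat Q R (s * t)).1 = (spinMat Q R s).1 * (spinMat Q R t).1 := by
    rw [map_mul]
    rfl
  rw [spinAct, this, Matrix.toLin'_mul, Submodule.map_comp]
  rfl

theorem spinAct_one (W : Submodule R (Idx k m → R)) : spinAct (1 : Spin Q R) W = W := by
  have : (spinMat Q R 1).1 = 1 := by
    rw [map_one]
    rfl
  rw [spinAct, this, Matrix.toLin'_one, Submodule.map_id]

theorem mem_stab_iff {s : Spin Q R} {W : Submodule R (Idx k m → R)} :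
    s ∈ stab Q W ↔ spinAct s W = W := Iff.rfl

theorem spinAct_eq_iff {s : Spin Q R} {V W : Submodule R (Idx k m → R)} :
    spinAct s V = W ↔ V = spinAct s⁻¹ W := by
  constructor
  · rintro rfl
    rw [← spinAct_mul, inv_mul_cancel, spinAct_one]
  · rintro rfl
    rw [← spinAct_mul, mul_inv_cancel, spinAct_one]

theorem mem_stab_spinAct_iff {s t : Spin Q R} {W : Submodule R (Idx k m → R)} :
    s ∈ stab Q (spinAct t W) ↔ t⁻¹ * s * t ∈ stab Q W := by
  rw [mem_stab_iff, mem_stab_iff, spinAct_mul, spinAct_mul]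
  refine ⟨fun h => ?_, fun h => ?_⟩
  · rw [h, ← spinAct_mul, inv_mul_cancel, spinAct_one]
  · rw [spinAct_eq_iff, inv_inv] at h
    exact h

/-- The stabilizer in `Spin_Q(ℤ)` of a real subspace. -/
def intStab (W : Submodule ℝ (Idx k m → ℝ)) : Subgroup (Spin Q ℤ) :=
  (stab Q W).comap (spinMap Q (Int.castRingHom ℝ))

theorem card_intStab_spinAct (η : Spin Q ℤ) (W : Submodule ℝ (Idx k m → ℝ)) :
    Nat.card (intStab (Q := Q) (spinAct (spinMap Q (Int.castRingHom ℝ) η) W)) =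
      Nat.card (intStab (Q := Q) W) := by
  refine Nat.card_congr ((MulAut.conj η⁻¹).toEquiv.subtypeEquiv fun γ => ?_)
  change spinMap Q (Int.castRingHom ℝ) γ ∈ stab Q _ ↔
    spinMap Q (Int.castRingHom ℝ) (η⁻¹ * γ * η⁻¹⁻¹) ∈ stab Q W
  rw [mem_stab_spinAct_iff, inv_inv, map_mul, map_mul, map_inv]

end SpinAct

section Extension

variable {k m : ℕ} {Q : QuadraticForm ℤ (Idx k m → ℤ)} {L : Submodule ℚ (Idx k m → ℚ)}
variable {R : Type} [CommRing R] [Algebra ℚ R]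

theorem ext_rat (L : Submodule ℚ (Idx k m → ℚ)) : ext ℚ L = L := by
  have : (fun (v : Idx k m → ℚ) i => algebraMap ℚ ℚ (v i)) = id := rfl
  rw [ext, this, Set.image_id, Submodule.span_eq]

theorem ext_map (M : Matrix (Idx k m) (Idx k m) ℚ) (L : Submodule ℚ (Idx k m → ℚ)) :
    ext R (L.map (Matrix.toLin' M)) =
      (ext R L).map (Matrix.toLin' ((algebraMap ℚ R).mapMatrix M)) := by
  rw [ext, ext, Submodule.map_span, ← Set.image_comp, Submodule.map_coe, ← Set.image_comp]
  congr 2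
  funext v i
  simp [Matrix.mulVec, dotProduct]

theorem ext_spinAct (s : Spin Q ℚ) (L : Submodule ℚ (Idx k m → ℚ)) :
    ext R (spinAct s L) = spinAct (spinMap Q (algebraMap ℚ R) s) (ext R L) :=
  ext_map _ _

theorem ext_stdSpace : ext R (stdSpace k m ℚ) = stdSpace k m R := by
  classical
  refine le_antisymm (Submodule.span_le.mpr ?_) fun v hv => ?_
  · rintro _ ⟨v, hv, rfl⟩ j
    exact (congrArg (algebraMap ℚ R) (hv j)).trans (map_zero _)
  · have h : v = ∑ i : Fin k, v (.inl i) • (fun a => algebraMap ℚ R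
        ((Pi.single (Sum.inl i) 1 : Idx k m → ℚ) a)) := by
      ext (a | a)
      · simp [Finset.sum_apply, Pi.single_apply, apply_ite]
      · simpa [Finset.sum_apply, Pi.single_apply] using hv a
    rw [h]
    refine Submodule.sum_mem _ fun i _ => Submodule.smul_mem _ _ (Submodule.subset_span ?_)
    refine ⟨_, fun j => ?_, rfl⟩
    simp

/-- If the first `k` columns of `g` form a basis of `L(ℤ)`, then `g` maps `ℚ ^ k` onto `L`. -/
theorem map_stdSpace_eq {g : Matrix.SpecialLinearGroup (Idx k m) ℤ}
    (hg : Submodule.span ℤ (Set.range fun i : Fin k => g.1.col (Sum.inl i)) = latticePts L) :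
    (stdSpace k m ℚ).map (Matrix.toLin' (castSL ℚ g).1) = L := by
  classical
  have hcol : ∀ i : Fin k, (fun j => ((g.1.col (Sum.inl i) j : ℤ) : ℚ)) =
      Matrix.toLin' (castSL ℚ g).1 (Pi.single (Sum.inl i) 1) := by
    intro i
    ext j
    simp
  have hsingle : ∀ i : Fin k, (Pi.single (Sum.inl i) 1 : Idx k m → ℚ) ∈ stdSpace k m ℚ := by
    intro i j
    simp
  refine le_antisymm ?_ fun x hx => ?_
  · rw [Submodule.map_le_iff_le_comap]
    intro v hv
    have h : v = ∑ i : Fin k, v (.inl i) • (Pi.single (Sum.inl i) 1 : Idx k m → ℚ) := by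
      ext (a | a)
      · simp [Finset.sum_apply, Pi.single_apply]
      · simpa [Finset.sum_apply, Pi.single_apply] using hv a
    rw [h]
    refine Submodule.sum_mem _ fun i _ => Submodule.smul_mem _ _ ?_
    rw [Submodule.mem_comap, ← hcol, ← mem_latticePts_iff, ← hg]
    exact Submodule.subset_span ⟨i, rfl⟩
  · obtain ⟨N, z, hN, hz, hzx⟩ := exists_smul_mem_latticePts hx
    have h3 : (fun i => (z i : ℚ)) = (N : ℚ) • x := by
      ext i
      simp [hzx]
    have hN' : (N : ℚ) ≠ 0 := Int.cast_ne_zero.mpr hN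
    have h4 : (fun i => (z i : ℚ)) ∈ (stdSpace k m ℚ).map (Matrix.toLin' (castSL ℚ g).1) := by
      rw [← hg] at hz
      clear h3 hzx
      induction hz using Submodule.span_induction with
      | mem z hz =>
        obtain ⟨i, rfl⟩ := hz
        change (fun j => ((g.1.col (Sum.inl i) j : ℤ) : ℚ)) ∈ _
        rw [hcol]
        exact Submodule.mem_map_of_mem (hsingle i)
      | zero =>
        have : (fun i : Idx k m => (((0 : Idx k m → ℤ) i : ℤ) : ℚ)) = 0 := by
          ext i
          simp
        rw [this]
        exact zero_mem _
      | add x y _ _ hx hy =>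
        have : (fun i : Idx k m => (((x + y) i : ℤ) : ℚ)) =
            (fun i => (x i : ℚ)) + fun i => (y i : ℚ) := by
          ext i
          simp
        rw [this]
        exact add_mem hx hy
      | smul a x _ hx =>
        have : (fun i : Idx k m => (((a • x) i : ℤ) : ℚ)) = (a : ℚ) • fun i => (x i : ℚ) := by
          ext i
          simp
        rw [this]
        exact Submodule.smul_mem _ _ hx
    rw [h3] at h4
    exact (Submodule.smul_mem_iff _ hN').mp h4

/-- Conversely, since `g` is unimodular, `g ℚ ^ k = L` implies that the first `k` columns of `g`
span `L(ℤ)`. -/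
theorem span_col_eq_latticePts {g : Matrix.SpecialLinearGroup (Idx k m) ℤ}
    (hg : (stdSpace k m ℚ).map (Matrix.toLin' (castSL ℚ g).1) = L) :
    Submodule.span ℤ (Set.range fun i : Fin k => g.1.col (Sum.inl i)) = latticePts L := by
  classical
  refine le_antisymm (Submodule.span_le.mpr ?_) fun z hz => ?_
  · rintro _ ⟨i, rfl⟩
    change (fun j => ((g.1.col (Sum.inl i) j : ℤ) : ℚ)) ∈ L
    rw [← hg]
    refine ⟨Pi.single (Sum.inl i) 1, fun j => by simp, ?_⟩
    ext j
    simp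
  · rw [mem_latticePts_iff, ← hg] at hz
    obtain ⟨v, hv, hvz⟩ := hz
    let y : Idx k m → ℤ := (g⁻¹).1.mulVec z
    have hgy : g.1.mulVec y = z := by
      rw [Matrix.mulVec_mulVec, SL_mul_inv, Matrix.one_mulVec]
    have hy : ∀ j, y (.inr j) = 0 := by
      intro j
      have h1 : ((castSL ℚ g)⁻¹).1.mulVec (fun i => (z i : ℚ)) = v := by
        rw [← hvz, Matrix.toLin'_apply, Matrix.mulVec_mulVec, SL_inv_mul, Matrix.one_mulVec]
      have h2 : ((castSL ℚ g)⁻¹).1.mulVec (fun i => (z i : ℚ)) = fun i => (y i : ℚ) := by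
        have h3 : ((castSL ℚ g)⁻¹).1 = (castSL ℚ g⁻¹).1 := by
          rw [← map_inv]
        rw [h3]
        ext i
        simp only [y, Matrix.mulVec, dotProduct, Int.cast_sum, Int.cast_mul]
        rfl
      have h3 := congrFun (h2.symm.trans h1) (.inr j)
      rw [hv j] at h3
      exact_mod_cast h3
    have h : z = ∑ i : Fin k, y (.inl i) • g.1.col (Sum.inl i) := by
      rw [← hgy]
      ext j
      simp [Matrix.mulVec, dotProduct, Fintype.sum_sum_type, hy, Finset.sum_apply, mul_comm]
    rw [h]
    exact Submodule.sum_mem _ fun i _ =>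
      Submodule.smul_mem _ _ (Submodule.subset_span ⟨i, rfl⟩)

theorem finrank_stdSpace_rat : Module.finrank ℚ (stdSpace k m ℚ) = k := by
  have h : stdSpace k m ℚ = LinearMap.range
      ((LinearEquiv.sumArrowLequivProdArrow (Fin k) (Fin m) ℚ ℚ).symm.toLinearMap ∘ₗ
        LinearMap.inl ℚ (Fin k → ℚ) (Fin m → ℚ)) := by
    ext v
    constructor
    · intro hv
      refine ⟨fun i => v (Sum.inl i), ?_⟩
      ext (i | j)
      · simp
      · simpa using (hv j).symm
    · rintro ⟨w, rfl⟩ j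
      simp
  rw [h, LinearMap.finrank_range_of_inj]
  · simp
  · intro x y hxy
    simpa using hxy

theorem GridData.finrank_eq (d : GridData Q L) : Module.finrank ℚ L = k := by
  rw [← map_stdSpace_eq d.g_span, finrank_map, finrank_stdSpace_rat]

namespace AdaptedBasis

variable (u : AdaptedBasis Q L)

include u in
/-- The stabilizer of `L` is defined by equations with rational coefficients, so membership can be
tested after an injective change of rings. -/
theorem spinMap_mem_stabL_iff {S : Type} [CommRing S] [Algebra ℚ S] {f : R →+* S}
    (hf : Function.Injective f) {s : Spin Q R} :
    spinMap Q f s ∈ stabL Q L S ↔ s ∈ stabL Q L R := by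
  have hPR : f.mapMatrix (u.PR R) = u.PR S := by
    have h : f.comp (algebraMap ℚ R) = algebraMap ℚ S := Subsingleton.elim _ _
    ext i j
    exact congrArg (fun φ : ℚ →+* S => φ (u.P i j)) h
  have hM : (spinMat Q S (spinMap Q f s)).1 = f.mapMatrix (spinMat Q R s).1 := rfl
  rw [u.mem_stabL_iff, u.mem_stabL_iff, hM, ← hPR, ← map_mul, ← map_mul]
  refine ⟨fun h => ?_, fun h => by rw [h]⟩
  ext i j
  exact hf (congrFun (congrFun h i) j)

include u in
theorem stabZ_eq_intStab : stabZ Q L = intStab (ext ℝ L) := by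
  ext γ
  have h := u.spinMap_mem_stabL_iff (algebraMap ℚ ℝ).injective
    (s := spinMap Q (Int.castRingHom ℚ) γ)
  have h2 : spinMap Q (algebraMap ℚ ℝ) (spinMap Q (Int.castRingHom ℚ) γ) =
      spinMap Q (Int.castRingHom ℝ) γ := by
    refine spinCrd_injective (funext fun i => ?_)
    simp only [spinCrd_spinMap, eq_intCast, map_intCast]
  rw [h2, stabL, stabL, ext_rat] at h
  exact h.symm

include u in
/-- The rational points of the torus are `T_L(𝔸) ∩ G(ℚ)`. -/
theorem mem_ratTorus_iff {g : Matrix.SpecialLinearGroup (Idx k m) ℤ} {x : Grp Q ℚ} :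
    ratEmb Q x ∈ torusA Q L g ↔ x ∈ torusGrp Q L g ℚ := by
  have h : ∀ {S : Type} [CommRing S] [Algebra ℚ S],
      x ∈ torusGrp Q L g ℚ → grpMap Q (algebraMap ℚ S) x ∈ torusGrp Q L g S := by
    intro S _ _ hx
    rw [u.mem_torusGrp_iff] at hx ⊢
    rw [u.orbMap_grpMap, hx, u.basePair_map]
  refine ⟨fun hx => ?_, fun hx => ⟨h hx, h hx⟩⟩
  have h1 : grpMap Q (algebraMap ℚ ℝ) x ∈ torusGrp Q L g ℝ := hx.1
  rw [u.mem_torusGrp_iff] at h1 ⊢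
  rw [u.orbMap_grpMap, ← u.basePair_map g (algebraMap ℚ ℝ)] at h1
  have hinj : Function.Injective
      ((algebraMap ℚ ℝ).mapMatrix : Matrix (Idx k m) (Idx k m) ℚ →+* _) :=
    fun A B hAB => Matrix.map_injective (algebraMap ℚ ℝ).injective hAB
  exact Prod.map_injective.mpr ⟨hinj, hinj⟩ h1

end AdaptedBasis

end Extension

section Points

variable {k m : ℕ} {Q : QuadraticForm ℤ (Idx k m → ℤ)} {L : Submodule ℚ (Idx k m → ℚ)}
  {g : Matrix.SpecialLinearGroup (Idx k m) ℤ}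

/-- Every point of the orbit is represented by elements `b` of `T_L(𝔸) q` with `q` rational. -/
theorem mk_mem_orbitL_iff {b : GrpA Q} :
    YA.mk Q b ∈ orbitL Q L g ↔ ∃ q, b * (ratEmb Q q)⁻¹ ∈ torusA Q L g := by
  constructor
  · rintro ⟨t, ht, htb⟩
    obtain ⟨q, rfl⟩ := mk_eq_iff.mp htb
    exact ⟨q, by rwa [mul_inv_cancel_right]⟩
  · rintro ⟨q, hq⟩
    exact ⟨_, hq, mk_eq_iff.mpr ⟨q, by rw [inv_mul_cancel_right]⟩⟩

/-- The group `G(ℝ × Ẑ)` preserves integral pairs of matrices at the finite places. -/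
theorem integral_of_mem_openPts {b : GrpA Q} (hb : b ∈ openPts Q)
    (A B : Matrix (Idx k m) (Idx k m) zhat) :
    ∃ C : Matrix (Idx k m) (Idx k m) zhat × Matrix (Idx k m) (Idx k m) zhat,
      pairAct b.2 (zhat.subtype.mapMatrix A, zhat.subtype.mapMatrix B) =
        Prod.map zhat.subtype.mapMatrix zhat.subtype.mapMatrix C := by
  obtain ⟨-, c, hc⟩ := hb
  refine ⟨pairAct c (A, B), ?_⟩
  rw [← hc, ← pairAct_map]
  rfl

namespace AdaptedBasis

variable (u : AdaptedBasis Q L)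

include u in
/-- The second component of the rational point `b⁻¹ (P, g)` is integral if `b ∈ G(ℝ × Ẑ)`. -/
theorem exists_castSL_eq {b : GrpA Q} (hb : b ∈ openPts Q) {q : Grp Q ℚ}
    (hq : b * (ratEmb Q q)⁻¹ ∈ torusA Q L g) :
    ∃ gb : Matrix.SpecialLinearGroup (Idx k m) ℤ,
      castSL ℚ gb = (spinMat Q ℚ q.1)⁻¹ * castSL ℚ g * q.2.1 := by
  have h1 : b.2 * (grpMap Q (algebraMap ℚ FinAdele) q)⁻¹ ∈ torusGrp Q L g FinAdele := hq.2
  rw [u.mul_inv_mem_torusGrp_iff, u.orbMap_grpMap] at h1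
  obtain ⟨C, hC⟩ := integral_of_mem_openPts hb 0 (castSL zhat g).1
  rw [castSL_map] at hC
  have h2 : (u.orbMap g b.2).2 = zhat.subtype.mapMatrix C.2 := congrArg Prod.snd hC
  set N : Matrix.SpecialLinearGroup (Idx k m) ℚ :=
    (spinMat Q ℚ q.1)⁻¹ * castSL ℚ g * q.2.1 with hN
  have h3 : (u.orbMap g q).2 = N.1 := rfl
  have hint : ∀ i j, ∃ z : ℤ, (z : ℚ) = N.1 i j := by
    intro i j
    rw [← algebraMap_mem_zhat_iff]
    have h4 := congrArg (fun M => M i j) (h2.symm.trans (congrArg Prod.snd h1))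
    have h5 : (C.2 i j : FinAdele) = algebraMap ℚ FinAdele (N.1 i j) := h4
    rw [← h5]
    exact (C.2 i j).2
  choose z hz using hint
  have hz' : (Int.castRingHom ℚ).mapMatrix (Matrix.of z) = N.1 := by
    ext i j
    exact hz i j
  refine ⟨⟨Matrix.of z, ?_⟩, Subtype.ext hz'⟩
  apply Int.cast_injective (α := ℚ)
  rw [Int.cast_one, ← N.2, ← hz']
  exact RingHom.map_det (Int.castRingHom ℚ) (Matrix.of z)

include u in
/-- Two points of the orbit in `G(ℝ × Ẑ)` whose subspaces are equivalent under `Spin_Q(ℤ)` lie in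
the same double coset of `T_L(𝔸) ∩ G(ℝ × Ẑ)` and `G(ℤ)`. -/
theorem exists_integral_of_mem_stabL (hQ : Q.PosDef)
    (hg : Submodule.span ℤ (Set.range fun i : Fin k => g.1.col (Sum.inl i)) = latticePts L)
    {b b' : GrpA Q} (hb : b ∈ openPts Q) (hb' : b' ∈ openPts Q) {q q' : Grp Q ℚ}
    (hq : b * (ratEmb Q q)⁻¹ ∈ torusA Q L g) (hq' : b' * (ratEmb Q q')⁻¹ ∈ torusA Q L g)
    {η : Spin Q ℤ}
    (hη : q'.1 * spinMap Q (Int.castRingHom ℚ) η * q.1⁻¹ ∈ stabL Q L ℚ) :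
    ∃ c : Grp Q ℤ, c.1 = η⁻¹ ∧
      b' * (b * ratEmb Q (grpMap Q (Int.castRingHom ℚ) c))⁻¹ ∈ torusA Q L g := by
  obtain ⟨gb, hgb⟩ := u.exists_castSL_eq hb hq
  obtain ⟨gb', hgb'⟩ := u.exists_castSL_eq hb' hq'
  set f : Spin Q ℚ := q'.1 * spinMap Q (Int.castRingHom ℚ) η * q.1⁻¹ with hf
  have hpar : (castSL ℚ g)⁻¹ * spinMat Q ℚ f * castSL ℚ g ∈ parabolic k m ℚ :=
    u.conj_mem_parabolic hg hQ (spinMat_gram f) (u.mem_stabL_iff.mp hη)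
  let p : Par k m ℚ := q.2⁻¹ * ⟨_, hpar⟩⁻¹ * q'.2
  have hp : p.1 = castSL ℚ (gb⁻¹ * spinMat Q ℤ η⁻¹ * gb') := by
    have h1 : p.1 = q.2.1⁻¹ * ((castSL ℚ g)⁻¹ * spinMat Q ℚ f * castSL ℚ g)⁻¹ * q'.2.1 := rfl
    have h2 : castSL ℚ (spinMat Q ℤ η⁻¹) = (spinMat Q ℚ (spinMap Q (Int.castRingHom ℚ) η))⁻¹ := by
      rw [map_inv, castSL, map_inv]
      rfl
    have h3 : castSL ℚ (gb⁻¹ * spinMat Q ℤ η⁻¹ * gb') =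
        (castSL ℚ gb)⁻¹ * castSL ℚ (spinMat Q ℤ η⁻¹) * castSL ℚ gb' := by
      simp only [castSL, map_mul, map_inv]
    rw [h1, h3, hgb, hgb', h2, hf, map_mul, map_mul, map_inv]
    group
  obtain ⟨p', hp'⟩ := exists_parMap_eq (f := Int.castRingHom ℚ) Int.cast_injective (p := p)
    fun i j => ⟨(gb⁻¹ * spinMat Q ℤ η⁻¹ * gb').1 i j, by rw [hp]; rfl⟩
  refine ⟨(η⁻¹, p'), rfl, ?_⟩
  set c := grpMap Q (Int.castRingHom ℚ) ((η⁻¹, p') : Grp Q ℤ) with hc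
  have hc1 : c.1 = (spinMap Q (Int.castRingHom ℚ) η)⁻¹ := by
    rw [hc]
    change spinMap Q (Int.castRingHom ℚ) η⁻¹ = _
    rw [map_inv]
  have hc2 : c.2 = p := hp'
  have ht : q' * c⁻¹ * q⁻¹ ∈ torusGrp Q L g ℚ := by
    refine ⟨?_, ?_⟩
    · have : (q' * c⁻¹ * q⁻¹).1 = f := by
        change q'.1 * c.1⁻¹ * q.1⁻¹ = f
        rw [hc1, inv_inv]
      rw [this]
      exact hη
    · have h1 : (q' * c⁻¹ * q⁻¹).1 = f := by
        change q'.1 * c.1⁻¹ * q.1⁻¹ = f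
        rw [hc1, inv_inv]
      have h2 : (q' * c⁻¹ * q⁻¹).2 = ⟨_, hpar⟩ := by
        change q'.2 * c.2⁻¹ * q.2⁻¹ = _
        rw [hc2]
        simp only [p]
        group
      rw [h1, h2]
  have e : b' * (b * ratEmb Q c)⁻¹ = b' * (ratEmb Q q')⁻¹ * ratEmb Q (q' * c⁻¹ * q⁻¹) *
      (b * (ratEmb Q q)⁻¹)⁻¹ := by
    rw [map_mul, map_mul, map_inv, map_inv]
    group
  rw [e]
  exact mul_mem (mul_mem hq' (u.mem_ratTorus_iff.mpr ht)) (inv_mem hq)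

include u in
/-- The isotropy group in `G(ℤ)` of the point `b` modulo `T_L(𝔸)` is the stabilizer in `Spin_Q(ℤ)`
of the subspace attached to `b`. -/
theorem card_isotropy_eq (hQ : Q.PosDef)
    (hg : Submodule.span ℤ (Set.range fun i : Fin k => g.1.col (Sum.inl i)) = latticePts L)
    {b : GrpA Q} (hb : b ∈ openPts Q) {q : Grp Q ℚ}
    (hq : b * (ratEmb Q q)⁻¹ ∈ torusA Q L g) :
    Nat.card {c : Grp Q ℤ //
      b * ratEmb Q (grpMap Q (Int.castRingHom ℚ) c) * b⁻¹ ∈ torusA Q L g} =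
      Nat.card (stabZ Q (spinAct q.1⁻¹ L)) := by
  have hiff : ∀ η : Spin Q ℤ, η ∈ stabZ Q (spinAct q.1⁻¹ L) ↔
      q.1 * spinMap Q (Int.castRingHom ℚ) η * q.1⁻¹ ∈ stabL Q L ℚ := by
    intro η
    rw [stabL, ext_rat]
    change spinMap Q (Int.castRingHom ℚ) η ∈ stab Q (spinAct q.1⁻¹ L) ↔ _
    rw [mem_stab_spinAct_iff, inv_inv]
  have hmem : ∀ c : Grp Q ℤ,
      b * ratEmb Q (grpMap Q (Int.castRingHom ℚ) c) * b⁻¹ ∈ torusA Q L g ↔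
      q * grpMap Q (Int.castRingHom ℚ) c * q⁻¹ ∈ torusGrp Q L g ℚ := by
    intro c
    rw [← u.mem_ratTorus_iff]
    have e : b * ratEmb Q (grpMap Q (Int.castRingHom ℚ) c) * b⁻¹ =
        (b * (ratEmb Q q)⁻¹) * ratEmb Q (q * grpMap Q (Int.castRingHom ℚ) c * q⁻¹) *
          (b * (ratEmb Q q)⁻¹)⁻¹ := by
      rw [map_mul, map_mul, map_inv]
      group
    rw [e, Subgroup.mul_mem_cancel_right _ (inv_mem hq), Subgroup.mul_mem_cancel_left _ hq]
  refine Nat.card_congr (Equiv.ofBijective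
    (fun c => ⟨c.1.1, (hiff _).mpr ((hmem c.1).mp c.2).1⟩) ⟨?_, ?_⟩)
  · rintro ⟨c, hc⟩ ⟨c', hc'⟩ h
    have h1 : c.1 = c'.1 := congrArg Subtype.val h
    have h2 := ((hmem c).mp hc).2
    have h3 := ((hmem c').mp hc').2
    have h4 : (q * grpMap Q (Int.castRingHom ℚ) c * q⁻¹).1 =
        (q * grpMap Q (Int.castRingHom ℚ) c' * q⁻¹).1 := by
      change q.1 * spinMap Q (Int.castRingHom ℚ) c.1 * q.1⁻¹ =
        q.1 * spinMap Q (Int.castRingHom ℚ) c'.1 * q.1⁻¹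
      rw [h1]
    rw [h4, ← h3] at h2
    have h5 : q * grpMap Q (Int.castRingHom ℚ) c * q⁻¹ =
        q * grpMap Q (Int.castRingHom ℚ) c' * q⁻¹ := Prod.ext h4 (Subtype.ext h2)
    exact Subtype.ext (grpMap_injective Int.cast_injective (mul_left_cancel (mul_right_cancel h5)))
  · rintro ⟨η, hη⟩
    have hη' : η⁻¹ ∈ stabZ Q (spinAct q.1⁻¹ L) := inv_mem hη
    obtain ⟨c, hc, hcb⟩ := u.exists_integral_of_mem_stabL hQ hg hb hb hq hq ((hiff _).mp hη')
    refine ⟨⟨c, ?_⟩, Subtype.ext (hc.trans (inv_inv η))⟩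
    have := inv_mem hcb
    rwa [mul_inv_rev, inv_inv] at this

end AdaptedBasis

end Points

/-! ### The packet -/

section Packet

variable {k m : ℕ} {Q : QuadraticForm ℤ (Idx k m → ℤ)} {L : Submodule ℚ (Idx k m → ℚ)}

theorem bilin_eq (v w : Idx k m → ℝ) : bilin Q v w = (v ⬝ᵥ (gram Q ℝ).mulVec w) / 2 := by
  simp only [bilin, dotProduct, Matrix.mulVec, gram, Matrix.of_apply, Finset.mul_sum,
    Finset.sum_div]
  refine Finset.sum_congr rfl fun i _ => Finset.sum_congr rfl fun j _ => ?_
  ring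

/-- The real dilation `a_L` commutes with the stabilizer of `ℝ ^ k`, because it is a linear combination
of the orthogonal projections onto `ℝ ^ k` and its complement. -/
theorem GridData.a_comm (hQ : Q.PosDef) (d : GridData Q L) {s : Spin Q ℝ} (hs : s ∈ stabStd Q) :
    d.a * spinMat Q ℝ s = spinMat Q ℝ s * d.a := by
  obtain ⟨u⟩ := exists_adaptedBasis hQ (finrank_stdSpace_rat (k := k) (m := m))
  have hext : ext ℝ (stdSpace k m ℚ) = stdSpace k m ℝ := ext_stdSpace
  have hs' : s ∈ stabL Q (stdSpace k m ℚ) ℝ := by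
    rw [stabL, hext]
    exact hs
  rw [u.mem_stabL_iff] at hs'
  have ha : d.a.1 = d.lam • u.PR ℝ + (d.lam ^ (-((k : ℝ) / (m : ℝ)))) • (1 - u.PR ℝ) := by
    refine Matrix.ext_of_mulVec_single fun i => ?_
    set v : Idx k m → ℝ := Pi.single i 1
    have h1 : (u.PR ℝ).mulVec v ∈ stdSpace k m ℝ := by
      rw [← hext, u.mem_ext_iff, Matrix.mulVec_mulVec, u.PR_sq]
    have h2 : ∀ x ∈ stdSpace k m ℝ, bilin Q x ((1 - u.PR ℝ).mulVec v) = 0 := by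
      intro x hx
      rw [← hext, u.mem_ext_iff] at hx
      have h3 : (u.PR ℝ).transpose * gram Q ℝ * (1 - u.PR ℝ) = 0 := by
        rw [← u.gram_mul_PR, Matrix.mul_sub, Matrix.mul_one, Matrix.mul_assoc, u.PR_sq, sub_self]
      have h4 : (u.PR ℝ).mulVec x ⬝ᵥ (gram Q ℝ).mulVec ((1 - u.PR ℝ).mulVec v) = 0 := by
        rw [Matrix.mulVec_mulVec, ← Matrix.vecMul_transpose, ← Matrix.dotProduct_mulVec,
          Matrix.mulVec_mulVec, ← Matrix.mul_assoc, h3, Matrix.zero_mulVec, dotProduct_zero]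
      rw [hx] at h4
      rw [bilin_eq, h4, zero_div]
    have h5 : v = (u.PR ℝ).mulVec v + (1 - u.PR ℝ).mulVec v := by
      rw [← Matrix.add_mulVec, add_sub_cancel, Matrix.one_mulVec]
    conv_lhs => rw [h5]
    rw [Matrix.mulVec_add, d.a_std _ h1, d.a_perp _ h2, Matrix.add_mulVec, Matrix.smul_mulVec,
      Matrix.smul_mulVec]
  refine Subtype.ext ?_
  change d.a.1 * (spinMat Q ℝ s).1 = (spinMat Q ℝ s).1 * d.a.1
  rw [ha, Matrix.add_mul, Matrix.mul_add, Matrix.smul_mul, Matrix.smul_mul, Matrix.mul_smul,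
    Matrix.mul_smul, Matrix.sub_mul, Matrix.mul_sub, hs', Matrix.one_mul, Matrix.mul_one]

theorem GridData.std_eq (d : GridData Q L) : stdSpace k m ℝ = spinAct d.ρ (ext ℝ L) := d.ρ_map.symm

/-- Conjugation by `α_L` carries `T_L(ℝ)` into the diagonally embedded group `A_Q(ℝ)`. -/
theorem GridData.conj_mem_diagA (hQ : Q.PosDef) (d : GridData Q L) {t : Grp Q ℝ}
    (ht : t ∈ torusGrp Q L d.g ℝ) : d.alpha.1 * t * d.alpha.1⁻¹ ∈ diagA Q := by
  have h1 : d.ρ * t.1 * d.ρ⁻¹ ∈ stabStd Q := by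
    change _ ∈ stab Q (stdSpace k m ℝ)
    rw [d.std_eq, mem_stab_spinAct_iff]
    have : d.ρ⁻¹ * (d.ρ * t.1 * d.ρ⁻¹) * d.ρ = t.1 := by group
    rw [this]
    exact ht.1
  refine ⟨h1, ?_⟩
  change d.a * spinMat Q ℝ d.ρ * castSL ℝ d.g * t.2.1 *
    (d.a * spinMat Q ℝ d.ρ * castSL ℝ d.g)⁻¹ = spinMat Q ℝ (d.ρ * t.1 * d.ρ⁻¹)
  have h2 := d.a_comm hQ h1
  rw [ht.2]
  rw [map_mul, map_mul, map_inv] at h2 ⊢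
  calc _ = d.a * (spinMat Q ℝ d.ρ * spinMat Q ℝ t.1 * (spinMat Q ℝ d.ρ)⁻¹) * d.a⁻¹ := by group
    _ = _ := by rw [h2, mul_inv_cancel_right]

theorem GridData.alpha_mem (d : GridData Q L) : d.alpha ∈ openPts Q :=
  ⟨trivial, one_mem _⟩

/-- The packet consists of the classes of `α_L b`, where `b ∈ G(ℝ × Ẑ)` represents a point of the
orbit; the translation by `α_L` can be undone because `α_L` lies in `G(ℝ × Ẑ)`. -/
theorem GridData.mem_packet_iff (d : GridData Q L) {x : DC Q} :
    x ∈ packet d ↔ ∃ b ∈ openPts Q, YA.mk Q b ∈ orbitL Q L d.g ∧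
      DC.mk Q (d.alpha * b).1 = x := by
  constructor
  · rintro ⟨_, ⟨⟨y, hy, rfl⟩, b, hb, hby⟩, rfl⟩
    have hby' : YA.mk Q b = d.alpha • y := hby
    have hy' : y = YA.mk Q (d.alpha⁻¹ * b) := by
      rw [← smul_mk, hby', inv_smul_smul]
    refine ⟨d.alpha⁻¹ * b, mul_mem (inv_mem d.alpha_mem) hb, hy' ▸ hy, ?_⟩
    change _ = Phi Q (d.alpha • y)
    rw [← hby', Phi_mk hb, mul_inv_cancel_left]
  · rintro ⟨b, hb, hbO, rfl⟩
    refine ⟨d.alpha • YA.mk Q b, ⟨⟨_, hbO, rfl⟩, ?_⟩, ?_⟩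
    · rw [smul_mk]
      exact ⟨_, mul_mem d.alpha_mem hb, rfl⟩
    · rw [smul_mk, Phi_mk (mul_mem d.alpha_mem hb)]

theorem equivalence_sameOrbit : Equivalence (sameOrbit Q) where
  refl x := ⟨⟨1, by rw [map_one]; exact (spinAct_one _).symm⟩, rfl⟩
  symm := by
    rintro x y ⟨⟨η, h⟩, h'⟩
    refine ⟨⟨η⁻¹, ?_⟩, h'.symm⟩
    rw [map_inv]
    exact spinAct_eq_iff.mp h.symm
  trans := by
    rintro x y z ⟨⟨η, h⟩, h'⟩ ⟨⟨θ, i⟩, i'⟩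
    refine ⟨⟨θ * η, ?_⟩, i'.trans h'⟩
    rw [i, h, map_mul]
    exact (spinAct_mul _ _ _).symm

theorem sameOrbit_of_mk_eq {x y : GrR k m × Grids Q}
    (h : (Quot.mk (sameOrbit Q) x) = Quot.mk (sameOrbit Q) y) : sameOrbit Q x y :=
  (Quot.eqvGen_exact h).rec (fun _ _ h => h) (fun _ => equivalence_sameOrbit.refl _)
    (fun _ _ _ h => equivalence_sameOrbit.symm h)
    (fun _ _ _ _ _ h h' => equivalence_sameOrbit.trans h h')

theorem exists_of_toX_eq {x x' : Grp Q ℝ} (h : toX Q (DC.mk Q x) = toX Q (DC.mk Q x')) :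
    ∃ η : Spin Q ℤ, spinAct x'.1⁻¹ (stdSpace k m ℝ) =
      spinAct (spinMap Q (Int.castRingHom ℝ) η) (spinAct x.1⁻¹ (stdSpace k m ℝ)) :=
  (sameOrbit_of_mk_eq h).1

section Point

variable (d : GridData Q L) {b b' : GrpA Q} {q q' : Grp Q ℚ}

/-- If `b ∈ T_L(𝔸) q`, then over `ℝ` the subspace attached to `α_L b` is the rational subspace `q⁻¹
L`. -/
theorem GridData.ext_spinAct_eq (hq : b * (ratEmb Q q)⁻¹ ∈ torusA Q L d.g) :
    ext ℝ (spinAct q.1⁻¹ L) = spinAct (d.alpha * b).1.1⁻¹ (stdSpace k m ℝ) := by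
  have h1 : b.1.1 * (spinMap Q (algebraMap ℚ ℝ) q.1)⁻¹ ∈ stab Q (ext ℝ L) := hq.1.1
  have h2 : (d.alpha * b).1.1 = d.ρ * b.1.1 := rfl
  rw [mem_stab_iff, spinAct_mul, spinAct_eq_iff] at h1
  rw [ext_spinAct, map_inv, h1, h2, d.std_eq, ← spinAct_mul]
  congr 1
  group

/-- The point attached to `b ∈ T_L(𝔸) q` is the grid of `q⁻¹ L`. The choices `g_L`, `ρ_L`, `a_L` are
replaced by the integral second component of `b⁻¹ (P, g)`, by `ρ_L b_∞`, and by the same dilation.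
-/
theorem GridData.exists_gridData (hQ : Q.PosDef) (hb : b ∈ openPts Q)
    (hq : b * (ratEmb Q q)⁻¹ ∈ torusA Q L d.g) :
    ∃ d' : GridData Q (spinAct q.1⁻¹ L), toX Q (DC.mk Q (d.alpha * b).1) = gridPt Q d' := by
  obtain ⟨u⟩ := exists_adaptedBasis hQ d.finrank_eq
  obtain ⟨gb, hgb⟩ := u.exists_castSL_eq hb hq
  set t := b.1 * (grpMap Q (algebraMap ℚ ℝ) q)⁻¹ with ht
  have ht' : t ∈ torusGrp Q L d.g ℝ := hq.1
  have hbt : b.1 = t * grpMap Q (algebraMap ℚ ℝ) q := by rw [ht, inv_mul_cancel_right]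
  have hgbR : castSL ℝ gb = (spinMat Q ℝ (grpMap Q (algebraMap ℚ ℝ) q).1)⁻¹ * castSL ℝ d.g *
      (grpMap Q (algebraMap ℚ ℝ) q).2.1 := by
    have h1 := congrArg (Matrix.SpecialLinearGroup.map (algebraMap ℚ ℝ)) hgb
    have h2 : ∀ g : Matrix.SpecialLinearGroup (Idx k m) ℤ,
        Matrix.SpecialLinearGroup.map (algebraMap ℚ ℝ) (castSL ℚ g) = castSL ℝ g :=
      fun g => Subtype.ext (castSL_map _ _)
    rw [map_mul, map_mul, map_inv, h2, h2] at h1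
    exact h1
  have hmat : d.a * spinMat Q ℝ (d.ρ * b.1.1) * castSL ℝ gb = d.par.1 * b.1.2.1 := by
    have h1 : b.1.1 = t.1 * (grpMap Q (algebraMap ℚ ℝ) q).1 := by rw [hbt]; rfl
    have h2 : b.1.2.1 = t.2.1 * (grpMap Q (algebraMap ℚ ℝ) q).2.1 := by rw [hbt]; rfl
    rw [hgbR, h1, h2, ht'.2, GridData.par, map_mul, map_mul]
    group
  refine ⟨{ g := gb, g_span := ?_, ρ := d.ρ * b.1.1, ρ_map := ?_, lam := d.lam,
            lam_pos := d.lam_pos, a := d.a, a_std := d.a_std, a_perp := d.a_perp,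
            mem := hmat ▸ (d.par * b.1.2).2 }, ?_⟩
  · apply span_col_eq_latticePts
    have hq2 : (stdSpace k m ℚ).map (Matrix.toLin' q.2.1.1) = stdSpace k m ℚ := by
      have hle : ∀ p : Par k m ℚ, (stdSpace k m ℚ).map (Matrix.toLin' p.1.1) ≤
          stdSpace k m ℚ := by
        rintro p _ ⟨v, hv, rfl⟩ j
        have h21 : ∀ i, p.1.1 (.inr j) (.inl i) = 0 := fun i =>
          congrFun (congrFun p.2.1 j) i
        have hv' : ∀ j, v (.inr j) = 0 := hv
        simp [Matrix.mulVec, dotProduct, Fintype.sum_sum_type, h21, hv']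
      refine le_antisymm (hle _) fun v hv => ?_
      refine ⟨Matrix.toLin' (q.2⁻¹).1.1 v, hle _ ⟨v, hv, rfl⟩, ?_⟩
      have h1 : q.2.1.1 * (q.2⁻¹).1.1 = 1 := SL_mul_inv q.2.1
      rw [← LinearMap.comp_apply, ← Matrix.toLin'_mul, h1, Matrix.toLin'_one, LinearMap.id_apply]
    have h1 : (castSL ℚ gb).1 = (spinMat Q ℚ q.1⁻¹).1 * (castSL ℚ d.g).1 * q.2.1.1 := by
      rw [hgb, map_inv]
      rfl
    rw [h1, Matrix.toLin'_mul, Matrix.toLin'_mul, Submodule.map_comp, Submodule.map_comp, hq2,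
      map_stdSpace_eq d.g_span]
    rfl
  · change spinAct (d.ρ * b.1.1) (ext ℝ (spinAct q.1⁻¹ L)) = _
    rw [spinAct_eq_iff]
    exact d.ext_spinAct_eq hq
  · refine congrArg (Quot.mk _) (Prod.ext (Subtype.ext (d.ext_spinAct_eq hq).symm) ?_)
    exact congrArg (gridMk Q) (Subtype.ext hmat.symm)

/-- Points of the packet with the same image in `G₁(ℤ) \ X_{n,k}` come from the same double coset
of `T_L(𝔸) ∩ G(ℝ × Ẑ)` and `G(ℤ)`. -/
theorem GridData.exists_integral_of_toX_eq (hQ : Q.PosDef) (hb : b ∈ openPts Q)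
    (hb' : b' ∈ openPts Q) (hbO : YA.mk Q b ∈ orbitL Q L d.g) (hbO' : YA.mk Q b' ∈ orbitL Q L d.g)
    (h : toX Q (DC.mk Q (d.alpha * b).1) = toX Q (DC.mk Q (d.alpha * b').1)) :
    ∃ c : Grp Q ℤ, b' * (b * ratEmb Q (grpMap Q (Int.castRingHom ℚ) c))⁻¹ ∈ torusA Q L d.g := by
  obtain ⟨u⟩ := exists_adaptedBasis hQ d.finrank_eq
  obtain ⟨q, hq⟩ := mk_mem_orbitL_iff.mp hbO
  obtain ⟨q', hq'⟩ := mk_mem_orbitL_iff.mp hbO'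
  obtain ⟨η, hη⟩ := exists_of_toX_eq h
  rw [← d.ext_spinAct_eq hq, ← d.ext_spinAct_eq hq', ext_spinAct, ext_spinAct, ← spinAct_mul,
    map_inv, map_inv] at hη
  have h2 : q'.1 * spinMap Q (Int.castRingHom ℚ) η * q.1⁻¹ ∈ stabL Q L ℚ := by
    rw [← u.spinMap_mem_stabL_iff (algebraMap ℚ ℝ).injective]
    have h3 : spinMap Q (algebraMap ℚ ℝ) (spinMap Q (Int.castRingHom ℚ) η) =
        spinMap Q (Int.castRingHom ℝ) η := by
      refine spinCrd_injective (funext fun i => ?_)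
      simp only [spinCrd_spinMap, eq_intCast, map_intCast]
    rw [map_mul, map_mul, h3, map_inv]
    change _ ∈ stab Q (ext ℝ L)
    rw [mem_stab_iff, mul_assoc, spinAct_mul, ← hη, ← spinAct_mul, mul_inv_cancel, spinAct_one]
  obtain ⟨c, -, hc⟩ := u.exists_integral_of_mem_stabL hQ d.g_span hb hb' hq hq' h2
  exact ⟨c, hc⟩

/-- The value of `Φ(α_L · )` depends only on the double coset of `T_L(𝔸) ∩ G(ℝ × Ẑ)` and `G(ℤ)`. -/
theorem GridData.DC_mk_eq (hQ : Q.PosDef) {c : Grp Q ℤ}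
    (h : b' * (b * ratEmb Q (grpMap Q (Int.castRingHom ℚ) c))⁻¹ ∈ torusA Q L d.g) :
    DC.mk Q (d.alpha * b).1 = DC.mk Q (d.alpha * b').1 := by
  refine (DoubleCoset.eq _ _ _ _).mpr ⟨_, d.conj_mem_diagA hQ h.1,
    grpMap Q (Int.castRingHom ℝ) c, ⟨c, rfl⟩, ?_⟩
  have e : (b' * (b * ratEmb Q (grpMap Q (Int.castRingHom ℚ) c))⁻¹).1 =
      b'.1 * (b.1 * grpMap Q (Int.castRingHom ℝ) c)⁻¹ := by
    rw [← ratEmb_int_fst]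
    rfl
  have e1 : (d.alpha * b').1 = d.alpha.1 * b'.1 := rfl
  have e2 : (d.alpha * b).1 = d.alpha.1 * b.1 := rfl
  have e3 : ((b' * (b * ratEmb Q (grpMap Q (Int.castRingHom ℚ) c))⁻¹).1 : Grp Q ℝ) =
    b'.1 * (b.1 * grpMap Q (Int.castRingHom ℝ) c)⁻¹ := e
  change d.alpha.1 * b'.1 = d.alpha.1 *
    (b' * (b * ratEmb Q (grpMap Q (Int.castRingHom ℚ) c))⁻¹).1 * d.alpha.1⁻¹ *
      (d.alpha.1 * b.1) * grpMap Q (Int.castRingHom ℝ) c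
  rw [e3]
  group

/-- Both the point of the packet and its image under `ι` determine, and are determined by, the
double coset of `T_L(𝔸) ∩ G(ℝ × Ẑ)` and `G(ℤ)`. -/
theorem GridData.injOn_toX (hQ : Q.PosDef) : Set.InjOn (toX Q) (packet d) := by
  intro x hx x' hx' h
  obtain ⟨b, hb, hbO, rfl⟩ := d.mem_packet_iff.mp hx
  obtain ⟨b', hb', hbO', rfl⟩ := d.mem_packet_iff.mp hx'
  obtain ⟨c, hc⟩ := d.exists_integral_of_toX_eq hQ hb hb' hbO hbO' h
  exact d.DC_mk_eq hQ hc

end Point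

/-- The weight of a double coset: the inverse of the order of the stabilizer of `g₁⁻¹ ℝ ^ k` in
`Spin_Q(ℤ)`, for some representative `(g₁, g₂)` of the double coset. -/
def wt (x : DC Q) : ℝ :=
  (Nat.card (intStab (Q := Q) (spinAct (Quotient.out x).1⁻¹ (stdSpace k m ℝ))) : ℝ)⁻¹

/-- Other representatives and other subspaces in the same class have stabilizers which are conjugate
in `Spin_Q(ℤ)`. -/
theorem wt_eq (hQ : Q.PosDef) {x : DC Q} (d : GridData Q L) (h : toX Q x = gridPt Q d) :
    wt x = (Nat.card (stabZ Q L) : ℝ)⁻¹ := by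
  obtain ⟨u⟩ := exists_adaptedBasis hQ d.finrank_eq
  have hx : DC.mk Q (Quotient.out x) = x := Quotient.out_eq x
  rw [← hx] at h
  obtain ⟨⟨η, hη⟩, -⟩ := sameOrbit_of_mk_eq h
  have hη' : ext ℝ L = spinAct (spinMap Q (Int.castRingHom ℝ) η)
      (spinAct (Quotient.out x).1⁻¹ (stdSpace k m ℝ)) := hη
  rw [u.stabZ_eq_intStab, hη', card_intStab_spinAct, wt]

end Packet

/-! ### Finiteness of the packet -/

section Finiteness

/-- A compact subset of `𝔸 ^ ι` contains only finitely many rational vectors. -/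
theorem finite_preimage_ratVec {ι : Type} [Finite ι] {C : Set ((ι → ℝ) × (ι → FinAdele))}
    (hC : IsCompact C) : (ratVec ι ⁻¹' C).Finite := by
  have hcl : ∀ A : Set (ι → ℚ), IsClosed (ratVec ι '' A) := isClosed_image_ratVec
  have h1 : IsCompact (C ∩ Set.range (ratVec ι)) := by
    refine hC.inter_right ?_
    rw [← Set.image_univ]
    exact hcl _
  have h2 : (C ∩ Set.range (ratVec ι)).Finite := by
    refine h1.finite (isDiscrete_iff_discreteTopology.mpr ?_)
    refine discreteTopology_iff_forall_isClosed.mpr fun A => ?_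
    have h3 : Subtype.val '' A = ratVec ι '' (ratVec ι ⁻¹' (Subtype.val '' A)) := by
      rw [Set.image_preimage_eq_inter_range]
      refine (Set.inter_eq_left.mpr ?_).symm
      rintro _ ⟨x, _, rfl⟩
      exact x.2.2
    rw [← Set.preimage_image_eq A Subtype.val_injective, h3]
    exact (hcl _).preimage continuous_subtype_val
  rw [← Set.preimage_inter_range]
  exact h2.preimage ratVec_injective.injOn

variable {k m : ℕ} {Q : QuadraticForm ℤ (Idx k m → ℤ)} {L : Submodule ℚ (Idx k m → ℚ)}

variable (Q) in
/-- The image of `Spin_Q(Ẑ)` in `Spin_Q(𝔸_f)`. -/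
def intSpin : Set (Spin Q FinAdele) := {s | ∀ i, spinCrd Q FinAdele s i ∈ zhat}

theorem isCompact_intSpin : IsCompact (intSpin Q) := by
  have h : intSpin Q = spinCrd Q FinAdele ⁻¹' Set.pi Set.univ fun _ => (zhat : Set FinAdele) := by
    ext s
    simp only [intSpin, Set.mem_ofPred_eq, Set.mem_preimage, Set.mem_pi, Set.mem_univ, true_imp_iff,
      SetLike.mem_coe]
  rw [h]
  exact isClosedEmbedding_spinCrd.isCompact_preimage (isCompact_univ_pi fun _ => isCompact_zhat)

theorem isOpen_intSpin : IsOpen (intSpin Q) := by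
  have h : intSpin Q = ⋂ i, {s | spinCrd Q FinAdele s i ∈ zhat} := by
    ext s
    simp only [intSpin, Set.mem_ofPred_eq, Set.mem_iInter]
  rw [h]
  exact isOpen_iInter_of_finite fun i => isOpen_zhat.preimage
    ((continuous_apply i).comp isClosedEmbedding_spinCrd.continuous)

theorem continuous_conj {R : Type} [CommRing R] [TopologicalSpace R] [IsTopologicalRing R]
    (A : Matrix (Idx k m) (Idx k m) R) :
    Continuous fun s : Spin Q R => ((spinMat Q R s)⁻¹).1 * A * (spinMat Q R s).1 := by
  have h1 : Continuous fun s : Spin Q R => (spinMat Q R s).1 :=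
    continuous_subtype_val.comp continuous_spinMat
  have h2 : Continuous fun s : Spin Q R => ((spinMat Q R s)⁻¹).1 := by
    have : (fun s : Spin Q R => ((spinMat Q R s)⁻¹).1) = fun s => (spinMat Q R s⁻¹).1 := by
      funext s
      rw [map_inv]
    rw [this]
    exact h1.comp continuous_inv
  exact (h2.mul continuous_const).mul h1

/-- A point of the packet is determined by the orthogonal projection onto its rational subspace.
These projections are rational matrices in the compact orbit of `P` under `Spin_Q(ℝ × Ẑ)`, hence
finite in number. -/
theorem GridData.finite_packet (hQ : Q.PosDef) (d : GridData Q L) : (packet d).Finite := by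
  obtain ⟨u⟩ := exists_adaptedBasis hQ d.finrank_eq
  have hcomp : CompactSpace (Spin Q ℝ) := u.compactSpace_spin_real
  have hrep : ∀ x : packet d, ∃ b ∈ openPts Q, ∃ q, b * (ratEmb Q q)⁻¹ ∈ torusA Q L d.g ∧
      DC.mk Q (d.alpha * b).1 = x := by
    rintro ⟨x, hx⟩
    obtain ⟨b, hb, hbO, h⟩ := d.mem_packet_iff.mp hx
    obtain ⟨q, hq⟩ := mk_mem_orbitL_iff.mp hbO
    exact ⟨b, hb, q, hq, h⟩
  choose b hb q hq hx using hrep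
  -- `F x` is the orthogonal projection onto the rational subspace `q⁻¹ L` over `x`
  let F : packet d → (Idx k m × Idx k m → ℚ) := fun x p => (u.orbMap d.g (q x)).1 p.1 p.2
  let f : ∀ (R : Type) [CommRing R] [Algebra ℚ R], Spin Q R → (Idx k m × Idx k m → R) :=
    fun R _ _ s p => (((spinMat Q R s)⁻¹).1 * u.PR R * (spinMat Q R s).1) p.1 p.2
  have hF : ∀ x, ratVec _ (F x) = Prod.map (f ℝ) (f FinAdele) ((b x).1.1, (b x).2.1) := by
    intro x
    have h1 := (u.mul_inv_mem_torusGrp_iff d.g).mp (hq x).1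
    have h2 := (u.mul_inv_mem_torusGrp_iff d.g).mp (hq x).2
    change u.orbMap d.g (b x).1 = u.orbMap d.g (grpMap Q (algebraMap ℚ ℝ) (q x)) at h1
    change u.orbMap d.g (b x).2 = u.orbMap d.g (grpMap Q (algebraMap ℚ FinAdele) (q x)) at h2
    rw [u.orbMap_grpMap] at h1 h2
    refine Prod.ext (funext fun p => ?_) (funext fun p => ?_)
    · exact congrFun (congrFun (congrArg Prod.fst h1.symm) p.1) p.2
    · exact congrFun (congrFun (congrArg Prod.fst h2.symm) p.1) p.2
  -- equal projections mean equal rational subspaces, hence the same double coset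
  have hinj : Function.Injective F := by
    intro x x' h
    have h1 : (u.orbMap d.g (q x)).1 = (u.orbMap d.g (q x')).1 := by
      ext i j
      exact congrFun h (i, j)
    have h2 : (q x').1 * spinMap Q (Int.castRingHom ℚ) 1 * (q x).1⁻¹ ∈ stabL Q L ℚ := by
      rw [u.mem_stabL_iff, map_one, mul_one, map_mul, map_inv]
      set A := spinMat Q ℚ (q x).1
      set B := spinMat Q ℚ (q x').1
      change (A⁻¹).1 * u.PR ℚ * A.1 = (B⁻¹).1 * u.PR ℚ * B.1 at h1
      change B.1 * (A⁻¹).1 * u.PR ℚ = u.PR ℚ * (B.1 * (A⁻¹).1)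
      calc B.1 * (A⁻¹).1 * u.PR ℚ = B.1 * ((A⁻¹).1 * u.PR ℚ * A.1) * (A⁻¹).1 := by
            simp only [Matrix.mul_assoc, SL_mul_inv, Matrix.mul_one]
        _ = B.1 * (B⁻¹).1 * (u.PR ℚ * B.1 * (A⁻¹).1) := by
            rw [h1]
            simp only [Matrix.mul_assoc]
        _ = _ := by
            rw [SL_mul_inv, Matrix.one_mul, Matrix.mul_assoc]
    obtain ⟨c, -, hc⟩ := u.exists_integral_of_mem_stabL hQ d.g_span (hb x) (hb x') (hq x) (hq x') h2
    exact Subtype.ext ((hx x).symm.trans ((d.DC_mk_eq hQ hc).trans (hx x')))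
  have hf : ∀ (R : Type) [CommRing R] [Algebra ℚ R] [TopologicalSpace R] [IsTopologicalRing R],
      Continuous (f R) := by
    intro R _ _ _ _
    exact continuous_pi fun p => (continuous_conj (u.PR R)).matrix_elem _ _
  have hC : IsCompact (Prod.map (f ℝ) (f FinAdele) '' (Set.univ ×ˢ intSpin Q)) :=
    (isCompact_univ.prod isCompact_intSpin).image ((hf ℝ).prodMap (hf FinAdele))
  have : Finite (packet d) := by
    refine Set.finite_univ_iff.mp (((finite_preimage_ratVec hC).preimage hinj.injOn).subset ?_)
    intro x _
    refine ⟨((b x).1.1, (b x).2.1), ⟨trivial, fun i => ?_⟩, (hF x).symm⟩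
    exact mem_openPts_iff.mp (hb x) (.inl i)
  exact Set.toFinite _

end Finiteness

/-! ### The action of isometries on the spin group -/

section Isometry

variable {k m : ℕ} {Q : QuadraticForm ℤ (Idx k m → ℤ)} {R : Type} [CommRing R]

theorem tmul_ι (v : Idx k m → ℤ) :
    ((1 : R) ⊗ₜ[ℤ] CliffordAlgebra.ι Q v) = vec Q (fun i => ((v i : ℤ) : R)) := by
  have hv : v = ∑ i, v i • (Pi.single i 1 : Idx k m → ℤ) := by
    simpa using (pi_eq_sum_univ' v)
  conv_lhs => rw [hv]
  rw [map_sum, TensorProduct.tmul_sum, vec]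
  refine Finset.sum_congr rfl fun i _ => ?_
  rw [map_smul, TensorProduct.tmul_smul, TensorProduct.smul_tmul']
  simp

/-- Induction principle: `Cl(Q_R)` is generated as a ring by `R` and `R ^ n`. -/
theorem cl_induction {p : Cl Q R → Prop} (scalar : ∀ r : R, p (r ⊗ₜ 1))
    (vec : ∀ v, p (vec Q v)) (mul : ∀ x y, p x → p y → p (x * y))
    (add : ∀ x y, p x → p y → p (x + y)) (x : Cl Q R) : p x := by
  induction x using TensorProduct.induction_on with
  | zero => simpa using scalar 0
  | add a b ha hb => exact add a b ha hb
  | tmul r c =>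
    have h1 : r ⊗ₜ[ℤ] c = (r ⊗ₜ 1) * ((1 : R) ⊗ₜ c) := by simp
    rw [h1]
    refine mul _ _ (scalar r) ?_
    clear h1
    induction c using CliffordAlgebra.induction with
    | algebraMap z =>
      have : ((1 : R) ⊗ₜ[ℤ] algebraMap ℤ (CliffordAlgebra Q) z) = (z : R) ⊗ₜ 1 := by
        rw [Algebra.algebraMap_eq_smul_one, TensorProduct.tmul_smul, TensorProduct.smul_tmul',
          zsmul_eq_mul, mul_one]
      rw [this]
      exact scalar _
    | ι v =>
      rw [tmul_ι]
      exact vec _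
    | mul a b ha hb =>
      have : ((1 : R) ⊗ₜ[ℤ] (a * b)) = (1 ⊗ₜ a) * (1 ⊗ₜ b) := by simp
      rw [this]
      exact mul _ _ ha hb
    | add a b ha hb =>
      rw [TensorProduct.tmul_add]
      exact add _ _ ha hb

/-- The algebra `Cl(Q_R)` is generated by vectors. -/
theorem clHom_ext {A : Type*} [Semiring A] [Algebra R A] {f g : Cl Q R →ₐ[R] A}
    (h : ∀ v, f (vec Q v) = g (vec Q v)) : f = g := by
  have hs : ∀ f : Cl Q R →ₐ[R] A, ∀ r : R, f (r ⊗ₜ 1) = algebraMap R A r := fun f r => f.commutes r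
  refine AlgHom.ext fun x => ?_
  induction x using cl_induction with
  | scalar r => rw [hs, hs]
  | vec v => exact h v
  | mul x y hx hy => rw [map_mul, map_mul, hx, hy]
  | add x y hx hy => rw [map_add, map_add, hx, hy]

theorem rev_vec (v : Idx k m → R) : rev Q R (vec Q v) = vec Q v := by
  simp only [vec, map_sum, rev_tmul, CliffordAlgebra.reverse_ι]

theorem vec_mul_vec_mem_evenPart (v w : Idx k m → R) : vec Q v * vec Q w ∈ evenPart Q R := by
  rw [vec, vec, Finset.sum_mul_sum]
  refine Subalgebra.sum_mem _ fun i _ => Subalgebra.sum_mem _ fun j _ => ?_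
  rw [Algebra.TensorProduct.tmul_mul_tmul]
  refine ⟨(v i * w j) ⊗ₜ ⟨_, CliffordAlgebra.ι_mul_ι_mem_evenOdd_zero Q (Pi.single i 1)
    (Pi.single j 1)⟩, rfl⟩

variable [Algebra ℚ R]

theorem vec_mul_self (v : Idx k m → R) {r : R} (h : v ⬝ᵥ (gram Q R).mulVec v = 2 * r) :
    vec Q v * vec Q v = r ⊗ₜ 1 := by
  have h1 := vec_mul_vec_add (Q := Q) v v
  rw [h] at h1
  have h2 : (algebraMap ℚ R 2⁻¹) * 2 = 1 := by
    rw [← map_ofNat (algebraMap ℚ R) 2, ← map_mul]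
    norm_num
  have h3 : vec Q v * vec Q v = (algebraMap ℚ R 2⁻¹ * 2) • (vec Q v * vec Q v) := by
    rw [h2, one_smul]
  rw [h3, mul_smul, two_smul, h1, TensorProduct.smul_tmul', smul_eq_mul, ← mul_assoc, h2, one_mul]

variable (Q R) in
/-- The group of isometries of `Q` on `R ^ n`. -/
def isoGrp : Subgroup (Matrix (Idx k m) (Idx k m) R)ˣ where
  carrier := {M | M.1.transpose * gram Q R * M.1 = gram Q R}
  mul_mem' := by
    intro M N hM hN
    simp only [Set.mem_ofPred_eq, Units.val_mul, Matrix.transpose_mul] at *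
    calc _ = N.1.transpose * (M.1.transpose * gram Q R * M.1) * N.1 := by
          simp only [Matrix.mul_assoc]
      _ = _ := by rw [hM, hN]
  one_mem' := by simp
  inv_mem' := by
    intro M hM
    simp only [Set.mem_ofPred_eq] at *
    have h1 : M.1 * (M⁻¹).1 = 1 := M.mul_inv
    have h2 : (M⁻¹).1.transpose * M.1.transpose = 1 := by
      rw [← Matrix.transpose_mul, h1, Matrix.transpose_one]
    calc _ = (M⁻¹).1.transpose * (M.1.transpose * gram Q R * M.1) * (M⁻¹).1 := by rw [hM]
      _ = ((M⁻¹).1.transpose * M.1.transpose) * gram Q R * (M.1 * (M⁻¹).1) := by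
          simp only [Matrix.mul_assoc]
      _ = _ := by rw [h1, h2, Matrix.one_mul, Matrix.mul_one]

omit [Algebra ℚ R] in
theorem isoGrp_dotProduct (M : isoGrp Q R) (v w : Idx k m → R) :
    M.1.1.mulVec v ⬝ᵥ (gram Q R).mulVec (M.1.1.mulVec w) = v ⬝ᵥ (gram Q R).mulVec w := by
  have h : M.1.1.transpose * gram Q R * M.1.1 = gram Q R := M.2
  conv_rhs => rw [← h]
  rw [Matrix.mulVec_mulVec, ← Matrix.vecMul_transpose, ← Matrix.dotProduct_mulVec,
    Matrix.mulVec_mulVec, ← Matrix.mul_assoc]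

/-- The restriction to `Cl(Q)` of the automorphism of `Cl(Q_R)` induced by an isometry. -/
def clHom (M : isoGrp Q R) : CliffordAlgebra Q →ₐ[ℤ] Cl Q R :=
  CliffordAlgebra.lift Q ⟨((vecLin Q R ∘ₗ Matrix.toLin' M.1.1).restrictScalars ℤ) ∘ₗ
    (Algebra.linearMap ℤ R).compLeft (Idx k m), fun v => by
      change vec Q (M.1.1.mulVec fun i => ((v i : ℤ) : R)) *
        vec Q (M.1.1.mulVec fun i => ((v i : ℤ) : R)) = _
      rw [vec_mul_self (r := ((Q v : ℤ) : R))]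
      · rw [Algebra.algebraMap_eq_smul_one, Algebra.TensorProduct.one_def,
          TensorProduct.smul_tmul', zsmul_eq_mul, mul_one]
      · rw [isoGrp_dotProduct]
        have := congrArg (Int.cast : ℤ → R) (dotProduct_gram_self (Q := Q) v)
        simpa [dotProduct, Matrix.mulVec, gram] using this⟩

theorem commute_clHom (M : isoGrp Q R) (r : R) (c : CliffordAlgebra Q) :
    Commute (Algebra.ofId R (Cl Q R) r) (clHom M c) := Algebra.commutes r _

/-- The automorphism of `Cl(Q_R)` induced by an isometry. -/
def clAct (M : isoGrp Q R) : Cl Q R →ₐ[R] Cl Q R :=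
  Algebra.TensorProduct.lift (Algebra.ofId R (Cl Q R)) (clHom M) (commute_clHom M)

theorem clAct_vec (M : isoGrp Q R) (v : Idx k m → R) :
    clAct M (vec Q v) = vec Q (M.1.1.mulVec v) := by
  have h : (clAct M).toLinearMap ∘ₗ vecLin Q R = vecLin Q R ∘ₗ Matrix.toLin' M.1.1 := by
    refine LinearMap.pi_ext' fun i => LinearMap.ext_ring ?_
    change clAct M (vec Q (Pi.single i 1)) = vec Q (M.1.1.mulVec (Pi.single i 1))
    have h1 : (Pi.single i 1 : Idx k m → R) = fun j => (((Pi.single i 1 : Idx k m → ℤ) j : ℤ) : R) := by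
      ext j
      by_cases hj : j = i
      · subst hj
        simp
      · simp [hj]
    conv_lhs => rw [h1, ← tmul_ι]
    rw [clAct, Algebra.TensorProduct.lift_tmul, map_one, one_mul, clHom,
      CliffordAlgebra.lift_ι_apply, h1]
    rfl
  exact LinearMap.congr_fun h v

theorem clAct_scalar (M : isoGrp Q R) (r : R) : clAct M (r ⊗ₜ 1) = r ⊗ₜ 1 := (clAct M).commutes r

theorem clAct_mul (M N : isoGrp Q R) (x : Cl Q R) : clAct (M * N) x = clAct M (clAct N x) := by
  have : clAct (M * N) = (clAct M).comp (clAct N) := by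
    refine clHom_ext fun v => ?_
    rw [AlgHom.comp_apply, clAct_vec, clAct_vec, clAct_vec, Matrix.mulVec_mulVec]
    rfl
  rw [this]
  rfl

theorem clAct_one (x : Cl Q R) : clAct (1 : isoGrp Q R) x = x := by
  have : clAct (1 : isoGrp Q R) = AlgHom.id R _ := by
    refine clHom_ext fun v => ?_
    rw [clAct_vec, AlgHom.id_apply]
    exact congrArg _ (Matrix.one_mulVec v)
  rw [this]
  rfl

omit [Algebra ℚ R] in
theorem rev_scalar (r : R) : rev Q R (r ⊗ₜ 1) = r ⊗ₜ 1 := by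
  rw [rev_tmul, CliffordAlgebra.reverse.map_one]

theorem rev_clAct (M : isoGrp Q R) (x : Cl Q R) : rev Q R (clAct M x) = clAct M (rev Q R x) := by
  induction x using cl_induction with
  | scalar r => rw [clAct_scalar, rev_scalar, clAct_scalar]
  | vec v => rw [clAct_vec, rev_vec, rev_vec, clAct_vec]
  | mul x y hx hy => rw [map_mul, rev_mul, rev_mul, map_mul, hx, hy]
  | add x y hx hy => rw [map_add, map_add, map_add, map_add, hx, hy]

omit [Algebra ℚ R] in
theorem scalar_mem_evenPart (r : R) : (r ⊗ₜ 1 : Cl Q R) ∈ evenPart Q R := ⟨r ⊗ₜ 1, by simp⟩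

theorem clAct_mem_evenPart (M : isoGrp Q R) {x : Cl Q R} (hx : x ∈ evenPart Q R) :
    clAct M x ∈ evenPart Q R := by
  obtain ⟨y, rfl⟩ := hx
  induction y using TensorProduct.induction_on with
  | zero =>
    simp only [map_zero]
    exact zero_mem _
  | add a b ha hb =>
    rw [map_add, map_add]
    exact add_mem ha hb
  | tmul r c =>
    obtain ⟨c, hc⟩ := c
    change clAct M (r ⊗ₜ c) ∈ _
    have h1 : r ⊗ₜ[ℤ] c = (r ⊗ₜ 1) * ((1 : R) ⊗ₜ c) := by simp
    rw [h1, map_mul, clAct_scalar]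
    refine mul_mem (scalar_mem_evenPart r) ?_
    clear h1
    induction c, hc using CliffordAlgebra.even_induction with
    | algebraMap z =>
      have : ((1 : R) ⊗ₜ[ℤ] algebraMap ℤ (CliffordAlgebra Q) z) = (z : R) ⊗ₜ 1 := by
        rw [Algebra.algebraMap_eq_smul_one, TensorProduct.tmul_smul, TensorProduct.smul_tmul',
          zsmul_eq_mul, mul_one]
      rw [this, clAct_scalar]
      exact scalar_mem_evenPart _
    | add a b _ _ ha hb =>
      rw [TensorProduct.tmul_add, map_add]
      exact add_mem ha hb
    | ι_mul_ι_mul v w c _ hc =>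
      have : ((1 : R) ⊗ₜ[ℤ] (CliffordAlgebra.ι Q v * CliffordAlgebra.ι Q w * c)) =
          (1 ⊗ₜ CliffordAlgebra.ι Q v) * (1 ⊗ₜ CliffordAlgebra.ι Q w) * (1 ⊗ₜ c) := by simp
      rw [this, map_mul, map_mul, tmul_ι, tmul_ι, clAct_vec, clAct_vec]
      exact mul_mem (vec_mul_vec_mem_evenPart _ _) hc

/-- The action of an isometry `M` on the spin group: the induced automorphism of the Clifford algebra
on one component, conjugation by `M` on the matrix. -/
def spinConj (M : isoGrp Q R) (h : Spin Q R) : Spin Q R :=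
  mkSpin (clAct M h.1.1) (M.1.1 * (spinMat Q R h).1 * (M.1⁻¹).1)
    (clAct_mem_evenPart M h.2.1.1)
    (by rw [rev_clAct, ← map_mul, spin_mul_rev, map_one])
    (by rw [rev_clAct, ← map_mul, spin_rev_mul, map_one])
    (by
      rw [Matrix.det_mul, Matrix.det_mul, (spinMat Q R h).2, mul_one, ← Matrix.det_mul,
        M.1.mul_inv, Matrix.det_one])
    (fun v => by
      have h1 := congrArg (clAct M) (spin_mul_vec h ((M.1⁻¹).1.mulVec v))
      rw [map_mul, map_mul, clAct_vec, clAct_vec, Matrix.mulVec_mulVec, M.1.mul_inv,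
        Matrix.one_mulVec, Matrix.mulVec_mulVec, Matrix.mulVec_mulVec] at h1
      exact h1)

theorem spinConj_val (M : isoGrp Q R) (h : Spin Q R) :
    ((spinConj M h).1.1 : Cl Q R) = clAct M h.1.1 := rfl

theorem spinMat_spinConj (M : isoGrp Q R) (h : Spin Q R) :
    (spinMat Q R (spinConj M h)).1 = M.1.1 * (spinMat Q R h).1 * (M.1⁻¹).1 := rfl

theorem spinConj_mul_left (M N : isoGrp Q R) (h : Spin Q R) :
    spinConj (M * N) h = spinConj M (spinConj N h) := by
  refine spin_ext ?_ ?_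
  · rw [spinConj_val, spinConj_val, spinConj_val, clAct_mul]
  · rw [spinMat_spinConj, spinMat_spinConj, spinMat_spinConj]
    have h1 : (M * N).1.1 = M.1.1 * N.1.1 := rfl
    have h2 : ((M * N).1⁻¹).1 = (N.1⁻¹).1 * (M.1⁻¹).1 := by
      rw [← Units.val_mul, ← mul_inv_rev]
      rfl
    rw [h1, h2]
    simp only [Matrix.mul_assoc]

theorem spinConj_one (h : Spin Q R) : spinConj (1 : isoGrp Q R) h = h := by
  refine spin_ext (clAct_one _) ?_
  rw [spinMat_spinConj]
  have h1 : (1 : isoGrp Q R).1.1 = 1 := rfl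
  have h2 : ((1 : isoGrp Q R).1⁻¹).1 = 1 := by simp
  rw [h1, h2, Matrix.one_mul, Matrix.mul_one]

theorem spinConj_mul (M : isoGrp Q R) (h h' : Spin Q R) :
    spinConj M (h * h') = spinConj M h * spinConj M h' := by
  refine spin_ext (map_mul (clAct M) _ _) ?_
  have h1 : ∀ a b : Spin Q R, (spinMat Q R (a * b)).1 = (spinMat Q R a).1 * (spinMat Q R b).1 := by
    intro a b
    rw [map_mul]
    rfl
  have h2 : (M.1⁻¹).1 * M.1.1 = 1 := M.1.inv_mul
  rw [h1, spinMat_spinConj, spinMat_spinConj, spinMat_spinConj, h1]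
  calc _ = M.1.1 * (spinMat Q R h).1 * 1 * (spinMat Q R h').1 * (M.1⁻¹).1 := by
        rw [Matrix.mul_one]
        simp only [Matrix.mul_assoc]
    _ = _ := by
        rw [← h2]
        simp only [Matrix.mul_assoc]

/-- The isometry by which an element of the spin group acts. -/
def spinIso (t : Spin Q R) : isoGrp Q R :=
  ⟨⟨(spinMat Q R t).1, ((spinMat Q R t)⁻¹).1, SL_mul_inv _, SL_inv_mul _⟩, spinMat_gram t⟩

/-- The isometry induced by an element of the spin group acts by an inner automorphism. -/
theorem spinConj_spinIso (t h : Spin Q R) : spinConj (spinIso t) h = t * h * t⁻¹ := by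
  refine spin_ext ?_ ?_
  · have hc : ∀ x : Cl Q R, clAct (spinIso t) x * (t.1.1 : Cl Q R) = (t.1.1 : Cl Q R) * x := by
      intro x
      induction x using cl_induction with
      | scalar r => rw [clAct_scalar, scalar_comm]
      | vec v =>
        rw [clAct_vec]
        exact (spin_mul_vec t v).symm
      | mul x y hx hy => rw [map_mul, mul_assoc, hy, ← mul_assoc, hx, mul_assoc]
      | add x y hx hy => rw [map_add, add_mul, mul_add, hx, hy]
    rw [spinConj_val]
    change _ = (t.1.1 : Cl Q R) * (h.1.1 : Cl Q R) * ((t.1.1⁻¹ : (Cl Q R)ˣ) : Cl Q R)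
    rw [← hc, mul_assoc, Units.mul_inv, mul_one]
  · have : spinMat Q R (t * h * t⁻¹) = spinMat Q R t * spinMat Q R h * (spinMat Q R t)⁻¹ := by
      rw [map_mul, map_mul, map_inv]
    rw [spinMat_spinConj, this]
    rfl

end Isometry

/-! ### Haar measure and automorphisms -/

section Haar

variable {G : Type*} [Group G] [TopologicalSpace G] [IsTopologicalGroup G]

/-- Conjugation by `t` as an automorphism of a topological group. -/
def conjEquiv (t : G) : G ≃ₜ* G where
  toMulEquiv := MulAut.conj t
  continuous_toFun := (continuous_const.mul continuous_id).mul continuous_const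
  continuous_invFun := (continuous_const.mul continuous_id).mul continuous_const

theorem conjEquiv_apply (t x : G) : conjEquiv t x = t * x * t⁻¹ := rfl

variable [MeasurableSpace G] [BorelSpace G] [LocallyCompactSpace G]

/-- An automorphism preserving a compact open set, which has positive finite volume, preserves the
Haar measure. -/
theorem mulEquivHaarChar_eq_one_of_preimage_eq {K : Set G} (hK : IsCompact K) (hKo : IsOpen K)
    (hne : K.Nonempty) (φ : G ≃ₜ* G) (h : φ ⁻¹' K = K) : mulEquivHaarChar φ = 1 := by
  have h1 := mulEquivHaarChar_smul_preimage (Measure.haar : Measure G) (X := K) φ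
  rw [h] at h1
  have h2 : (Measure.haar : Measure G) K ≠ 0 := (hKo.measure_pos _ hne).ne'
  have h3 : (Measure.haar : Measure G) K ≠ ⊤ := hK.measure_lt_top.ne
  rw [ENNReal.smul_def, smul_eq_mul] at h1
  have h4 : ((mulEquivHaarChar φ : NNReal) : ENNReal) = 1 := by
    refine (ENNReal.mul_left_inj h2 h3).mp ?_
    rw [h1, one_mul]
  exact_mod_cast h4

/-- The modulus of an involution is a positive number with square one. -/
theorem mulEquivHaarChar_eq_one_of_trans_self (φ : G ≃ₜ* G)
    (h : φ.trans φ = ContinuousMulEquiv.refl G) : mulEquivHaarChar φ = 1 := by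
  have h1 := mulEquivHaarChar_trans (φ := φ) (ψ := φ)
  rw [h, mulEquivHaarChar_refl] at h1
  have h2 : mulEquivHaarChar φ ^ 2 = 1 := by rw [sq, ← h1]
  exact (pow_eq_one_iff_of_nonneg zero_le two_ne_zero).mp h2

end Haar

/-! ### The torus as a product of stabilizers -/

section Model

variable {k m : ℕ} (Q : QuadraticForm ℤ (Idx k m → ℤ)) (L : Submodule ℚ (Idx k m → ℚ))

/-- The group `F_L(𝔸) = F_L(ℝ) × F_L(𝔸_f)`. -/
def Tor : Type := stabL Q L ℝ × stabL Q L FinAdele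

instance : Group (Tor Q L) := inferInstanceAs (Group (stabL Q L ℝ × stabL Q L FinAdele))

instance : TopologicalSpace (Tor Q L) :=
  inferInstanceAs (TopologicalSpace (stabL Q L ℝ × stabL Q L FinAdele))

instance : IsTopologicalGroup (Tor Q L) :=
  inferInstanceAs (IsTopologicalGroup (stabL Q L ℝ × stabL Q L FinAdele))

instance : MeasurableSpace (Tor Q L) := borel _

instance : BorelSpace (Tor Q L) := ⟨rfl⟩

/-- The projection to the finite adeles. -/
def torFin : Tor Q L →* Spin Q FinAdele := (stabL Q L FinAdele).subtype.comp (MonoidHom.snd _ _)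

variable {Q L} in
theorem torFin_apply (t : Tor Q L) : torFin Q L t = t.2.1 := rfl

/-- The subgroup of the points of `F_L(ℝ) × F_L(𝔸_f)` which are integral at the finite places. -/
def torInt : Subgroup (Tor Q L) := (spinMap Q zhat.subtype).range.comap (torFin Q L)

variable {Q L}

/-- An element of `Spin_Q(𝔸_f)` with integral coordinates is defined over `Ẑ`. -/
theorem mem_intSpin_iff {s : Spin Q FinAdele} :
    s ∈ intSpin Q ↔ s ∈ (spinMap Q zhat.subtype).range := by
  constructor
  · intro h
    exact exists_spinMap_eq Subtype.val_injective fun i => ⟨⟨_, h i⟩, rfl⟩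
  · rintro ⟨s, rfl⟩ i
    rw [spinCrd_spinMap]
    exact (spinCrd Q zhat s i).2

theorem continuous_torFin : Continuous (torFin Q L) := continuous_subtype_val.comp continuous_snd

theorem isOpen_torInt : IsOpen (torInt Q L : Set (Tor Q L)) := by
  have h : (torInt Q L : Set (Tor Q L)) = torFin Q L ⁻¹' intSpin Q := by
    ext t
    exact mem_intSpin_iff.symm
  rw [h]
  exact isOpen_intSpin.preimage continuous_torFin

instance : T2Space (Spin Q ℝ) := isClosedEmbedding_spinCrd.isEmbedding.t2Space
instance : T2Space (Spin Q FinAdele) := isClosedEmbedding_spinCrd.isEmbedding.t2Space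
instance : T2Space (Tor Q L) := inferInstanceAs (T2Space (stabL Q L ℝ × stabL Q L FinAdele))

namespace AdaptedBasis

section Topology

variable (u : AdaptedBasis Q L)

include u

theorem isClosed_stabL {R : Type} [CommRing R] [Algebra ℚ R] [TopologicalSpace R]
    [IsTopologicalRing R] [T2Space R] : IsClosed (stabL Q L R : Set (Spin Q R)) := by
  have h : (stabL Q L R : Set (Spin Q R)) =
      {s | (spinMat Q R s).1 * u.PR R = u.PR R * (spinMat Q R s).1} := by
    ext s
    exact u.mem_stabL_iff
  have h1 : Continuous fun s : Spin Q R => (spinMat Q R s).1 :=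
    continuous_subtype_val.comp continuous_spinMat
  rw [h]
  exact isClosed_eq (h1.mul continuous_const) (continuous_const.mul h1)

theorem compactSpace_stabL_real : CompactSpace (stabL Q L ℝ) := by
  have := u.compactSpace_spin_real
  exact isCompact_iff_compactSpace.mp u.isClosed_stabL.isCompact

theorem isCompact_torInt : IsCompact (torInt Q L : Set (Tor Q L)) := by
  have := u.compactSpace_stabL_real
  have h : (torInt Q L : Set (Tor Q L)) = (Set.univ : Set (stabL Q L ℝ)) ×ˢ
      ((Subtype.val : stabL Q L FinAdele → _) ⁻¹' intSpin Q) := by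
    ext t
    exact mem_intSpin_iff.symm.trans ⟨fun h => ⟨trivial, h⟩, fun h => h.2⟩
  rw [h]
  exact isCompact_univ.prod
    (u.isClosed_stabL.isClosedEmbedding_subtypeVal.isCompact_preimage isCompact_intSpin)

theorem locallyCompactSpace_tor : LocallyCompactSpace (Tor Q L) :=
  u.isCompact_torInt.locallyCompactSpace_of_mem_nhds_of_group
    (isOpen_torInt.mem_nhds (one_mem (torInt Q L)))

theorem sigmaCompactSpace_tor : SigmaCompactSpace (Tor Q L) := by
  have := u.compactSpace_stabL_real
  have h1 : SigmaCompactSpace (Spin Q FinAdele) := isClosedEmbedding_spinCrd.sigmaCompactSpace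
  have h2 : SigmaCompactSpace (stabL Q L FinAdele) :=
    u.isClosed_stabL.isClosedEmbedding_subtypeVal.sigmaCompactSpace
  exact inferInstanceAs (SigmaCompactSpace (stabL Q L ℝ × stabL Q L FinAdele))

end Topology

variable (u : AdaptedBasis Q L)

variable {R : Type} [CommRing R] [Algebra ℚ R]

variable (R) in
/-- The isometries of `Q` on `R ^ n` preserving `L_R`. -/
def isoL : Subgroup (isoGrp Q R) where
  carrier := {M | M.1.1 * u.PR R = u.PR R * M.1.1}
  mul_mem' := by
    intro M N hM hN
    change (M.1.1 * N.1.1) * u.PR R = u.PR R * (M.1.1 * N.1.1)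
    have hM' : M.1.1 * u.PR R = u.PR R * M.1.1 := hM
    have hN' : N.1.1 * u.PR R = u.PR R * N.1.1 := hN
    rw [Matrix.mul_assoc, hN', ← Matrix.mul_assoc, hM', Matrix.mul_assoc]
  one_mem' := by
    change (1 : Matrix (Idx k m) (Idx k m) R) * u.PR R = u.PR R * 1
    rw [Matrix.one_mul, Matrix.mul_one]
  inv_mem' := by
    intro M hM
    have hM' : M.1.1 * u.PR R = u.PR R * M.1.1 := hM
    change (M.1⁻¹).1 * u.PR R = u.PR R * (M.1⁻¹).1
    have h1 : M.1.1 * (M.1⁻¹).1 = 1 := M.1.mul_inv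
    have h2 : (M.1⁻¹).1 * M.1.1 = 1 := M.1.inv_mul
    calc (M.1⁻¹).1 * u.PR R = (M.1⁻¹).1 * (u.PR R * M.1.1) * (M.1⁻¹).1 := by
          rw [Matrix.mul_assoc, Matrix.mul_assoc, h1, Matrix.mul_one]
      _ = (M.1⁻¹).1 * M.1.1 * u.PR R * (M.1⁻¹).1 := by
          rw [← hM']
          simp only [Matrix.mul_assoc]
      _ = _ := by rw [h2, Matrix.one_mul]

theorem mem_isoL_iff {M : isoGrp Q R} : M ∈ u.isoL R ↔ M.1.1 * u.PR R = u.PR R * M.1.1 := Iff.rfl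

theorem spinConj_mem_stabL {M : isoGrp Q R} (hM : M ∈ u.isoL R) {h : Spin Q R}
    (hh : h ∈ stabL Q L R) : spinConj M h ∈ stabL Q L R := by
  have hM' := (u.mem_isoL_iff).mp (inv_mem hM)
  rw [mem_isoL_iff] at hM
  rw [u.mem_stabL_iff] at hh ⊢
  have h2 : (M.1⁻¹).1 * u.PR R = u.PR R * (M.1⁻¹).1 := hM'
  rw [spinMat_spinConj, Matrix.mul_assoc, h2, Matrix.mul_assoc, ← Matrix.mul_assoc _ (u.PR R), hh,
    Matrix.mul_assoc (u.PR R), ← Matrix.mul_assoc M.1.1, hM]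
  simp only [Matrix.mul_assoc]

end AdaptedBasis

theorem continuous_spinConj {R : Type} [CommRing R] [Algebra ℚ R] [TopologicalSpace R]
    [IsTopologicalRing R] [T2Space R] (M : isoGrp Q R) : Continuous (spinConj M) := by
  rw [isClosedEmbedding_spinCrd.isInducing.continuous_iff]
  have hc : Continuous (spinCrd Q R) := isClosedEmbedding_spinCrd.continuous
  refine continuous_pi fun i => ?_
  rcases i with i | ⟨a, b⟩
  · let f : (Fin (clRank Q) → R) →ₗ[R] R := LinearMap.proj i ∘ₗ (clCrd Q R).toLinearMap ∘ₗ
      (clAct M).toLinearMap ∘ₗ (clCrd Q R).symm.toLinearMap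
    have h1 : Continuous fun s : Spin Q R => f fun j => spinCrd Q R s (.inl j) :=
      (LinearMap.continuous_on_pi f).comp (continuous_pi fun j => (continuous_apply _).comp hc)
    refine h1.congr fun s => ?_
    change clCrd Q R (clAct M ((clCrd Q R).symm (clCrd Q R s.1.1))) i = clCrd Q R (clAct M s.1.1) i
    rw [LinearEquiv.symm_apply_apply]
  · have h1 : Continuous fun s : Spin Q R => (spinMat Q R s).1 :=
      continuous_subtype_val.comp continuous_spinMat
    exact ((continuous_const.mul h1).mul continuous_const).matrix_elem a b

namespace AdaptedBasis

variable (u : AdaptedBasis Q L)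

/-- The automorphism of `F_L(𝔸)` induced by an isometry of `𝔸_f ^ n` preserving `L`. -/
def torConj (M : u.isoL FinAdele) : Tor Q L ≃ₜ* Tor Q L where
  toFun t := (t.1, ⟨spinConj M.1 t.2.1, u.spinConj_mem_stabL M.2 t.2.2⟩)
  invFun t := (t.1, ⟨spinConj M.1⁻¹ t.2.1, u.spinConj_mem_stabL (inv_mem M.2) t.2.2⟩)
  left_inv t := by
    refine Prod.ext rfl (Subtype.ext ?_)
    change spinConj M.1⁻¹ (spinConj M.1 t.2.1) = t.2.1
    rw [← spinConj_mul_left, inv_mul_cancel, spinConj_one]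
  right_inv t := by
    refine Prod.ext rfl (Subtype.ext ?_)
    change spinConj M.1 (spinConj M.1⁻¹ t.2.1) = t.2.1
    rw [← spinConj_mul_left, mul_inv_cancel, spinConj_one]
  map_mul' s t := Prod.ext rfl (Subtype.ext (spinConj_mul _ _ _))
  continuous_toFun := continuous_fst.prodMk
    (((continuous_spinConj M.1).comp (continuous_subtype_val.comp continuous_snd)).subtype_mk _)
  continuous_invFun := continuous_fst.prodMk
    (((continuous_spinConj M.1⁻¹).comp (continuous_subtype_val.comp continuous_snd)).subtype_mk _)

theorem torConj_snd (M : u.isoL FinAdele) (t : Tor Q L) :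
    (u.torConj M t).2.1 = spinConj M.1 t.2.1 := rfl

theorem torConj_fst (M : u.isoL FinAdele) (t : Tor Q L) : (u.torConj M t).1 = t.1 := rfl

theorem torFin_torConj (M : u.isoL FinAdele) (t : Tor Q L) :
    torFin Q L (u.torConj M t) = spinConj M.1 (torFin Q L t) := by
  rw [torFin_apply, torFin_apply, torConj_snd]

theorem torConj_mul (M N : u.isoL FinAdele) :
    u.torConj (M * N) = (u.torConj N).trans (u.torConj M) := by
  refine DFunLike.ext _ _ fun t => ?_
  rw [ContinuousMulEquiv.trans_apply]
  refine Prod.ext ?_ (Subtype.ext ?_)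
  · rw [torConj_fst, torConj_fst, torConj_fst]
  · rw [torConj_snd, torConj_snd, torConj_snd, ← spinConj_mul_left, Subgroup.coe_mul]

theorem torConj_one : u.torConj 1 = ContinuousMulEquiv.refl _ := by
  refine DFunLike.ext _ _ fun t => ?_
  exact Prod.ext rfl (Subtype.ext (spinConj_one t.2.1))

end AdaptedBasis

/-- An isometry which is integral together with its inverse preserves `Spin_Q(Ẑ)`. -/
theorem spinConj_mem_range (M : isoGrp Q FinAdele) (h1 : ∀ i j, M.1.1 i j ∈ zhat)
    (h2 : ∀ i j, (M.1⁻¹).1 i j ∈ zhat) {s : Spin Q FinAdele}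
    (hs : s ∈ (spinMap Q zhat.subtype).range) :
    spinConj M s ∈ (spinMap Q zhat.subtype).range := by
  obtain ⟨s, rfl⟩ := hs
  choose M1 hM1 using fun i j => (⟨⟨_, h1 i j⟩, rfl⟩ : ∃ z : zhat, (z : FinAdele) = M.1.1 i j)
  choose M2 hM2 using fun i j => (⟨⟨_, h2 i j⟩, rfl⟩ : ∃ z : zhat, (z : FinAdele) = (M.1⁻¹).1 i j)
  have hM1' : M.1.1 = zhat.subtype.mapMatrix (Matrix.of M1) := by
    exact Matrix.ext fun i j => (hM1 i j).symm
  have hM2' : (M.1⁻¹).1 = zhat.subtype.mapMatrix (Matrix.of M2) := by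
    exact Matrix.ext fun i j => (hM2 i j).symm
  have hcl : ∀ x : Cl Q zhat, ∃ y, clAct M (clMap Q zhat.subtype x) = clMap Q zhat.subtype y := by
    intro x
    induction x using cl_induction with
    | scalar r =>
      refine ⟨r ⊗ₜ 1, ?_⟩
      have : clMap Q zhat.subtype (r ⊗ₜ 1) = (r : FinAdele) ⊗ₜ 1 := rfl
      rw [this, clAct_scalar]
    | vec v =>
      refine ⟨vec Q ((Matrix.of M1).mulVec v), ?_⟩
      rw [clMap_vec, clMap_vec, clAct_vec, hM1']
      congr 1
      funext i
      exact (RingHom.map_mulVec zhat.subtype (Matrix.of M1) v i).symm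
    | mul x y hx hy =>
      obtain ⟨a, ha⟩ := hx
      obtain ⟨b, hb⟩ := hy
      exact ⟨a * b, by rw [map_mul, map_mul, ha, hb, map_mul]⟩
    | add x y hx hy =>
      obtain ⟨a, ha⟩ := hx
      obtain ⟨b, hb⟩ := hy
      exact ⟨a + b, by rw [map_add, map_add, ha, hb, map_add]⟩
  refine exists_spinMap_eq Subtype.val_injective fun i => ?_
  rcases i with i | ⟨a, b⟩
  · obtain ⟨y, hy⟩ := hcl s.1.1
    refine ⟨clCrd Q zhat y i, ?_⟩
    rw [← clCrd_clMap, ← hy]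
    rfl
  · refine ⟨(Matrix.of M1 * (spinMat Q zhat s).1 * Matrix.of M2) a b, ?_⟩
    change _ = (M.1.1 * (zhat.subtype.mapMatrix (spinMat Q zhat s).1) * (M.1⁻¹).1) a b
    rw [hM1', hM2', ← map_mul, ← map_mul]
    rfl

end Model

/-! ### Reflections -/

section Reflection

variable {k m : ℕ} {Q : QuadraticForm ℤ (Idx k m → ℤ)} {R : Type} [CommRing R]

theorem gdot_comm (v w : Idx k m → R) : gdot Q v w = gdot Q w v := by
  rw [gdot, gdot, Matrix.dotProduct_mulVec, ← Matrix.mulVec_transpose, gram_transpose,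
    dotProduct_comm]

theorem gdot_add_right (v w x : Idx k m → R) : gdot Q v (w + x) = gdot Q v w + gdot Q v x := by
  rw [gdot, Matrix.mulVec_add, dotProduct_add]
  rfl

theorem gdot_sub_right (v w x : Idx k m → R) : gdot Q v (w - x) = gdot Q v w - gdot Q v x := by
  rw [gdot, Matrix.mulVec_sub, dotProduct_sub]
  rfl

theorem gdot_smul_right (r : R) (v w : Idx k m → R) : gdot Q v (r • w) = r * gdot Q v w := by
  rw [gdot, Matrix.mulVec_smul, dotProduct_smul]
  rfl

theorem gdot_add_left (v w x : Idx k m → R) : gdot Q (v + w) x = gdot Q v x + gdot Q w x := by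
  rw [gdot, add_dotProduct]
  rfl

theorem gdot_sub_left (v w x : Idx k m → R) : gdot Q (v - w) x = gdot Q v x - gdot Q w x := by
  rw [gdot, sub_dotProduct]
  rfl

theorem gdot_smul_left (r : R) (v w : Idx k m → R) : gdot Q (r • v) w = r * gdot Q v w := by
  rw [gdot, smul_dotProduct]
  rfl

/-- The linear map `x ↦ x - r ⟨v, x⟩ v`. -/
def reflMat (v : Idx k m → R) (r : R) : Matrix (Idx k m) (Idx k m) R :=
  1 - r • Matrix.vecMulVec v ((gram Q R).mulVec v)

theorem reflMat_mulVec (v : Idx k m → R) (r : R) (x : Idx k m → R) :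
    (reflMat (Q := Q) v r).mulVec x = x - (r * gdot Q v x) • v := by
  rw [reflMat, Matrix.sub_mulVec, Matrix.one_mulVec, Matrix.smul_mulVec, Matrix.vecMulVec_mulVec,
    gdot_comm, gdot, dotProduct_comm, mul_smul]
  ext i
  simp [mul_comm]

theorem reflMat_mul_self {v : Idx k m → R} {r : R} (h : r * r * gdot Q v v = 2 * r) :
    reflMat (Q := Q) v r * reflMat (Q := Q) v r = 1 := by
  refine Matrix.ext_of_mulVec_single fun i => ?_
  rw [← Matrix.mulVec_mulVec, reflMat_mulVec, reflMat_mulVec, Matrix.one_mulVec, gdot_sub_right,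
    gdot_smul_right, sub_sub, ← add_smul]
  have : r * gdot Q v (Pi.single i 1) + r * (gdot Q v (Pi.single i 1) -
      r * gdot Q v (Pi.single i 1) * gdot Q v v) = 0 := by
    linear_combination (-gdot Q v (Pi.single i 1)) * h
  rw [this, zero_smul, sub_zero]

/-- The reflection `x ↦ x - r ⟨v, x⟩ v`, where `r ^ 2 ⟨v, v⟩ = 2 r`. It is the reflection in `v` on
the part of `R` where `r` is invertible, and the identity on the part where `r = 0`. -/
def reflIso (v : Idx k m → R) (r : R) (h : r * r * gdot Q v v = 2 * r) : isoGrp Q R :=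
  ⟨⟨reflMat (Q := Q) v r, reflMat (Q := Q) v r, reflMat_mul_self h, reflMat_mul_self h⟩, by
    refine matrix_eq_of_dotProduct fun x y => ?_
    have h1 : x ⬝ᵥ ((reflMat (Q := Q) v r).transpose * gram Q R * reflMat (Q := Q) v r).mulVec y =
        gdot Q ((reflMat (Q := Q) v r).mulVec x) ((reflMat (Q := Q) v r).mulVec y) := by
      rw [gdot, Matrix.mulVec_mulVec, ← Matrix.vecMul_transpose _ x, ← Matrix.dotProduct_mulVec,
        Matrix.mulVec_mulVec, ← Matrix.mul_assoc]
    refine h1.trans ?_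
    rw [reflMat_mulVec, reflMat_mulVec, gdot_sub_left, gdot_sub_right, gdot_sub_right,
      gdot_smul_left, gdot_smul_left, gdot_smul_right, gdot_smul_right, gdot_comm x v]
    change _ = gdot Q x y
    linear_combination (gdot Q v x * gdot Q v y) * h⟩

/-- The action of an isometry on vectors. -/
def isoVec (M : isoGrp Q R) (x : Idx k m → R) : Idx k m → R := M.1.1.mulVec x

theorem isoVec_reflIso (v : Idx k m → R) (r : R) (h : r * r * gdot Q v v = 2 * r)
    (x : Idx k m → R) : isoVec (reflIso v r h) x = x - (r * gdot Q v x) • v := reflMat_mulVec v r x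

theorem isoVec_mul (M N : isoGrp Q R) (x : Idx k m → R) :
    isoVec (M * N) x = isoVec M (isoVec N x) := by
  rw [isoVec, isoVec, isoVec, Matrix.mulVec_mulVec]
  rfl

theorem isoVec_one (x : Idx k m → R) : isoVec (1 : isoGrp Q R) x = x := Matrix.one_mulVec x

theorem isoVec_smul (M : isoGrp Q R) (r : R) (x : Idx k m → R) :
    isoVec M (r • x) = r • isoVec M x := Matrix.mulVec_smul _ _ _

theorem isoVec_sum {ι : Type*} (M : isoGrp Q R) (s : Finset ι) (f : ι → Idx k m → R) :
    isoVec M (∑ i ∈ s, f i) = ∑ i ∈ s, isoVec M (f i) := map_sum (Matrix.toLin' M.1.1) _ _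

theorem gdot_isoVec (M : isoGrp Q R) (x y : Idx k m → R) :
    gdot Q (isoVec M x) (isoVec M y) = gdot Q x y := by
  have h : M.1.1.transpose * gram Q R * M.1.1 = gram Q R := M.2
  rw [gdot, gdot, isoVec, isoVec]
  conv_rhs => rw [← h]
  rw [Matrix.mulVec_mulVec, ← Matrix.vecMul_transpose, ← Matrix.dotProduct_mulVec,
    Matrix.mulVec_mulVec, ← Matrix.mul_assoc]

namespace AdaptedBasis

variable {L : Submodule ℚ (Idx k m → ℚ)} (u : AdaptedBasis Q L) [Algebra ℚ R]

theorem gdot_PR (x y : Idx k m → R) :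
    gdot Q x ((u.PR R).mulVec y) = gdot Q ((u.PR R).mulVec x) y := by
  rw [gdot, gdot, Matrix.mulVec_mulVec, u.gram_mul_PR, ← Matrix.vecMul_transpose (u.PR R) x,
    ← Matrix.dotProduct_mulVec, Matrix.mulVec_mulVec]

theorem reflIso_mem_isoL {v : Idx k m → R} {r : R} (h : r * r * gdot Q v v = 2 * r) {ε : R}
    (hv : (u.PR R).mulVec v = ε • v) : reflIso v r h ∈ u.isoL R := by
  rw [mem_isoL_iff]
  change reflMat (Q := Q) v r * u.PR R = u.PR R * reflMat (Q := Q) v r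
  refine Matrix.ext_of_mulVec_single fun i => ?_
  rw [← Matrix.mulVec_mulVec, ← Matrix.mulVec_mulVec, reflMat_mulVec, reflMat_mulVec,
    Matrix.mulVec_sub, Matrix.mulVec_smul, hv, u.gdot_PR, hv, gdot_smul_left, smul_smul]
  congr 2
  ring

/-- The action of isometries commutes with the projection onto `L`. -/
theorem PR_isoVec (M : u.isoL R) (x : Idx k m → R) :
    (u.PR R).mulVec (isoVec M.1 x) = isoVec M.1 ((u.PR R).mulVec x) := by
  have h : M.1.1.1 * u.PR R = u.PR R * M.1.1.1 := M.2
  rw [isoVec, isoVec, Matrix.mulVec_mulVec, Matrix.mulVec_mulVec, h]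

theorem PR_baseVec (i : Idx k m) :
    ∃ ε : R, (u.PR R).mulVec (u.baseVec R i) = ε • u.baseVec R i := by
  have h : ∃ ε : ℚ, u.P.mulVec (u.U.col i) = ε • u.U.col i := by
    refine ⟨Sum.elim (fun _ => 1) (fun _ => 0) i, ?_⟩
    have h := congrArg (fun M => Matrix.col M i) u.P_mul_U
    have h1 : (u.P * u.U).col i = u.P.mulVec (u.U.col i) := by
      ext j
      simp [Matrix.mul_apply, Matrix.mulVec, dotProduct]
    rw [← h1]
    refine h.trans ?_
    ext j
    rw [stdProj_eq_diagonal]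
    simp [Matrix.mul_diagonal, mul_comm]
  obtain ⟨ε, hε⟩ := h
  refine ⟨algebraMap ℚ R ε, ?_⟩
  ext j
  have h2 := congrArg (algebraMap ℚ R) (congrFun hε j)
  simpa [Matrix.mulVec, dotProduct, PR, baseVec] using h2

end AdaptedBasis

end Reflection

/-! ### Unimodularity -/

section Unimodular

variable {k m : ℕ} {Q : QuadraticForm ℤ (Idx k m → ℤ)} {L : Submodule ℚ (Idx k m → ℚ)}

namespace AdaptedBasis

variable (u : AdaptedBasis Q L) [LocallyCompactSpace (Tor Q L)]

/-- The isometries preserving the Haar measure of `F_L(𝔸)`. -/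
def isoKer : Subgroup (u.isoL FinAdele) where
  carrier := {M | mulEquivHaarChar (u.torConj M) = 1}
  mul_mem' := by
    intro M N hM hN
    rw [Set.mem_ofPred_eq] at *
    rw [torConj_mul, mulEquivHaarChar_trans, hM, hN, one_mul]
  one_mem' := by
    rw [Set.mem_ofPred_eq, torConj_one, mulEquivHaarChar_refl]
  inv_mem' := by
    intro M hM
    rw [Set.mem_ofPred_eq] at *
    have h : mulEquivHaarChar (u.torConj (M⁻¹ * M)) = 1 := by
      rw [inv_mul_cancel, torConj_one, mulEquivHaarChar_refl]
    rwa [torConj_mul, mulEquivHaarChar_trans, hM, one_mul] at h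

/-- Reflections preserve the Haar measure since they are involutions. -/
theorem exists_isoKer_reflection {v : Idx k m → FinAdele} {r : FinAdele}
    (h : r * r * gdot Q v v = 2 * r) {ε : FinAdele} (hv : (u.PR FinAdele).mulVec v = ε • v) :
    ∃ S ∈ u.isoKer, ∀ x, isoVec S.1 x = x - (r * gdot Q v x) • v := by
  refine ⟨⟨reflIso v r h, u.reflIso_mem_isoL h hv⟩, ?_, isoVec_reflIso v r h⟩
  refine mulEquivHaarChar_eq_one_of_trans_self _ ?_
  rw [← torConj_mul, ← torConj_one]
  congr 1
  exact Subtype.ext (Subtype.ext (Units.ext (reflMat_mul_self h)))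

/-- If `w` and `z` have the same invertible length then some product of reflections moves `w` to
`z` on the part of `𝔸_f` cut out by an idempotent `e` with von Neumann regular `e 𝔸_f`. On the part
where `w - z` is anisotropic the reflection in `w - z` does it; on the part where `w - z` is
isotropic, `w + z` is anisotropic, and one reflects in `w + z` and then in `z`. -/
theorem exists_isoKer_move {e : FinAdele} (he : e * e = e)
    (hreg : ∀ a : FinAdele, ∃ y, e * (a * y * a) = e * a) {w z : Idx k m → FinAdele}
    {ε c c' : FinAdele} (hw : (u.PR FinAdele).mulVec w = ε • w)
    (hz : (u.PR FinAdele).mulVec z = ε • z) (hwc : gdot Q w w = c) (hzc : gdot Q z z = c)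
    (hc : c * c' = 1) :
    ∃ N ∈ u.isoKer, (∀ x, (1 - e) • isoVec N.1 x = (1 - e) • x) ∧
      e • isoVec N.1 w = e • z ∧
      ∀ x, e * gdot Q w x = 0 → e * gdot Q z x = 0 → isoVec N.1 x = x := by
  obtain ⟨s, hs⟩ : ∃ s : FinAdele, 2 * s = 1 := by
    refine ⟨algebraMap ℚ FinAdele 2⁻¹, ?_⟩
    rw [← map_ofNat (algebraMap ℚ FinAdele) 2, ← map_mul]
    norm_num
  set b := gdot Q w z with hb
  have hbz : gdot Q z w = b := gdot_comm _ _
  obtain ⟨a, ha⟩ : ∃ a : FinAdele, a = 2 * c - 2 * b := ⟨_, rfl⟩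
  -- `a` is the length of `w - z`, and `y` a generalized inverse of `e a`; the idempotent `f = a y`
  -- cuts out the part of `e 𝔸_f` where `w - z` is anisotropic, and `h = e - f` the part where it is
  -- isotropic
  obtain ⟨y, hy1, hy2, hy3⟩ : ∃ y, e * y = y ∧ y * a * y = y ∧ a * y * a = e * a := by
    obtain ⟨y, hy⟩ := hreg a
    refine ⟨e * y * a * y, ?_, ?_, ?_⟩
    · linear_combination (y * a * y) * he
    · linear_combination (y * a * y * a * y * a * y) * he + (y * y * a * y) * hy + (y * y) * hy
    · linear_combination (a * y) * hy + hy
  set f := a * y with hf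
  set h := e - f with hh
  have hff : f * f = f := by linear_combination a * hy2
  have hef : e * f = f := by linear_combination a * hy1
  have hha : h * a = 0 := by linear_combination -hy3
  have hhc : h * b = h * c := by
    have h1 : h * b = h * b * (2 * s) := by rw [hs, mul_one]
    have h2 : h * c = h * c * (2 * s) := by rw [hs, mul_one]
    rw [h1, h2]
    linear_combination (-s) * hha + s * h * ha
  have hhf : h * f = 0 := by linear_combination hef - hff
  have hhh : h * h = h := by linear_combination he - hef - hef + hff
  have heh : e * h = h := by linear_combination he - hef
  -- the coefficients of the reflections in `w - z`, `w + z` and `z`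
  have c1 : 2 * y * (2 * y) * gdot Q (w - z) (w - z) = 2 * (2 * y) := by
    rw [gdot_sub_left, gdot_sub_right, gdot_sub_right, hwc, hzc, hbz, ← hb]
    linear_combination 4 * hy2 - 4 * y * y * ha
  have c2 : h * c' * s * (h * c' * s) * gdot Q (w + z) (w + z) = 2 * (h * c' * s) := by
    rw [gdot_add_left, gdot_add_right, gdot_add_right, hwc, hzc, hbz, ← hb]
    have e1 : h * h * (c + b + (b + c)) = h * (4 * c) := by
      linear_combination (c + b + (b + c)) * hhh + 2 * hhc
    linear_combination (c' * s * c' * s) * e1 + (4 * s * s * h * c') * hc +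
      (2 * s * h * c') * hs
  have c3 : 2 * h * c' * (2 * h * c') * gdot Q z z = 2 * (2 * h * c') := by
    rw [hzc]
    linear_combination (4 * c' * c' * c) * hhh + (4 * h * c') * hc
  have p1 : (u.PR FinAdele).mulVec (w - z) = ε • (w - z) := by
    rw [Matrix.mulVec_sub, hw, hz, smul_sub]
  have p2 : (u.PR FinAdele).mulVec (w + z) = ε • (w + z) := by
    rw [Matrix.mulVec_add, hw, hz, smul_add]
  obtain ⟨S1, hS1, hS1x⟩ := u.exists_isoKer_reflection c1 p1
  obtain ⟨S2, hS2, hS2x⟩ := u.exists_isoKer_reflection c2 p2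
  obtain ⟨S3, hS3, hS3x⟩ := u.exists_isoKer_reflection c3 hz
  refine ⟨S3 * (S2 * S1), mul_mem hS3 (mul_mem hS2 hS1), ?_⟩
  have hN : ∀ x, isoVec (S3 * (S2 * S1)).1 x = isoVec S3.1 (isoVec S2.1 (isoVec S1.1 x)) := by
    intro x
    rw [Subgroup.coe_mul, Subgroup.coe_mul, isoVec_mul, isoVec_mul]
  have key : ∀ (v : Idx k m → FinAdele) (r : FinAdele), e * r = r →
      ∀ x, (1 - e) • (x - (r * gdot Q v x) • v) = (1 - e) • x := by
    intro v r hre x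
    have h0 : (1 - e) * (r * gdot Q v x) = 0 := by linear_combination (-gdot Q v x) * hre
    rw [smul_sub, smul_smul, h0, zero_smul, sub_zero]
  have key2 : ∀ (v : Idx k m → FinAdele) (r : FinAdele), e * r = r →
      ∀ x, e * gdot Q v x = 0 → x - (r * gdot Q v x) • v = x := by
    intro v r hre x hx
    have h0 : r * gdot Q v x = 0 := by
      rw [← hre]
      linear_combination r * hx
    rw [h0, zero_smul, sub_zero]
  have r1 : e * (2 * y) = 2 * y := by linear_combination 2 * hy1
  have r2 : e * (h * c' * s) = h * c' * s := by linear_combination (c' * s) * heh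
  have r3 : e * (2 * h * c') = 2 * h * c' := by linear_combination (2 * c') * heh
  refine ⟨fun x => ?_, ?_, fun x hxw hxz => ?_⟩
  · rw [hN, hS3x, key _ _ r3, hS2x, key _ _ r2, hS1x, key _ _ r1]
  · rw [hN]
    have e1 : 2 * y * gdot Q (w - z) w = f := by
      rw [gdot_sub_left, hwc, hbz]
      linear_combination (-y) * ha
    have e2 : h * c' * s * gdot Q (w + z) (w - f • (w - z)) = h := by
      rw [gdot_add_left, gdot_sub_right, gdot_sub_right, gdot_smul_right, gdot_smul_right,
        gdot_sub_right, gdot_sub_right, hwc, hzc, hbz, ← hb]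
      linear_combination (c' * s) * hhc + 2 * s * h * hc + h * hs
    have e3 : 2 * h * c' * gdot Q z (w - f • (w - z) - h • (w + z)) = -2 * h := by
      rw [gdot_sub_right, gdot_sub_right, gdot_smul_right, gdot_smul_right, gdot_sub_right,
        gdot_add_right, hzc, hbz]
      linear_combination (2 * c') * hhc - (2 * c' * (b - c)) * hhf - (2 * c' * (b + c)) * hhh -
        (2 * c') * hhc - 2 * h * hc
    rw [hS1x, e1, hS2x, e2, hS3x, e3]
    funext i
    simp only [Pi.smul_apply, Pi.sub_apply, Pi.add_apply, smul_eq_mul]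
    rw [hh]
    linear_combination (z i - w i) * he
  · have hx1 : e * gdot Q (w - z) x = 0 := by
      rw [gdot_sub_left, mul_sub, hxw, hxz, sub_zero]
    have hx2 : e * gdot Q (w + z) x = 0 := by
      rw [gdot_add_left, mul_add, hxw, hxz, add_zero]
    rw [hN, hS1x, key2 _ _ r1 _ hx1, hS2x, key2 _ _ r2 _ hx2, hS3x, key2 _ _ r3 _ hxz]

/-- Moving the images of the vectors of an orthogonal basis back one after the other by products of
reflections (as in the theorem of Cartan and Dieudonné), an isometry is made trivial on the part of
`𝔸_f` cut out by `e`. A later step does not disturb an earlier one since the vectors are orthogonal.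
-/
theorem exists_isoKer_trivialize {e : FinAdele} (he : e * e = e)
    (hreg : ∀ a : FinAdele, ∃ y, e * (a * y * a) = e * a) (M : u.isoL FinAdele)
    (s : Finset (Idx k m)) :
    ∃ N ∈ u.isoKer, (∀ x, (1 - e) • isoVec N.1 x = (1 - e) • x) ∧
      ∀ i ∈ s, e • isoVec (N * M).1 (u.baseVec FinAdele i) = e • u.baseVec FinAdele i := by
  classical
  induction s using Finset.induction_on with
  | empty => exact ⟨1, one_mem _, fun x => by rw [Subgroup.coe_one, isoVec_one], by simp⟩
  | insert j s hj ih =>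
    obtain ⟨N, hN, hN1, hN2⟩ := ih
    obtain ⟨ε, hε⟩ := u.PR_baseVec (R := FinAdele) j
    set z := u.baseVec FinAdele j with hz
    set w := isoVec (N * M).1 z with hw
    have hwε : (u.PR FinAdele).mulVec w = ε • w := by
      rw [hw, u.PR_isoVec, hε, isoVec_smul]
    have hzz : gdot Q z z = algebraMap ℚ FinAdele (u.c j) := by
      rw [hz, u.gdot_baseVec, if_pos rfl]
    have hww : gdot Q w w = algebraMap ℚ FinAdele (u.c j) := by
      rw [hw, gdot_isoVec, hzz]
    have hc : algebraMap ℚ FinAdele (u.c j) * algebraMap ℚ FinAdele (u.c j)⁻¹ = 1 := by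
      rw [← map_mul, mul_inv_cancel₀ (u.c_pos j).ne', map_one]
    obtain ⟨N', hN', hN1', hN2', hN3'⟩ := u.exists_isoKer_move he hreg hwε hε hww hzz hc
    have hmul : ∀ x, isoVec (N' * N * M).1 x = isoVec N'.1 (isoVec (N * M).1 x) := by
      intro x
      rw [mul_assoc, Subgroup.coe_mul, isoVec_mul]
    refine ⟨N' * N, mul_mem hN' hN, fun x => ?_, fun i hi => ?_⟩
    · rw [Subgroup.coe_mul, isoVec_mul, hN1', hN1]
    · rw [hmul]
      rcases Finset.mem_insert.mp hi with rfl | hi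
      · exact hN2'
      · have hij : j ≠ i := by
          rintro rfl
          exact hj hi
        rw [hN3', hN2 i hi]
        · rw [hw, gdot_isoVec, hz, u.gdot_baseVec, if_neg hij, mul_zero]
        · rw [← gdot_smul_right, hN2 i hi, gdot_smul_right, hz, u.gdot_baseVec, if_neg hij,
            mul_zero]

/-- All isometries preserve the Haar measure. At the finitely many places where `M` or its inverse
is not integral, collected in the idempotent `e`, products of reflections make `M` trivial; the
result is integral together with its inverse and preserves the compact open subgroup `torInt`. -/
theorem isoKer_eq_top (M : u.isoL FinAdele) : M ∈ u.isoKer := by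
  obtain ⟨e, he, hint, hez, hreg⟩ := exists_idempotent_integral_away
    (Sum.elim (fun p : Idx k m × Idx k m => M.1.1.1 p.1 p.2)
      fun p : Idx k m × Idx k m => (M.1.1⁻¹).1 p.1 p.2)
  obtain ⟨N, hN, hN1, hN2⟩ := u.exists_isoKer_trivialize he hreg M Finset.univ
  set W := N * M with hW
  have hinv : ∀ (A : u.isoL FinAdele) x, isoVec A.1 (isoVec (A⁻¹).1 x) = x := by
    intro A x
    rw [← isoVec_mul, ← Subgroup.coe_mul, mul_inv_cancel, Subgroup.coe_one, isoVec_one]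
  have hWe : ∀ x, e • isoVec W.1 x = e • x := by
    intro x
    obtain ⟨t, rfl⟩ := u.exists_baseVec_combination x
    rw [isoVec_sum, Finset.smul_sum, Finset.smul_sum]
    refine Finset.sum_congr rfl fun i _ => ?_
    rw [isoVec_smul, smul_comm, hN2 i (Finset.mem_univ i), smul_comm]
  have hWe' : ∀ x, e • isoVec (W⁻¹).1 x = e • x := by
    intro x
    rw [← hWe, hinv]
  have hN1' : ∀ x, (1 - e) • isoVec (N⁻¹).1 x = (1 - e) • x := by
    intro x
    rw [← hN1, hinv]
  have hWf : ∀ x, (1 - e) • isoVec W.1 x = (1 - e) • isoVec M.1 x := by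
    intro x
    rw [hW, Subgroup.coe_mul, isoVec_mul, hN1]
  have hWf' : ∀ x, (1 - e) • isoVec (W⁻¹).1 x = (1 - e) • isoVec (M⁻¹).1 x := by
    intro x
    rw [hW, mul_inv_rev, Subgroup.coe_mul, isoVec_mul, ← isoVec_smul, hN1', isoVec_smul]
  have hentry : ∀ (A B : isoGrp Q FinAdele), (∀ x, e • isoVec A x = e • x) →
      (∀ x, (1 - e) • isoVec A x = (1 - e) • isoVec B x) →
      (∀ i j, (1 - e) * B.1.1 i j ∈ zhat) → ∀ i j, A.1.1 i j ∈ zhat := by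
    intro A B h1 h2 h3 i j
    have hA : ∀ C : isoGrp Q FinAdele, isoVec C (Pi.single j 1) i = C.1.1 i j := by
      intro C
      simp [isoVec]
    have e1 := congrFun (h1 (Pi.single j 1)) i
    have e2 := congrFun (h2 (Pi.single j 1)) i
    rw [Pi.smul_apply, Pi.smul_apply, smul_eq_mul, smul_eq_mul, hA] at e1
    rw [Pi.smul_apply, Pi.smul_apply, smul_eq_mul, smul_eq_mul, hA, hA] at e2
    have e3 : A.1.1 i j = e * (Pi.single j 1 : Idx k m → FinAdele) i + (1 - e) * B.1.1 i j := by
      linear_combination e1 + e2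
    rw [e3]
    refine add_mem (mul_mem hez ?_) (h3 i j)
    by_cases hij : i = j
    · subst hij
      rw [Pi.single_eq_same]
      exact one_mem _
    · rw [Pi.single_eq_of_ne hij]
      exact zero_mem _
  have hW1 := hentry W.1 M.1 hWe hWf fun i j => hint (.inl (i, j))
  have hW2 := hentry (W⁻¹).1 (M⁻¹).1 hWe' hWf' fun i j => hint (.inr (i, j))
  have hWker : W ∈ u.isoKer := by
    refine mulEquivHaarChar_eq_one_of_preimage_eq u.isCompact_torInt isOpen_torInt
      ⟨1, one_mem (torInt Q L)⟩ _ ?_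
    ext t
    change torFin Q L (u.torConj W t) ∈ (spinMap Q zhat.subtype).range ↔
      torFin Q L t ∈ (spinMap Q zhat.subtype).range
    rw [torFin_torConj]
    refine ⟨fun ht => ?_, spinConj_mem_range W.1 hW1 hW2⟩
    have h1 := spinConj_mem_range (W⁻¹).1 hW2 (by
      have : ((W⁻¹).1.1⁻¹) = W.1.1 := by
        rw [Subgroup.coe_inv, Subgroup.coe_inv, inv_inv]
      rw [this]
      exact hW1) ht
    rwa [← spinConj_mul_left, Subgroup.coe_inv, inv_mul_cancel, spinConj_one] at h1
  have : M = N⁻¹ * W := by rw [hW, inv_mul_cancel_left]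
  rw [this]
  exact mul_mem (inv_mem hN) hWker

include u in
/-- The group `F_L(𝔸)` is unimodular: conjugation by `(t, s)` is the action of an isometry, and the
isometries preserving `L` are generated by reflections and by isometries which are integral together
with their inverses; all of these preserve the Haar measure. -/
theorem mulEquivHaarChar_conj (t : Tor Q L) : mulEquivHaarChar (conjEquiv t) = 1 := by
  have hmul : ∀ s t : Tor Q L, conjEquiv (s * t) = (conjEquiv t).trans (conjEquiv s) := by
    intro s t
    refine DFunLike.ext _ _ fun x => ?_
    rw [ContinuousMulEquiv.trans_apply, conjEquiv_apply, conjEquiv_apply, conjEquiv_apply]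
    group
  let t1 : Tor Q L := (t.1, 1)
  let t2 : Tor Q L := (1, t.2)
  have ht : t = t1 * t2 := Prod.ext (mul_one t.1).symm (one_mul t.2).symm
  -- the real component acts trivially at the finite places and so preserves `torInt`
  have h1 : mulEquivHaarChar (conjEquiv t1) = 1 := by
    refine mulEquivHaarChar_eq_one_of_preimage_eq u.isCompact_torInt isOpen_torInt
      ⟨1, one_mem (torInt Q L)⟩ _ ?_
    ext x
    have h3 : torFin Q L t1 = 1 := rfl
    change torFin Q L (t1 * x * t1⁻¹) ∈ (spinMap Q zhat.subtype).range ↔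
      torFin Q L x ∈ (spinMap Q zhat.subtype).range
    rw [map_mul, map_mul, map_inv, h3, one_mul, inv_one, mul_one]
  have h2 : mulEquivHaarChar (conjEquiv t2) = 1 := by
    have hM : spinIso t.2.1 ∈ u.isoL FinAdele := u.mem_stabL_iff.mp t.2.2
    have h3 : conjEquiv t2 = u.torConj ⟨_, hM⟩ := by
      refine DFunLike.ext _ _ fun x => ?_
      rw [conjEquiv_apply]
      refine Prod.ext ?_ (Subtype.ext ?_)
      · change (1 : stabL Q L ℝ) * x.1 * 1⁻¹ = x.1
        rw [one_mul, inv_one, mul_one]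
      · rw [torConj_snd, spinConj_spinIso]
        rfl
    rw [h3]
    exact u.isoKer_eq_top _
  rw [ht, hmul, mulEquivHaarChar_trans, h1, h2, one_mul]

end AdaptedBasis

end Unimodular

/-! ### Invariant measures on orbits with discrete stabilizer -/

section Orbit

open scoped Pointwise ENNReal

variable {G : Type*} [Group G] {Y : Type*} [MulAction G Y]

open Classical in
/-- The number of elements of `A` moving `y₀` to `y`. -/
def orbitCount (y₀ : Y) (A : Set G) (y : Y) : ℝ≥0∞ := ∑' s : G, if s ∈ A ∧ s • y₀ = y then 1 else 0

/-- The elements of `J` moving `y₀` to a given point of its orbit form a coset of the isotropy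
group. -/
theorem orbitCount_coset (y₀ : Y) (J : Subgroup G) (g : G) (y : Y) :
    orbitCount y₀ (g • (J : Set G)) y =
      (g • ((fun s : G => s • y₀) '' (J : Set G))).indicator
        (fun _ => (((MulAction.stabilizer G y₀ ⊓ J : Subgroup G) : Set G).encard : ℝ≥0∞)) y := by
  classical
  by_cases hy : y ∈ g • ((fun s : G => s • y₀) '' (J : Set G))
  · rw [Set.indicator_of_mem hy]
    obtain ⟨_, ⟨j, hj, rfl⟩, hjy⟩ := hy
    have hjy' : (g * j) • y₀ = y := by rw [mul_smul]; exact hjy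
    rw [orbitCount, ← (Equiv.mulLeft (g * j)).tsum_eq, ← ENNReal.tsum_set_one,
      tsum_subtype _ (fun _ => (1 : ℝ≥0∞))]
    refine tsum_congr fun s => ?_
    rw [Set.indicator_apply]
    refine if_congr ?_ rfl rfl
    rw [Equiv.coe_mulLeft, ← hjy', mul_smul (g * j) s, smul_left_cancel_iff]
    have h1 : g * j * s ∈ g • (J : Set G) ↔ s ∈ J := by
      rw [Set.mem_smul_set_iff_inv_smul_mem, smul_eq_mul, ← mul_assoc, ← mul_assoc,
        inv_mul_cancel, one_mul, SetLike.mem_coe, Subgroup.mul_mem_cancel_left _ hj]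
    rw [h1, SetLike.mem_coe, Subgroup.mem_inf, MulAction.mem_stabilizer_iff, and_comm]
  · rw [Set.indicator_of_notMem hy, orbitCount, ENNReal.tsum_eq_zero]
    intro s
    rw [if_neg]
    rintro ⟨⟨j, hj, rfl⟩, rfl⟩
    exact hy ⟨j • y₀, ⟨j, hj, rfl⟩, (mul_smul g j y₀).symm⟩

/-- The count over `J₁` is the sum of the counts over the cosets of `J`. -/
theorem orbitCount_subgroup (y₀ : Y) {J J₁ : Subgroup G} (h : J ≤ J₁)
    [Fintype (J₁ ⧸ J.subgroupOf J₁)] (y : Y) :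
    orbitCount y₀ (J₁ : Set G) y =
      ∑ q : J₁ ⧸ J.subgroupOf J₁, orbitCount y₀ ((q.out : G) • (J : Set G)) y := by
  classical
  have hmem : ∀ (s : G) (q : J₁ ⧸ J.subgroupOf J₁), s ∈ (q.out : G) • (J : Set G) ↔
      ∃ hs : s ∈ J₁, (QuotientGroup.mk ⟨s, hs⟩ : J₁ ⧸ J.subgroupOf J₁) = q := by
    intro s q
    rw [Set.mem_smul_set_iff_inv_smul_mem, smul_eq_mul, SetLike.mem_coe]
    constructor
    · intro hs
      have hs1 : s ∈ J₁ := by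
        have := mul_mem q.out.2 (h hs)
        rwa [mul_inv_cancel_left] at this
      refine ⟨hs1, ?_⟩
      rw [← q.out_eq', eq_comm, Quotient.out_eq']
      exact (QuotientGroup.out_eq' q).symm.trans (QuotientGroup.eq.mpr hs)
    · rintro ⟨hs, rfl⟩
      have := QuotientGroup.eq.mp (QuotientGroup.out_eq'
        (QuotientGroup.mk ⟨s, hs⟩ : J₁ ⧸ J.subgroupOf J₁))
      exact this
  simp only [orbitCount]
  rw [← Summable.tsum_finsetSum fun _ _ => ENNReal.summable]
  refine tsum_congr fun s => ?_
  by_cases hs : s ∈ J₁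
  · rw [Finset.sum_eq_single (QuotientGroup.mk ⟨s, hs⟩ : J₁ ⧸ J.subgroupOf J₁)]
    · refine if_congr (and_congr_left fun _ => ?_) rfl rfl
      rw [hmem]
      exact ⟨fun _ => ⟨hs, rfl⟩, fun _ => hs⟩
    · intro q _ hq
      rw [if_neg]
      rintro ⟨h1, -⟩
      exact hq ((hmem _ _).mp h1).2.symm
    · intro h
      exact (h (Finset.mem_univ _)).elim
  · rw [if_neg (fun h => hs h.1), eq_comm]
    refine Finset.sum_eq_zero fun q _ => if_neg ?_
    rintro ⟨h1, -⟩
    exact hs ((hmem _ _).mp h1).1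

variable [MeasurableSpace Y]

/-- The measure of an orbit of a subgroup, weighted by the order of its isotropy group, is
multiplicative in the index. -/
theorem measure_orbit_mul_encard {μ : Measure Y} (hμ : ∀ (g : G) (E : Set Y), μ (g • E) = μ E)
    (y₀ : Y) {J J₁ : Subgroup G} (h : J ≤ J₁) [Finite (J₁ ⧸ J.subgroupOf J₁)]
    (hJ : ∀ g : G, MeasurableSet (g • ((fun s : G => s • y₀) '' (J : Set G))))
    (hJ₁ : MeasurableSet ((fun s : G => s • y₀) '' (J₁ : Set G))) :
    μ ((fun s : G => s • y₀) '' (J₁ : Set G)) *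
        (((MulAction.stabilizer G y₀ ⊓ J₁ : Subgroup G) : Set G).encard : ℝ≥0∞) =
      Nat.card (J₁ ⧸ J.subgroupOf J₁) * (μ ((fun s : G => s • y₀) '' (J : Set G)) *
        (((MulAction.stabilizer G y₀ ⊓ J : Subgroup G) : Set G).encard : ℝ≥0∞)) := by
  classical
  have := Fintype.ofFinite (J₁ ⧸ J.subgroupOf J₁)
  have h1 : ∫⁻ y, orbitCount y₀ (J₁ : Set G) y ∂μ = μ ((fun s : G => s • y₀) '' (J₁ : Set G)) *
        (((MulAction.stabilizer G y₀ ⊓ J₁ : Subgroup G) : Set G).encard : ℝ≥0∞) := by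
    have h2 : ∀ y, orbitCount y₀ (J₁ : Set G) y =
        ((fun s : G => s • y₀) '' (J₁ : Set G)).indicator
        (fun _ => (((MulAction.stabilizer G y₀ ⊓ J₁ : Subgroup G) : Set G).encard : ℝ≥0∞)) y := by
      intro y
      have := orbitCount_coset y₀ J₁ 1 y
      rwa [one_smul, one_smul] at this
    simp only [h2]
    rw [lintegral_indicator_const hJ₁, mul_comm]
  rw [← h1]
  simp only [orbitCount_subgroup y₀ h, orbitCount_coset]
  rw [lintegral_finsetSum _ fun q _ => measurable_const.indicator (hJ _)]
  simp only [lintegral_indicator_const (hJ _), hμ]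
  rw [Finset.sum_const, Finset.card_univ, Nat.card_eq_fintype_card, nsmul_eq_mul, mul_comm (μ _)]

end Orbit

section Unimodular

open scoped Pointwise ENNReal

variable {G : Type*} [Group G] [TopologicalSpace G] [IsTopologicalGroup G] [LocallyCompactSpace G]
  [MeasurableSpace G] [BorelSpace G]

/-- If conjugations preserve the left Haar measure, it is also right invariant. -/
theorem isMulRightInvariant_haar (hG : ∀ t : G, mulEquivHaarChar (conjEquiv t) = 1) :
    (Measure.haar : Measure G).IsMulRightInvariant := by
  refine ⟨fun g => ?_⟩
  have h1 := mulEquivHaarChar_smul_map (Measure.haar : Measure G) (conjEquiv g⁻¹)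
  rw [hG, one_smul] at h1
  have h2 : (fun s : G => s * g) = conjEquiv g⁻¹ ∘ fun s => g * s := by
    funext s
    rw [Function.comp_apply, conjEquiv_apply]
    group
  rw [h2, ← Measure.map_map (g := conjEquiv g⁻¹) (conjEquiv g⁻¹).continuous.measurable
      (continuous_const_mul g).measurable,
    map_mul_left_eq_self, h1]

/-- Conjugate subgroups of a unimodular group have the same volume. -/
theorem haar_comap_conj (hG : ∀ t : G, mulEquivHaarChar (conjEquiv t) = 1) (K : Subgroup G) (t : G) :
    (Measure.haar : Measure G) (K.comap (MulAut.conj t).toMonoidHom : Subgroup G) =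
      (Measure.haar : Measure G) K := by
  have h1 := mulEquivHaarChar_smul_preimage (Measure.haar : Measure G) (X := (K : Set G))
    (conjEquiv t)
  rwa [hG, one_smul] at h1

omit [LocallyCompactSpace G] [MeasurableSpace G] [BorelSpace G] in
theorem finite_quotient_subgroupOf {J J₁ : Subgroup G} (hJ : IsOpen (J : Set G))
    (hJ₁ : IsCompact (J₁ : Set G)) : Finite (J₁ ⧸ J.subgroupOf J₁) := by
  have : CompactSpace J₁ := isCompact_iff_compactSpace.mp hJ₁
  exact Subgroup.quotient_finite_of_isOpen _ (hJ.preimage continuous_subtype_val)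

variable {Y : Type*} [TopologicalSpace Y] [T2Space Y] [MeasurableSpace Y] [BorelSpace Y]
  [MulAction G Y] [ContinuousConstSMul G Y]

/-- Two compact open subgroups of the same volume have orbits of the same measure, when orbits are
weighted by the orders of the isotropy groups. -/
theorem measure_orbit_mul_encard_eq [T2Space G] {μ : Measure Y}
    (hμ : ∀ (g : G) (E : Set Y), μ (g • E) = μ E)
    {y₀ : Y} (hy₀ : Continuous fun s : G => s • y₀) {J₁ J₂ : Subgroup G}
    (ho₁ : IsOpen (J₁ : Set G)) (ho₂ : IsOpen (J₂ : Set G))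
    (hc₁ : IsCompact (J₁ : Set G)) (hc₂ : IsCompact (J₂ : Set G))
    (h : (Measure.haar : Measure G) J₁ = (Measure.haar : Measure G) J₂) :
    μ ((fun s : G => s • y₀) '' (J₁ : Set G)) *
        (((MulAction.stabilizer G y₀ ⊓ J₁ : Subgroup G) : Set G).encard : ℝ≥0∞) =
      μ ((fun s : G => s • y₀) '' (J₂ : Set G)) *
        (((MulAction.stabilizer G y₀ ⊓ J₂ : Subgroup G) : Set G).encard : ℝ≥0∞) := by
  have hoJ : IsOpen ((J₁ ⊓ J₂ : Subgroup G) : Set G) := ho₁.inter ho₂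
  have hcJ : IsCompact ((J₁ ⊓ J₂ : Subgroup G) : Set G) := hc₁.inter_right hc₂.isClosed
  have hf₁ : Finite (J₁ ⧸ (J₁ ⊓ J₂).subgroupOf J₁) := finite_quotient_subgroupOf hoJ hc₁
  have hf₂ : Finite (J₂ ⧸ (J₁ ⊓ J₂).subgroupOf J₂) := finite_quotient_subgroupOf hoJ hc₂
  have hmeas : ∀ {J : Subgroup G}, IsCompact (J : Set G) → ∀ g : G,
      MeasurableSet (g • ((fun s : G => s • y₀) '' (J : Set G))) := fun hJ g =>
    ((hJ.image hy₀).smul g).isClosed.measurableSet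
  have hmeas' : ∀ {J : Subgroup G}, IsCompact (J : Set G) →
      MeasurableSet ((fun s : G => s • y₀) '' (J : Set G)) := fun hJ =>
    (hJ.image hy₀).isClosed.measurableSet
  -- the two indices agree, by the same formula for the translation action of `G` on itself
  have key : ∀ {J : Subgroup G}, (hJ : J₁ ⊓ J₂ ≤ J) → IsCompact (J : Set G) →
      (hf : Finite (J ⧸ (J₁ ⊓ J₂).subgroupOf J)) →
      (Measure.haar : Measure G) J = Nat.card (J ⧸ (J₁ ⊓ J₂).subgroupOf J) *
        (Measure.haar : Measure G) (J₁ ⊓ J₂ : Subgroup G) := by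
    intro J hJ hJc hf
    have hid : ∀ A : Set G, (fun s : G => s • (1 : G)) '' A = A := fun A => by simp
    have h0 := measure_orbit_mul_encard (G := G) (Y := G) (μ := (Measure.haar : Measure G))
      (fun g E => measure_smul (Measure.haar : Measure G) g E) 1 hJ
      (fun g => by rw [hid]; exact (hcJ.smul g).isClosed.measurableSet)
      (by rw [hid]; exact hJc.isClosed.measurableSet)
    have h1 : MulAction.stabilizer G (1 : G) = ⊥ := by
      ext s
      simp
    rw [hid, hid, h1] at h0
    simpa using h0
  have h1 := key inf_le_left hc₁ hf₁
  have h2 := key inf_le_right hc₂ hf₂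
  have h3 : ((Nat.card (J₁ ⧸ (J₁ ⊓ J₂).subgroupOf J₁) : ℕ) : ℝ≥0∞) =
      (Nat.card (J₂ ⧸ (J₁ ⊓ J₂).subgroupOf J₂) : ℕ) := by
    refine (ENNReal.mul_left_inj (hoJ.measure_pos Measure.haar ⟨1, one_mem _⟩).ne'
      hcJ.measure_lt_top.ne).mp ?_
    rw [← h1, ← h2, h]
  rw [measure_orbit_mul_encard hμ y₀ inf_le_left (hmeas hcJ) (hmeas' hc₁),
    measure_orbit_mul_encard hμ y₀ inf_le_right (hmeas hcJ) (hmeas' hc₂), h3]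

/-- The orbits of a compact open subgroup `K` through `y₀` and `t • y₀` have the same measure when
weighted by the orders of isotropy groups: the second is a translate of the orbit through `y₀` of
the conjugate subgroup `t⁻¹ K t`, which has the volume of `K`. -/
theorem measure_orbit_smul_mul_encard [T2Space G]
    (hG : ∀ t : G, mulEquivHaarChar (conjEquiv t) = 1) {μ : Measure Y}
    (hμ : ∀ (g : G) (E : Set Y), μ (g • E) = μ E)
    {y₀ : Y} (hy₀ : Continuous fun s : G => s • y₀) {K : Subgroup G}
    (ho : IsOpen (K : Set G)) (hc : IsCompact (K : Set G)) (t : G) :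
    μ ((fun s : G => s • t • y₀) '' (K : Set G)) *
        (((MulAction.stabilizer G y₀ ⊓ K.comap (MulAut.conj t).toMonoidHom : Subgroup G) :
          Set G).encard : ℝ≥0∞) =
      μ ((fun s : G => s • y₀) '' (K : Set G)) *
        (((MulAction.stabilizer G y₀ ⊓ K : Subgroup G) : Set G).encard : ℝ≥0∞) := by
  have h1 : (fun s : G => s • t • y₀) '' (K : Set G) = t • ((fun s : G => s • y₀) ''
      (K.comap (MulAut.conj t).toMonoidHom : Subgroup G)) := by
    ext y
    constructor
    · rintro ⟨s, hs, rfl⟩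
      refine ⟨(t⁻¹ * s * t) • y₀, ⟨t⁻¹ * s * t, ?_, rfl⟩, ?_⟩
      · change t * (t⁻¹ * s * t) * t⁻¹ ∈ K
        have h2 : t * (t⁻¹ * s * t) * t⁻¹ = s := by group
        rwa [h2]
      · change t • (t⁻¹ * s * t) • y₀ = s • t • y₀
        rw [smul_smul, smul_smul, mul_assoc, mul_inv_cancel_left]
    · rintro ⟨_, ⟨s, hs, rfl⟩, rfl⟩
      refine ⟨t * s * t⁻¹, hs, ?_⟩
      change (t * s * t⁻¹) • t • y₀ = t • s • y₀
      rw [smul_smul, smul_smul, inv_mul_cancel_right]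
  rw [h1, hμ]
  refine measure_orbit_mul_encard_eq hμ hy₀ ?_ ho ?_ hc (haar_comap_conj hG K t)
  · exact ho.preimage (conjEquiv t).continuous
  · exact (conjEquiv t).toHomeomorph.isClosedEmbedding.isCompact_preimage hc

end Unimodular

/-! ### Existence of the invariant measure on an orbit with discrete stabilizer -/

section Existence

open scoped Pointwise ENNReal

variable {G : Type*} [Group G] [TopologicalSpace G] [IsTopologicalGroup G]
  [MeasurableSpace G] [BorelSpace G]

theorem measurable_comp_mul_right {f : G → ℝ≥0∞} (hf : Measurable f) (g : G) :
    Measurable fun s => f (s * g) := hf.comp (continuous_mul_const g).measurable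

variable (Γ : Subgroup G) [Countable Γ]

/-- Unfolding along a discrete subgroup: for functions `F` invariant under `Γ` the integral of
`F * f` depends on `f` only through its periodization. -/
theorem lintegral_mul_eq_of_periodization (μ : Measure G) [μ.IsMulRightInvariant]
    {F f f' : G → ℝ≥0∞} (hF : Measurable F)
    (hFΓ : ∀ s, ∀ γ ∈ Γ, F (s * γ) = F s) (hf : Measurable f) (hf' : Measurable f')
    (h : ∀ s, ∑' γ : Γ, f (s * γ) = 1) (h' : ∀ s, ∑' γ : Γ, f' (s * γ) = 1) :
    ∫⁻ s, F s * f s ∂μ = ∫⁻ s, F s * f' s ∂μ := by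
  calc ∫⁻ s, F s * f s ∂μ = ∫⁻ s, ∑' γ : Γ, F s * f s * f' (s * γ) ∂μ := by
        refine lintegral_congr fun s => ?_
        rw [ENNReal.tsum_mul_left, h', mul_one]
    _ = ∑' γ : Γ, ∫⁻ s, F s * f s * f' (s * γ) ∂μ :=
        lintegral_tsum fun γ => ((hF.mul hf).mul (measurable_comp_mul_right hf' _)).aemeasurable
    _ = ∑' γ : Γ, ∫⁻ s, F s * f' s * f (s * (γ⁻¹ : Γ)) ∂μ := by
        refine tsum_congr fun γ => ?_
        rw [← lintegral_mul_right_eq_self (fun s => F s * f' s * f (s * (γ⁻¹ : Γ))) (γ : G)]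
        refine lintegral_congr fun s => ?_
        rw [hFΓ s γ γ.2, Subgroup.coe_inv, mul_inv_cancel_right, mul_right_comm]
    _ = ∑' γ : Γ, ∫⁻ s, F s * f' s * f (s * γ) ∂μ :=
        (Equiv.inv Γ).tsum_eq fun γ : Γ => ∫⁻ s, F s * f' s * f (s * γ) ∂μ
    _ = ∫⁻ s, ∑' γ : Γ, F s * f' s * f (s * γ) ∂μ :=
        (lintegral_tsum fun γ =>
          ((hF.mul hf').mul (measurable_comp_mul_right hf _)).aemeasurable).symm
    _ = ∫⁻ s, F s * f' s ∂μ := by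
        refine lintegral_congr fun s => ?_
        rw [ENNReal.tsum_mul_left, h, mul_one]

variable [SigmaCompactSpace G]

omit [Countable Γ] [MeasurableSpace G] [BorelSpace G] in
/-- An open subgroup of a σ-compact group has countably many cosets. -/
theorem exists_countable_cosets {K : Subgroup G} (ho : IsOpen (K : Set G)) :
    ∃ r : Set G, r.Countable ∧ ∀ s, ∃ t ∈ r, s * t⁻¹ ∈ K := by
  obtain ⟨r, hr, hr'⟩ := countable_cover_nhds (U := fun t : G => {s | s * t⁻¹ ∈ K}) fun t =>
    (ho.preimage (continuous_mul_const t⁻¹)).mem_nhds (by simp [one_mem])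
  refine ⟨r, hr, fun s => ?_⟩
  have : s ∈ ⋃ t ∈ r, {s | s * t⁻¹ ∈ K} := hr' ▸ Set.mem_univ s
  simpa using this

open Classical in
/-- A partition of unity along the cosets of a discrete subgroup. It is obtained by normalizing a
sum of indicator functions of cosets of a compact open subgroup, with coefficients which decrease
fast enough for the periodization to be finite. -/
theorem exists_periodization_eq_one {K : Subgroup G} (ho : IsOpen (K : Set G))
    (hK : ∀ t : G, ((Γ : Set G) ∩ K.comap (MulAut.conj t).toMonoidHom).Finite) :
    ∃ f : G → ℝ≥0∞, Measurable f ∧ ∀ s, ∑' γ : Γ, f (s * γ) = 1 := by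
  obtain ⟨r, hr, hcov⟩ := exists_countable_cosets (G := G) ho
  have : Countable r := hr.to_subtype
  let w : r → ℝ≥0∞ := fun t =>
    ((((Γ : Set G) ∩ K.comap (MulAut.conj (t : G)).toMonoidHom).encard : ℕ∞) : ℝ≥0∞)
  have hw : ∀ t, w t ≠ ⊤ := fun t => by
    change (((_ : Set G).encard : ℕ∞) : ℝ≥0∞) ≠ ⊤
    rw [← (hK t).cast_ncard_eq]
    exact ENNReal.natCast_ne_top _
  obtain ⟨ε, hε, hε'⟩ := ENNReal.exists_pos_tsum_mul_lt_of_countable (ε := 1) one_ne_zero w hw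
  let h : G → ℝ≥0∞ := fun s => ∑' t : r, if s * (t : G)⁻¹ ∈ K then (ε t : ℝ≥0∞) else 0
  have hh : Measurable h := by
    refine Measurable.tsum fun t => ?_
    refine Measurable.ite ?_ measurable_const measurable_const
    exact (ho.preimage (continuous_mul_const _)).measurableSet
  let N : G → ℝ≥0∞ := fun s => ∑' γ : Γ, h (s * γ)
  have hN : Measurable N := Measurable.tsum fun γ => measurable_comp_mul_right hh _
  have hNΓ : ∀ s, ∀ γ : Γ, N (s * γ) = N s := by
    intro s γ
    change ∑' δ : Γ, h (s * γ * δ) = ∑' δ : Γ, h (s * δ)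
    rw [← (Equiv.mulLeft γ).tsum_eq fun δ : Γ => h (s * δ)]
    refine tsum_congr fun δ => ?_
    rw [Equiv.coe_mulLeft, Subgroup.coe_mul, mul_assoc]
  have hN0 : ∀ s, N s ≠ 0 := by
    intro s hs
    obtain ⟨t, ht, hst⟩ := hcov s
    have h1 := ENNReal.tsum_eq_zero.mp (ENNReal.tsum_eq_zero.mp hs 1) ⟨t, ht⟩
    rw [if_pos (by simpa using hst)] at h1
    exact (hε ⟨t, ht⟩).ne' (by exact_mod_cast h1)
  have hNt : ∀ s, N s ≠ ⊤ := by
    intro s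
    refine ne_top_of_le_ne_top (b := ∑' t : r, w t * ε t) (hε'.trans ENNReal.one_lt_top).ne ?_
    change ∑' γ : Γ, ∑' t : r, _ ≤ _
    rw [ENNReal.tsum_comm]
    refine ENNReal.tsum_le_tsum fun t => ?_
    -- two elements of `Γ` moving `s` into `K t` differ by an element of `t⁻¹ K t`
    by_cases hex : ∃ γ₀ : Γ, s * γ₀ * (t : G)⁻¹ ∈ K
    · obtain ⟨γ₀, hγ₀⟩ := hex
      rw [← (Equiv.mulLeft γ₀).tsum_eq]
      have h2 : w t = ∑' γ : Γ, if (γ : G) ∈ K.comap (MulAut.conj (t : G)).toMonoidHom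
          then 1 else 0 := by
        change (((_ : Set G).encard : ℕ∞) : ℝ≥0∞) = _
        rw [← ENNReal.tsum_set_one, tsum_subtype _ (fun _ => (1 : ℝ≥0∞)),
          ← Set.indicator_indicator, ← tsum_subtype]
        refine tsum_congr fun γ => ?_
        rw [Set.indicator_apply]
        rfl
      rw [h2, ← ENNReal.tsum_mul_right]
      refine ENNReal.tsum_le_tsum fun γ => ?_
      rw [Equiv.coe_mulLeft]
      split_ifs with h3 h4
      · rw [one_mul]
      · refine (h4 ?_).elim
        have := mul_mem (inv_mem hγ₀) h3
        rw [Subgroup.coe_mul] at this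
        have e : (s * γ₀ * (t : G)⁻¹)⁻¹ * (s * (γ₀ * γ) * (t : G)⁻¹) = t * γ * (t : G)⁻¹ := by group
        rwa [e] at this
      · exact zero_le
      · exact zero_le
    · rw [ENNReal.tsum_eq_zero.mpr fun γ => if_neg fun hγ => hex ⟨γ, hγ⟩]
      exact zero_le
  refine ⟨fun s => h s / N s, hh.div hN, fun s => ?_⟩
  simp only [hNΓ, ENNReal.div_eq_inv_mul]
  rw [ENNReal.tsum_mul_left]
  exact ENNReal.inv_mul_cancel (hN0 s) (hNt s)

variable [LocallyCompactSpace G] {Y : Type*} [TopologicalSpace Y] [T2Space Y] [MeasurableSpace Y]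
  [BorelSpace Y] [MulAction G Y] [ContinuousConstSMul G Y]

/-- An orbit of a unimodular group with discrete stabilizer carries an invariant measure, the image
of a Haar measure multiplied by a partition of unity. -/
theorem exists_invariant_measure (hG : ∀ t : G, mulEquivHaarChar (conjEquiv t) = 1)
    {y₀ : Y} (hy₀ : Continuous fun s : G => s • y₀)
    (hO : MeasurableSet (Set.range fun s : G => s • y₀))
    [Countable (MulAction.stabilizer G y₀)] {K : Subgroup G} (ho : IsOpen (K : Set G))
    (hK : ∀ t : G, ((MulAction.stabilizer G y₀ : Set G) ∩
      K.comap (MulAut.conj t).toMonoidHom).Finite) :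
    ∃ ν : Measure Y, ν ≠ 0 ∧ (∀ g : G, ν.map (fun y => g • y) = ν) ∧
      ν (Set.range fun s : G => s • y₀)ᶜ = 0 ∧
      ∀ S : Set G, IsCompact S → ν ((fun s : G => s • y₀) '' S) < ⊤ := by
  classical
  obtain ⟨f, hf, hf1⟩ := exists_periodization_eq_one (MulAction.stabilizer G y₀) ho hK
  have := isMulRightInvariant_haar hG
  let lam : Measure G := Measure.haar
  have hlam : lam.IsMulRightInvariant := this
  have hπ : Measurable fun s : G => s • y₀ := hy₀.measurable
  let ν : Measure Y := (lam.withDensity f).map fun s : G => s • y₀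
  have hν : ∀ E : Set Y, MeasurableSet E →
      ν E = ∫⁻ s, ((fun s : G => s • y₀) ⁻¹' E).indicator 1 s * f s ∂lam := by
    intro E hE
    have hE' : MeasurableSet ((fun s : G => s • y₀) ⁻¹' E) := hπ hE
    rw [Measure.map_apply hπ hE, withDensity_apply _ hE', ← lintegral_indicator hE']
    refine lintegral_congr fun s => ?_
    by_cases hs : s ∈ (fun s : G => s • y₀) ⁻¹' E
    · rw [Set.indicator_of_mem hs, Set.indicator_of_mem hs, Pi.one_apply, one_mul]
    · rw [Set.indicator_of_notMem hs, Set.indicator_of_notMem hs, zero_mul]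
  refine ⟨ν, ?_, ?_, ?_, ?_⟩
  · intro h0
    have h1 : ∫⁻ s, f s ∂lam = 0 := by
      have := hν Set.univ MeasurableSet.univ
      rw [h0] at this
      simpa using this.symm
    have h2 : lam Set.univ = 0 := by
      rw [← lintegral_one]
      calc ∫⁻ _, 1 ∂lam = ∫⁻ s, ∑' γ : MulAction.stabilizer G y₀, f (s * γ) ∂lam :=
            lintegral_congr fun s => (hf1 s).symm
        _ = ∑' γ : MulAction.stabilizer G y₀, ∫⁻ s, f (s * γ) ∂lam :=
            lintegral_tsum fun γ => (measurable_comp_mul_right hf _).aemeasurable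
        _ = 0 := by
            refine ENNReal.tsum_eq_zero.mpr fun γ => ?_
            rw [lintegral_mul_right_eq_self f (γ : G), h1]
    exact (isOpen_univ.measure_pos lam Set.univ_nonempty).ne' h2
  · intro g
    refine Measure.ext fun E hE => ?_
    have hg : Measurable fun y : Y => g • y := (continuous_const_smul g).measurable
    rw [Measure.map_apply hg hE, hν _ (hg hE), hν _ hE]
    have hE' : MeasurableSet ((fun s : G => s • y₀) ⁻¹' E) := hπ hE
    have hf' : Measurable fun s => f (g⁻¹ * s) := hf.comp (continuous_const_mul g⁻¹).measurable
    rw [← lintegral_mul_left_eq_self _ g⁻¹]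
    calc _ = ∫⁻ s, ((fun s : G => s • y₀) ⁻¹' E).indicator 1 s * f (g⁻¹ * s) ∂lam := by
          refine lintegral_congr fun s => ?_
          congr 1
          refine Set.indicator_eq_indicator ?_ rfl
          change g • (g⁻¹ * s) • y₀ ∈ E ↔ s • y₀ ∈ E
          rw [smul_smul, mul_inv_cancel_left]
      _ = _ := by
          refine lintegral_mul_eq_of_periodization (MulAction.stabilizer G y₀) lam
            (measurable_one.indicator hE') ?_ hf' hf (fun s => ?_) hf1
          · intro s γ hγ
            refine Set.indicator_eq_indicator ?_ rfl
            change (s * γ) • y₀ ∈ E ↔ s • y₀ ∈ E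
            rw [mul_smul, MulAction.mem_stabilizer_iff.mp hγ]
          · simp only [← mul_assoc]
            exact hf1 _
  · rw [hν _ hO.compl]
    have : (fun s : G => s • y₀) ⁻¹' (Set.range fun s : G => s • y₀)ᶜ = ∅ := by
      ext s
      simp
    simp [this]
  · intro S hS
    have hS' : MeasurableSet ((fun s : G => s • y₀) '' S) := (hS.image hy₀).isClosed.measurableSet
    refine lt_of_le_of_lt ?_ (hS.closure.measure_lt_top (μ := lam))
    have hcm : MeasurableSet (closure S) := isClosed_closure.measurableSet
    rw [hν _ hS', ← lintegral_indicator_one hcm]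
    calc _ ≤ ∫⁻ s, ∑' γ : MulAction.stabilizer G y₀, (closure S).indicator 1 (s * γ) * f s ∂lam := by
          refine lintegral_mono fun s => ?_
          rw [ENNReal.tsum_mul_right]
          gcongr
          by_cases hs : s ∈ (fun s : G => s • y₀) ⁻¹' ((fun s : G => s • y₀) '' S)
          · obtain ⟨x, hx, hxs⟩ := hs
            have hγ : s⁻¹ * x ∈ MulAction.stabilizer G y₀ := by
              rw [MulAction.mem_stabilizer_iff, mul_smul]
              exact inv_smul_eq_iff.mpr hxs
            refine le_trans ?_ (ENNReal.le_tsum (⟨_, hγ⟩ : MulAction.stabilizer G y₀))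
            rw [mul_inv_cancel_left, Set.indicator_of_mem (subset_closure hx)]
            exact Set.indicator_le_self' (fun _ _ => zero_le) s
          · rw [Set.indicator_of_notMem hs]
            exact zero_le
      _ = ∑' γ : MulAction.stabilizer G y₀, ∫⁻ s, (closure S).indicator 1 (s * γ) * f s ∂lam :=
          lintegral_tsum fun γ => ((measurable_comp_mul_right (measurable_one.indicator hcm) _).mul
            hf).aemeasurable
      _ = ∑' γ : MulAction.stabilizer G y₀,
            ∫⁻ s, (closure S).indicator 1 s * f (s * (γ⁻¹ : MulAction.stabilizer G y₀)) ∂lam := by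
          refine tsum_congr fun γ => ?_
          rw [← lintegral_mul_right_eq_self (fun s => (closure S).indicator 1 s *
            f (s * (γ⁻¹ : MulAction.stabilizer G y₀))) (γ : G)]
          refine lintegral_congr fun s => ?_
          rw [Subgroup.coe_inv, mul_inv_cancel_right]
      _ = ∑' γ : MulAction.stabilizer G y₀, ∫⁻ s, (closure S).indicator 1 s * f (s * γ) ∂lam :=
          (Equiv.inv (MulAction.stabilizer G y₀)).tsum_eq
            fun γ => ∫⁻ s, (closure S).indicator 1 s * f (s * γ) ∂lam
      _ = ∫⁻ s, ∑' γ : MulAction.stabilizer G y₀, (closure S).indicator 1 s * f (s * γ) ∂lam :=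
          (lintegral_tsum fun γ => ((measurable_one.indicator hcm).mul
            (measurable_comp_mul_right hf _)).aemeasurable).symm
      _ ≤ ∫⁻ s, (closure S).indicator 1 s ∂lam := by
          refine lintegral_mono fun s => ?_
          rw [ENNReal.tsum_mul_left, hf1, mul_one]

end Existence

/-! ### Measures of orbits of a compact open subgroup -/

section Orbit

open scoped Pointwise ENNReal

variable {G : Type*} [Group G] [TopologicalSpace G] [IsTopologicalGroup G] [SigmaCompactSpace G]
  {Y : Type*} [TopologicalSpace Y] [T2Space Y] [MeasurableSpace Y] [BorelSpace Y] [MulAction G Y]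

omit [IsTopologicalGroup G] in
/-- An orbit of a σ-compact group is σ-compact, hence a Borel set. -/
theorem measurableSet_range_smul {y₀ : Y} (hy₀ : Continuous fun s : G => s • y₀) :
    MeasurableSet (Set.range fun s : G => s • y₀) := by
  rw [← Set.image_univ, ← iUnion_compactCovering, Set.image_iUnion]
  exact MeasurableSet.iUnion fun n => ((isCompact_compactCovering G n).image hy₀).measurableSet

variable [ContinuousConstSMul G Y] [LocallyCompactSpace G] [T2Space G] [MeasurableSpace G]
  [BorelSpace G]

/-- The orbits of a compact open subgroup `K` of a unimodular group have measure inversely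
proportional to the orders of their isotropy groups. -/
theorem exists_measure_orbit_mul_card (hG : ∀ t : G, mulEquivHaarChar (conjEquiv t) = 1)
    {μ : Measure Y} (hμ : ∀ (g : G) (E : Set Y), μ (g • E) = μ E) (hμ0 : μ ≠ 0)
    {y₀ : Y} (hy₀ : Continuous fun s : G => s • y₀)
    (hcar : μ (Set.range fun s : G => s • y₀)ᶜ = 0) {K : Subgroup G}
    (ho : IsOpen (K : Set G)) (hc : IsCompact (K : Set G))
    (hfin : μ ((fun s : G => s • y₀) '' (K : Set G)) ≠ ⊤)
    (hK : ∀ t : G, ((MulAction.stabilizer G y₀ : Set G) ∩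
      K.comap (MulAut.conj t).toMonoidHom).Finite) :
    ∃ c : ℝ≥0∞, c ≠ 0 ∧ c ≠ ⊤ ∧ ∀ t : G, μ ((fun s : G => s • t • y₀) '' (K : Set G)) *
      (Nat.card (MulAction.stabilizer G y₀ ⊓ K.comap (MulAut.conj t).toMonoidHom : Subgroup G) : ℕ)
        = c := by
  have hcard : ∀ {A : Subgroup G}, (A : Set G).Finite →
      (((A : Set G).encard : ℕ∞) : ℝ≥0∞) = (Nat.card A : ℕ) ∧ Nat.card A ≠ 0 := by
    intro A hA
    have : Finite A := hA
    refine ⟨?_, Nat.card_pos.ne'⟩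
    rw [← hA.cast_ncard_eq]
    rfl
  have hK1 : ((MulAction.stabilizer G y₀ ⊓ K : Subgroup G) : Set G).Finite := by
    refine (hK 1).subset fun s hs => ⟨hs.1, ?_⟩
    change 1 * s * 1⁻¹ ∈ K
    rw [one_mul, inv_one, mul_one]
    exact hs.2
  have key : ∀ t : G, μ ((fun s : G => s • t • y₀) '' (K : Set G)) *
      (Nat.card (MulAction.stabilizer G y₀ ⊓ K.comap (MulAut.conj t).toMonoidHom : Subgroup G) : ℕ)
      = μ ((fun s : G => s • y₀) '' (K : Set G)) *
        (Nat.card (MulAction.stabilizer G y₀ ⊓ K : Subgroup G) : ℕ) := by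
    intro t
    have h := measure_orbit_smul_mul_encard hG hμ hy₀ ho hc t
    rwa [(hcard (hK t)).1, (hcard hK1).1] at h
  refine ⟨_, fun h0 => hμ0 ?_, ENNReal.mul_ne_top hfin (ENNReal.natCast_ne_top _), key⟩
  -- countably many orbits of `K` cover the orbit of `G`
  obtain ⟨r, hr, hcov⟩ := exists_countable_cosets (G := G) ho
  have h1 : ∀ t ∈ r, μ ((fun s : G => s • t • y₀) '' (K : Set G)) = 0 := by
    intro t _
    have h := key t
    rw [h0, mul_eq_zero] at h
    exact h.resolve_right (Nat.cast_ne_zero.mpr (hcard (hK t)).2)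
  have h2 : (Set.range fun s : G => s • y₀) ⊆
      ⋃ t ∈ r, (fun s : G => s • t • y₀) '' (K : Set G) := by
    rintro _ ⟨s, rfl⟩
    obtain ⟨t, ht, hst⟩ := hcov s
    refine Set.mem_biUnion ht ⟨_, hst, ?_⟩
    change (s * t⁻¹) • t • y₀ = s • y₀
    rw [smul_smul, inv_mul_cancel_right]
  have h3 : μ (Set.range fun s : G => s • y₀) = 0 :=
    measure_mono_null h2 ((measure_biUnion_null_iff hr).mpr h1)
  refine Measure.measure_univ_eq_zero.mp ?_
  rw [← Set.union_compl_self (Set.range fun s : G => s • y₀)]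
  exact measure_union_null h3 hcar

end Orbit

/-! ### The torus acting on the adelic quotient -/

section Embedding

variable {k m : ℕ} {Q : QuadraticForm ℤ (Idx k m → ℤ)} {L : Submodule ℚ (Idx k m → ℚ)}

/-- The isomorphism `h ↦ (h, g⁻¹ h g)` of `F_L(R)` with `T_L(R)`. -/
def torusEmb (hQ : Q.PosDef) (d : GridData Q L) (R : Type) [CommRing R] [Algebra ℚ R] :
    stabL Q L R →* Grp Q R where
  toFun h := (h.1, ⟨(castSL R d.g)⁻¹ * spinMat Q R h.1 * castSL R d.g, by
    obtain ⟨u⟩ := exists_adaptedBasis hQ d.finrank_eq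
    exact u.conj_mem_parabolic d.g_span hQ (spinMat_gram h.1) (u.mem_stabL_iff.mp h.2)⟩)
  map_one' := by
    refine Prod.ext rfl (Subtype.ext ?_)
    change (castSL R d.g)⁻¹ * spinMat Q R 1 * castSL R d.g = 1
    rw [map_one, mul_one, inv_mul_cancel]
  map_mul' h h' := by
    refine Prod.ext rfl (Subtype.ext ?_)
    change (castSL R d.g)⁻¹ * spinMat Q R (h.1 * h'.1) * castSL R d.g =
      (castSL R d.g)⁻¹ * spinMat Q R h.1 * castSL R d.g *
        ((castSL R d.g)⁻¹ * spinMat Q R h'.1 * castSL R d.g)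
    rw [map_mul]
    group

variable (hQ : Q.PosDef) (d : GridData Q L)

theorem mem_torusGrp_iff_torusEmb {R : Type} [CommRing R] [Algebra ℚ R] {x : Grp Q R} :
    x ∈ torusGrp Q L d.g R ↔ ∃ h, torusEmb hQ d R h = x :=
  ⟨fun hx => ⟨⟨x.1, hx.1⟩, Prod.ext rfl (Subtype.ext hx.2.symm)⟩, by
    rintro ⟨h, rfl⟩
    exact ⟨h.2, rfl⟩⟩

theorem continuous_torusEmb {R : Type} [CommRing R] [Algebra ℚ R] [TopologicalSpace R]
    [IsTopologicalRing R] [T2Space R] : Continuous (torusEmb hQ d R) := by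
  rw [isClosedEmbedding_grpCrd.isInducing.continuous_iff]
  refine continuous_pi fun i => ?_
  rcases i with i | ⟨a, b⟩
  · exact (continuous_apply i).comp
      (isClosedEmbedding_spinCrd.continuous.comp continuous_subtype_val)
  · have h1 : Continuous fun s : Spin Q R => (spinMat Q R s).1 :=
      continuous_subtype_val.comp continuous_spinMat
    exact ((continuous_const.mul (h1.comp continuous_subtype_val)).mul
      continuous_const).matrix_elem a b

/-- The isomorphism of `F_L(𝔸)` with `T_L(𝔸)`. -/
def torEmb : Tor Q L →* GrpA Q := (torusEmb hQ d ℝ).prodMap (torusEmb hQ d FinAdele)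

theorem mem_torusA_iff {x : GrpA Q} : x ∈ torusA Q L d.g ↔ ∃ t, torEmb hQ d t = x := by
  constructor
  · rintro ⟨h1, h2⟩
    obtain ⟨a, ha⟩ := (mem_torusGrp_iff_torusEmb hQ d).mp h1
    obtain ⟨b, hb⟩ := (mem_torusGrp_iff_torusEmb hQ d).mp h2
    exact ⟨(a, b), Prod.ext ha hb⟩
  · rintro ⟨t, rfl⟩
    exact ⟨(mem_torusGrp_iff_torusEmb hQ d).mpr ⟨_, rfl⟩,
      (mem_torusGrp_iff_torusEmb hQ d).mpr ⟨_, rfl⟩⟩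

theorem torEmb_injective : Function.Injective (torEmb hQ d) := by
  intro s t h
  exact Prod.ext (Subtype.ext (congrArg (fun x : GrpA Q => x.1.1) h))
    (Subtype.ext (congrArg (fun x : GrpA Q => x.2.1) h))

theorem continuous_torEmb : Continuous (torEmb hQ d) :=
  ((continuous_torusEmb hQ d).comp continuous_fst).prodMk
    ((continuous_torusEmb hQ d).comp continuous_snd)

/-- The integral points of the torus correspond to `torInt`: the second component `g⁻¹ h g` is
integral with `h`, as `g` is unimodular. -/
theorem torEmb_mem_openPts_iff {t : Tor Q L} : torEmb hQ d t ∈ openPts Q ↔ t ∈ torInt Q L := by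
  constructor
  · rintro ⟨-, c, hc⟩
    exact ⟨c.1, congrArg Prod.fst hc⟩
  · rintro ⟨s, hs⟩
    rw [mem_openPts_iff]
    intro i
    rcases i with i | ⟨a, b⟩
    · exact mem_intSpin_iff.mpr ⟨s, hs⟩ i
    · have h1 : spinMat Q FinAdele t.2.1 =
          Matrix.SpecialLinearGroup.map zhat.subtype (spinMat Q zhat s) := by
        rw [← torFin_apply, ← hs]
        rfl
      have h2 : castSL FinAdele d.g =
          Matrix.SpecialLinearGroup.map zhat.subtype (castSL zhat d.g) :=
        Subtype.ext (castSL_map zhat.subtype d.g).symm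
      have h3 : (torEmb hQ d t).2.2.1 = Matrix.SpecialLinearGroup.map zhat.subtype
          ((castSL zhat d.g)⁻¹ * spinMat Q zhat s * castSL zhat d.g) := by
        rw [map_mul, map_mul, map_inv, ← h1, ← h2]
        rfl
      change (torEmb hQ d t).2.2.1.1 a b ∈ zhat
      rw [h3]
      exact (((castSL zhat d.g)⁻¹ * spinMat Q zhat s * castSL zhat d.g).1 a b).2

/-- The embedding of the torus is proper, because its first component is the inclusion of the closed
subgroup `F_L(𝔸)` of `Spin_Q(𝔸)`. -/
theorem isCompact_preimage_torEmb {S : Set (GrpA Q)} (hS : IsCompact S)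
    (hS' : S ⊆ torusA Q L d.g) : IsCompact (torEmb hQ d ⁻¹' S) := by
  obtain ⟨u⟩ := exists_adaptedBasis hQ d.finrank_eq
  have hemb : Topology.IsClosedEmbedding
      (Prod.map Subtype.val Subtype.val : Tor Q L → Spin Q ℝ × Spin Q FinAdele) :=
    u.isClosed_stabL.isClosedEmbedding_subtypeVal.prodMap
      u.isClosed_stabL.isClosedEmbedding_subtypeVal
  have hp : Continuous fun x : GrpA Q => (x.1.1, x.2.1) :=
    (continuous_fst.comp continuous_fst).prodMk (continuous_fst.comp continuous_snd)
  have h : torEmb hQ d ⁻¹' S = (Prod.map Subtype.val Subtype.val : Tor Q L → _) ⁻¹'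
      ((fun x : GrpA Q => (x.1.1, x.2.1)) '' S) := by
    ext t
    constructor
    · intro ht
      exact ⟨_, ht, rfl⟩
    · rintro ⟨x, hx, hxt⟩
      obtain ⟨s, rfl⟩ := (mem_torusA_iff hQ d).mp (hS' hx)
      have : s = t := hemb.injective hxt
      rwa [← this]
  rw [h]
  exact hemb.isCompact_preimage (hS.image hp)

/-- The action of `F_L(𝔸)` on `Y_𝔸` through its isomorphism with `T_L(𝔸)`. -/
abbrev torAction : MulAction (Tor Q L) (YA Q) := MulAction.compHom (YA Q) (torEmb hQ d)

end Embedding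

/-! ### The measure of the fibres over a packet -/

section Fibres

open scoped Pointwise ENNReal

variable {k m : ℕ} {Q : QuadraticForm ℤ (Idx k m → ℤ)} {L : Submodule ℚ (Idx k m → ℚ)}
  (hQ : Q.PosDef) (d : GridData Q L)

theorem torEmb_smul_mk_one (t : Tor Q L) : torEmb hQ d t • YA.mk Q 1 = YA.mk Q (torEmb hQ d t) := by
  rw [smul_mk, mul_one]

theorem continuous_torEmb_smul : Continuous fun t : Tor Q L => torEmb hQ d t • YA.mk Q 1 := by
  simp only [torEmb_smul_mk_one]
  exact continuous_mk.comp (continuous_torEmb hQ d)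

theorem torEmb_smul_mk_one_eq_iff {t : Tor Q L} :
    torEmb hQ d t • YA.mk Q 1 = YA.mk Q 1 ↔ ∃ q, torEmb hQ d t = ratEmb Q q := by
  rw [torEmb_smul_mk_one, eq_comm, mk_eq_iff]
  simp only [one_mul]

theorem range_torEmb_smul :
    (Set.range fun t : Tor Q L => torEmb hQ d t • YA.mk Q 1) = orbitL Q L d.g := by
  simp only [torEmb_smul_mk_one]
  ext y
  constructor
  · rintro ⟨t, rfl⟩
    exact ⟨_, (mem_torusA_iff hQ d).mpr ⟨t, rfl⟩, rfl⟩
  · rintro ⟨x, hx, rfl⟩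
    obtain ⟨t, rfl⟩ := (mem_torusA_iff hQ d).mp hx
    exact ⟨t, rfl⟩

theorem mk_mem_orbitL_iff_torEmb {b : GrpA Q} :
    YA.mk Q b ∈ orbitL Q L d.g ↔ ∃ t q, b = torEmb hQ d t * ratEmb Q q := by
  rw [mk_mem_orbitL_iff]
  constructor
  · rintro ⟨q, hq⟩
    obtain ⟨t, ht⟩ := (mem_torusA_iff hQ d).mp hq
    exact ⟨t, q, by rw [ht, inv_mul_cancel_right]⟩
  · rintro ⟨t, q, rfl⟩
    exact ⟨q, (mem_torusA_iff hQ d).mpr ⟨t, by rw [mul_inv_cancel_right]⟩⟩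

include hQ in
theorem measurableSet_orbitL : MeasurableSet (orbitL Q L d.g) := by
  obtain ⟨u⟩ := exists_adaptedBasis hQ d.finrank_eq
  have := u.sigmaCompactSpace_tor
  let _ := torAction hQ d
  rw [← range_torEmb_smul hQ d]
  exact measurableSet_range_smul (G := Tor Q L) (y₀ := YA.mk Q 1) (continuous_torEmb_smul hQ d)

/-- A compact set contains only finitely many rational points of the torus. -/
theorem finite_preimage_ratEmb {C : Set (Tor Q L)} (hC : IsCompact C) :
    {t | (∃ q, torEmb hQ d t = ratEmb Q q) ∧ t ∈ C}.Finite := by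
  refine ((finite_inter_ratPts (hC.image (continuous_torEmb hQ d))).preimage
    (torEmb_injective hQ d).injOn).subset ?_
  rintro t ⟨⟨q, hq⟩, ht⟩
  exact ⟨⟨t, ht, rfl⟩, q, hq.symm⟩

include hQ d in
theorem isCompact_comap_conj_torInt (t : Tor Q L) :
    IsCompact (((torInt Q L).comap (MulAut.conj t).toMonoidHom : Subgroup (Tor Q L)) :
      Set (Tor Q L)) := by
  obtain ⟨u⟩ := exists_adaptedBasis hQ d.finrank_eq
  exact (conjEquiv t).toHomeomorph.isClosedEmbedding.isCompact_preimage u.isCompact_torInt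

/-- The points of `𝒰` in the orbit of the torus which lie over the double coset `x`. -/
def GridData.fibre (x : DC Q) : Set (YA Q) :=
  {y | y ∈ openOrbit Q ∧ y ∈ orbitL Q L d.g ∧ Phi Q (d.alpha • y) = x}

/-- The fibre over a point of the packet is one orbit of the integral points of the torus. -/
theorem fibre_eq {b : GrpA Q} (hb : b ∈ openPts Q) {t : Tor Q L} {q : Grp Q ℚ}
    (hbt : b = torEmb hQ d t * ratEmb Q q) :
    d.fibre (DC.mk Q (d.alpha * b).1) =
      (fun s => torEmb hQ d s • torEmb hQ d t • YA.mk Q 1) '' (torInt Q L : Set (Tor Q L)) := by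
  have hbO : YA.mk Q b ∈ orbitL Q L d.g := (mk_mem_orbitL_iff_torEmb hQ d).mpr ⟨t, q, hbt⟩
  have hmk : torEmb hQ d t • YA.mk Q 1 = YA.mk Q b := by
    rw [torEmb_smul_mk_one, mk_eq_iff]
    exact ⟨q, hbt⟩
  have hPhi : ∀ {b' : GrpA Q}, b' ∈ openPts Q →
      Phi Q (d.alpha • YA.mk Q b') = DC.mk Q (d.alpha * b').1 := fun hb' => by
    rw [smul_mk, Phi_mk (mul_mem d.alpha_mem hb')]
  rw [hmk]
  ext y
  constructor
  · rintro ⟨⟨b', hb', rfl⟩, hyO, hy⟩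
    rw [hPhi hb'] at hy
    obtain ⟨c, hc⟩ := d.exists_integral_of_toX_eq hQ hb hb' hbO hyO (congrArg (toX Q) hy.symm)
    obtain ⟨s, hs⟩ := (mem_torusA_iff hQ d).mp hc
    refine ⟨s, ?_, ?_⟩
    · rw [SetLike.mem_coe, ← torEmb_mem_openPts_iff hQ d, hs]
      exact mul_mem hb' (inv_mem (mul_mem hb (ratEmb_int_mem_openPts c)))
    · change torEmb hQ d s • YA.mk Q b = YA.mk Q b'
      rw [smul_mk, mk_eq_iff]
      refine ⟨grpMap Q (Int.castRingHom ℚ) c, ?_⟩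
      rw [hs, mul_assoc, inv_mul_cancel_right]
  · rintro ⟨s, hs, rfl⟩
    have hs' : torEmb hQ d s * b ∈ openPts Q :=
      mul_mem ((torEmb_mem_openPts_iff hQ d).mpr hs) hb
    change torEmb hQ d s • YA.mk Q b ∈ _
    rw [smul_mk]
    refine ⟨⟨_, hs', rfl⟩, (mk_mem_orbitL_iff_torEmb hQ d).mpr ⟨s * t, q, ?_⟩, ?_⟩
    · rw [hbt, map_mul, mul_assoc]
    · rw [hPhi hs']
      refine (d.DC_mk_eq (b := b) (b' := torEmb hQ d s * b) hQ (c := 1) ?_).symm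
      rw [map_one, map_one, mul_one, mul_inv_cancel_right]
      exact (mem_torusA_iff hQ d).mpr ⟨s, rfl⟩

/-- The isotropy group of the base point in a conjugate of the integral points of the torus,
in terms of the integral points of `G`. -/
theorem card_isotropy_tor {b : GrpA Q} (hb : b ∈ openPts Q) {t : Tor Q L} {q : Grp Q ℚ}
    (hbt : b = torEmb hQ d t * ratEmb Q q) :
    Nat.card {γ : Tor Q L // (∃ x, torEmb hQ d γ = ratEmb Q x) ∧ t * γ * t⁻¹ ∈ torInt Q L} =
      Nat.card {c : Grp Q ℤ //
        b * ratEmb Q (grpMap Q (Int.castRingHom ℚ) c) * b⁻¹ ∈ torusA Q L d.g} := by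
  have hτ : ∀ c : {c : Grp Q ℤ //
      b * ratEmb Q (grpMap Q (Int.castRingHom ℚ) c) * b⁻¹ ∈ torusA Q L d.g},
      ∃ τ, torEmb hQ d τ = b * ratEmb Q (grpMap Q (Int.castRingHom ℚ) c.1) * b⁻¹ :=
    fun c => (mem_torusA_iff hQ d).mp c.2
  choose τ hτ using hτ
  have h1 : ∀ c, torEmb hQ d (t⁻¹ * τ c * t) =
      ratEmb Q (q * grpMap Q (Int.castRingHom ℚ) c.1 * q⁻¹) := by
    intro c
    rw [map_mul, map_mul, hτ, map_inv, eq_mul_inv_of_mul_eq hbt.symm, map_mul, map_mul, map_inv]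
    group
  have h2 : ∀ c, t * (t⁻¹ * τ c * t) * t⁻¹ ∈ torInt Q L := by
    intro c
    have h : t * (t⁻¹ * τ c * t) * t⁻¹ = τ c := by group
    rw [h, ← torEmb_mem_openPts_iff hQ d, hτ]
    exact mul_mem (mul_mem hb (ratEmb_int_mem_openPts _)) (inv_mem hb)
  refine (Nat.card_congr (Equiv.ofBijective (fun c => ⟨t⁻¹ * τ c * t, ⟨_, h1 c⟩, h2 c⟩)
    ⟨?_, ?_⟩)).symm
  · intro c c' h
    have h1 : τ c = τ c' := mul_left_cancel (mul_right_cancel (congrArg Subtype.val h))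
    have h2 := congrArg (torEmb hQ d) h1
    rw [hτ, hτ] at h2
    have h3 := mul_left_cancel (mul_right_cancel h2)
    exact Subtype.ext (grpMap_injective Int.cast_injective (ratEmb_injective h3))
  · rintro ⟨γ, ⟨x, hx⟩, hγ⟩
    have h1 : ratEmb Q (q⁻¹ * x * q) = b⁻¹ * torEmb hQ d (t * γ * t⁻¹) * b := by
      rw [map_mul, map_mul, map_inv, ← hx, hbt, map_mul, map_mul, map_inv]
      group
    obtain ⟨c, hc⟩ := exists_int_of_mem_openPts (q := q⁻¹ * x * q) (by
      rw [h1]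
      exact mul_mem (mul_mem (inv_mem hb) ((torEmb_mem_openPts_iff hQ d).mpr hγ)) hb)
    have h2 : b * ratEmb Q (grpMap Q (Int.castRingHom ℚ) c) * b⁻¹ =
        torEmb hQ d (t * γ * t⁻¹) := by
      rw [← hc, h1]
      group
    refine ⟨⟨c, (mem_torusA_iff hQ d).mpr ⟨_, h2.symm⟩⟩, Subtype.ext ?_⟩
    have h3 : τ ⟨c, (mem_torusA_iff hQ d).mpr ⟨_, h2.symm⟩⟩ = t * γ * t⁻¹ :=
      torEmb_injective hQ d ((hτ _).trans h2)
    change t⁻¹ * τ _ * t = γ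
    rw [h3]
    group

include hQ in
theorem wt_pos {x : DC Q} (hx : x ∈ packet d) : 0 < wt x := by
  obtain ⟨b, hb, hbO, rfl⟩ := d.mem_packet_iff.mp hx
  obtain ⟨q, hq⟩ := mk_mem_orbitL_iff.mp hbO
  obtain ⟨d', hd'⟩ := d.exists_gridData hQ hb hq
  obtain ⟨u⟩ := exists_adaptedBasis hQ d.finrank_eq
  have := u.finite_spin_int
  rw [wt_eq hQ d' hd']
  exact inv_pos.mpr (Nat.cast_pos.mpr Nat.card_pos)

include hQ in
theorem measurableSet_fibre (x : DC Q) (hx : x ∈ packet d) : MeasurableSet (d.fibre x) := by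
  obtain ⟨b, hb, hbO, rfl⟩ := d.mem_packet_iff.mp hx
  obtain ⟨t, q, hbt⟩ := (mk_mem_orbitL_iff_torEmb hQ d).mp hbO
  obtain ⟨u⟩ := exists_adaptedBasis hQ d.finrank_eq
  rw [fibre_eq hQ d hb hbt]
  refine (u.isCompact_torInt.image ?_).measurableSet
  have : (fun s => torEmb hQ d s • torEmb hQ d t • YA.mk Q 1) =
      (fun s => torEmb hQ d s • YA.mk Q 1) ∘ fun s => s * t := by
    funext s
    rw [Function.comp_apply, map_mul, mul_smul]
  rw [this]
  exact (continuous_torEmb_smul hQ d).comp (continuous_mul_const t)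

include hQ in
/-- The measure of the fibre over a point of the packet is proportional to the weight of the
point. -/
theorem exists_measure_fibre_eq {μ : Measure (YA Q)} (hμ : IsOrbitHaar Q L d.g μ) :
    ∃ c : ℝ≥0∞, c ≠ 0 ∧ c ≠ ⊤ ∧ ∀ x ∈ packet d, μ (d.fibre x) = c * ENNReal.ofReal (wt x) := by
  obtain ⟨u⟩ := exists_adaptedBasis hQ d.finrank_eq
  have := u.sigmaCompactSpace_tor
  have := u.locallyCompactSpace_tor
  let _ := torAction hQ d
  have hcs : ContinuousConstSMul (Tor Q L) (YA Q) :=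
    ⟨fun t => continuous_const_smul (torEmb hQ d t)⟩
  obtain ⟨c, hc0, hct, hc⟩ := exists_measure_orbit_mul_card (G := Tor Q L) (μ := μ)
    (y₀ := YA.mk Q 1) (K := torInt Q L) u.mulEquivHaarChar_conj (fun t E => by
      -- invariance of `μ` under push-forward gives invariance of the measure of translates
      have h1 := hμ.invariant _ ((mem_torusA_iff hQ d).mpr ⟨t, rfl⟩)
      have h2 : (fun y : YA Q => torEmb hQ d t • y) =
        (Homeomorph.smul (torEmb hQ d t)).toMeasurableEquiv := rfl
      have h3 : (fun y : YA Q => torEmb hQ d t • y) ⁻¹' (t • E) = E := by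
        ext y
        exact Set.smul_mem_smul_set_iff (a := t)
      conv_lhs => rw [← h1]
      rw [h2, MeasurableEquiv.map_apply, ← h2, h3]) hμ.ne_zero
    (continuous_torEmb_smul hQ d) (by
      have := hμ.carried
      rwa [← range_torEmb_smul hQ d] at this) isOpen_torInt u.isCompact_torInt (by
      have h1 := hμ.finite_image _ (u.isCompact_torInt.image (continuous_torEmb hQ d)) (by
        rintro _ ⟨t, -, rfl⟩
        exact (mem_torusA_iff hQ d).mpr ⟨t, rfl⟩)
      rw [Set.image_image] at h1
      simp only [← torEmb_smul_mk_one] at h1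
      exact h1.ne) fun t => by
      refine (finite_preimage_ratEmb hQ d (isCompact_comap_conj_torInt hQ d t)).subset ?_
      exact fun γ hγ => ⟨(torEmb_smul_mk_one_eq_iff hQ d).mp hγ.1, hγ.2⟩
  refine ⟨c, hc0, hct, fun x hx => ?_⟩
  obtain ⟨b, hb, hbO, rfl⟩ := d.mem_packet_iff.mp hx
  obtain ⟨t, q, hbt⟩ := (mk_mem_orbitL_iff_torEmb hQ d).mp hbO
  have hq : b * (ratEmb Q q)⁻¹ ∈ torusA Q L d.g :=
    (mem_torusA_iff hQ d).mpr ⟨t, by rw [hbt, mul_inv_cancel_right]⟩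
  obtain ⟨d', hd'⟩ := d.exists_gridData hQ hb hq
  have hcard : Nat.card (MulAction.stabilizer (Tor Q L) (YA.mk Q 1) ⊓
      (torInt Q L).comap (MulAut.conj t).toMonoidHom : Subgroup (Tor Q L)) =
      Nat.card (stabZ Q (spinAct q.1⁻¹ L)) := by
    rw [← u.card_isotropy_eq hQ d.g_span hb hq, ← card_isotropy_tor hQ d hb hbt]
    refine Nat.card_congr (Equiv.subtypeEquivRight fun γ => ?_)
    exact and_congr (torEmb_smul_mk_one_eq_iff hQ d) Iff.rfl
  have hfin := u.finite_spin_int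
  have hpos : (0 : ℝ) < Nat.card (stabZ Q (spinAct q.1⁻¹ L)) := Nat.cast_pos.mpr Nat.card_pos
  have h1 := hc t
  rw [hcard] at h1
  rw [wt_eq hQ d' hd', ENNReal.ofReal_inv_of_pos hpos, ENNReal.ofReal_natCast, ← h1, mul_assoc,
    ENNReal.mul_inv_cancel (Nat.cast_ne_zero.mpr Nat.card_pos.ne') (ENNReal.natCast_ne_top _),
    mul_one, fibre_eq hQ d hb hbt]
  rfl

/-- The part of the orbit in `𝒰` is the disjoint union of the fibres over the packet. -/
theorem openOrbit_inter_orbitL_inter {E : Set (DC Q)} (hfin : (packet d).Finite)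
    [DecidablePred (· ∈ E)] :
    (fun y => d.alpha • y) ⁻¹' (Phi Q ⁻¹' E) ∩ openOrbit Q ∩ orbitL Q L d.g =
      ⋃ x ∈ hfin.toFinset.filter (· ∈ E), d.fibre x := by
  ext y
  simp only [Set.mem_iUnion, Finset.mem_filter, Set.Finite.mem_toFinset, exists_prop]
  constructor
  · rintro ⟨⟨hE, ⟨b, hb, rfl⟩⟩, hO⟩
    have h1 : Phi Q (d.alpha • YA.mk Q b) = DC.mk Q (d.alpha * b).1 := by
      rw [smul_mk, Phi_mk (mul_mem d.alpha_mem hb)]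
    exact ⟨_, ⟨d.mem_packet_iff.mpr ⟨b, hb, hO, h1.symm⟩, hE⟩, ⟨b, hb, rfl⟩, hO, rfl⟩
  · rintro ⟨x, ⟨-, hxE⟩, hU, hO, hx⟩
    refine ⟨⟨?_, hU⟩, hO⟩
    change Phi Q (d.alpha • y) ∈ E
    rwa [hx]

include hQ in
theorem measure_preimage_inter {μ : Measure (YA Q)} (hμ : IsOrbitHaar Q L d.g μ)
    (hfin : (packet d).Finite) {c : ℝ≥0∞}
    (hc : ∀ x ∈ packet d, μ (d.fibre x) = c * ENNReal.ofReal (wt x)) (E : Set (DC Q))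
    [DecidablePred (· ∈ E)] :
    μ ((fun y => d.alpha • y) ⁻¹' (Phi Q ⁻¹' E) ∩ openOrbit Q) =
      c * ∑ x ∈ hfin.toFinset.filter (· ∈ E), ENNReal.ofReal (wt x) := by
  have h0 : μ (((fun y => d.alpha • y) ⁻¹' (Phi Q ⁻¹' E) ∩ openOrbit Q) \ orbitL Q L d.g) = 0 :=
    measure_mono_null (fun y hy => hy.2) hμ.carried
  rw [← measure_inter_add_sdiff _ (measurableSet_orbitL hQ d), openOrbit_inter_orbitL_inter d hfin,
    h0, add_zero, measure_biUnion_finset, Finset.mul_sum]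
  · exact Finset.sum_congr rfl fun x hx =>
      hc x (hfin.mem_toFinset.mp (Finset.mem_filter.mp hx).1)
  · intro x _ y _ hxy
    exact Set.disjoint_left.mpr fun z hz hz' => hxy (hz.2.2.symm.trans hz'.2.2)
  · exact fun x hx => measurableSet_fibre hQ d x (hfin.mem_toFinset.mp (Finset.mem_filter.mp hx).1)

include hQ in
/-- The mass of `γ_L` at a point of the packet is the relative measure of the fibre, which is
proportional to the weight. -/
theorem gammaL_eq {μ : Measure (YA Q)} (hμ : IsOrbitHaar Q L d.g μ) (hfin : (packet d).Finite) :
    gammaL d μ = ∑ x ∈ hfin.toFinset,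
      ENNReal.ofReal (wt x / ∑ y ∈ hfin.toFinset, wt y) • Measure.dirac x := by
  classical
  obtain ⟨c, hc0, hct, hc⟩ := exists_measure_fibre_eq hQ d hμ
  have hwt : ∀ x ∈ hfin.toFinset, 0 < wt x := fun x hx => wt_pos hQ d (hfin.mem_toFinset.mp hx)
  -- the packet contains the class of `L` itself
  have hne : hfin.toFinset.Nonempty := by
    refine ⟨DC.mk Q (d.alpha * 1).1, hfin.mem_toFinset.mpr (d.mem_packet_iff.mpr
      ⟨1, one_mem _, ⟨1, one_mem _, rfl⟩, rfl⟩)⟩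
  have hW : 0 < ∑ y ∈ hfin.toFinset, wt y := Finset.sum_pos hwt hne
  have hU : μ (openOrbit Q) = c * ENNReal.ofReal (∑ y ∈ hfin.toFinset, wt y) := by
    have h := measure_preimage_inter hQ d hμ hfin hc Set.univ
    rw [ENNReal.ofReal_sum_of_nonneg fun x hx => (hwt x hx).le]
    simpa using h
  refine Measure.ext fun E hE => ?_
  have hsm : Measurable fun y : YA Q => d.alpha • y := (continuous_const_smul d.alpha).measurable
  have hPE : MeasurableSet (Phi Q ⁻¹' E) := measurable_Phi hE
  rw [gammaL, Measure.map_apply measurable_Phi hE, Measure.map_apply hsm hPE, Measure.smul_apply,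
    Measure.restrict_apply (hsm hPE), measure_preimage_inter hQ d hμ hfin hc, hU, smul_eq_mul,
    Measure.finsetSum_apply, ENNReal.mul_inv (Or.inl hc0) (Or.inl hct), mul_mul_mul_comm,
    ENNReal.inv_mul_cancel hc0 hct, one_mul, Finset.sum_filter, Finset.mul_sum]
  refine Finset.sum_congr rfl fun x hx => ?_
  rw [Measure.smul_apply, Measure.dirac_apply' _ hE, smul_eq_mul, Set.indicator_apply,
    ENNReal.ofReal_div_of_pos hW, ENNReal.div_eq_inv_mul]
  split_ifs
  · rw [Pi.one_apply, mul_one]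
  · rw [mul_zero, mul_zero]

include hQ in
/-- An invariant measure exists because `F_L(𝔸)` is unimodular and its rational points are discrete;
it is divided by its total mass if that is finite. -/
theorem exists_isOrbitHaar : ∃ μ, IsOrbitHaar Q L d.g μ := by
  obtain ⟨u⟩ := exists_adaptedBasis hQ d.finrank_eq
  have := u.sigmaCompactSpace_tor
  have := u.locallyCompactSpace_tor
  let _ := torAction hQ d
  have hcs : ContinuousConstSMul (Tor Q L) (YA Q) :=
    ⟨fun t => continuous_const_smul (torEmb hQ d t)⟩
  have hcount : Countable (MulAction.stabilizer (Tor Q L) (YA.mk Q 1)) := by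
    have h1 : ∀ γ : MulAction.stabilizer (Tor Q L) (YA.mk Q 1),
        torEmb hQ d γ.1 ∈ ratPts Q := fun γ => by
      obtain ⟨q, hq⟩ := (torEmb_smul_mk_one_eq_iff hQ d).mp γ.2
      exact ⟨q, hq.symm⟩
    refine Function.Injective.countable (f := fun γ => (⟨_, h1 γ⟩ : ratPts Q)) fun γ γ' h => ?_
    exact Subtype.ext (torEmb_injective hQ d (congrArg Subtype.val h))
  obtain ⟨ν, hν0, hνi, hνc, hνf⟩ := exists_invariant_measure (G := Tor Q L) (y₀ := YA.mk Q 1)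
    u.mulEquivHaarChar_conj (continuous_torEmb_smul hQ d)
    (measurableSet_range_smul (continuous_torEmb_smul hQ d)) isOpen_torInt fun t => by
      refine (finite_preimage_ratEmb hQ d (isCompact_comap_conj_torInt hQ d t)).subset ?_
      exact fun γ hγ => ⟨(torEmb_smul_mk_one_eq_iff hQ d).mp hγ.1, hγ.2⟩
  have hνc' : ν (orbitL Q L d.g)ᶜ = 0 := by
    rw [← range_torEmb_smul hQ d]
    exact hνc
  have hνi' : ∀ t ∈ torusA Q L d.g, ν.map (fun y => t • y) = ν := by
    intro t ht
    obtain ⟨s, rfl⟩ := (mem_torusA_iff hQ d).mp ht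
    exact hνi s
  have hνf' : ∀ S : Set (GrpA Q), IsCompact S → S ⊆ torusA Q L d.g → ν (YA.mk Q '' S) < ⊤ := by
    intro S hS hS'
    refine lt_of_le_of_lt (measure_mono ?_) (hνf _ (isCompact_preimage_torEmb hQ d hS hS'))
    rintro _ ⟨x, hx, rfl⟩
    obtain ⟨t, rfl⟩ := (mem_torusA_iff hQ d).mp (hS' hx)
    exact ⟨t, hx, torEmb_smul_mk_one hQ d t⟩
  by_cases hfin : ν Set.univ < ⊤
  · have h0 : ν Set.univ ≠ 0 := fun h => hν0 (Measure.measure_univ_eq_zero.mp h)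
    have h1 : ((ν Set.univ)⁻¹ • ν) Set.univ = 1 := by
      rw [Measure.smul_apply, smul_eq_mul, ENNReal.inv_mul_cancel h0 hfin.ne]
    refine ⟨(ν Set.univ)⁻¹ • ν, ?_, ?_, ?_, ?_, fun _ => h1⟩
    · intro h
      rw [h] at h1
      simp at h1
    · intro t ht
      rw [Measure.map_smul, hνi' t ht]
    · rw [Measure.smul_apply, hνc', smul_zero]
    · intro S hS hS'
      rw [Measure.smul_apply, smul_eq_mul]
      exact ENNReal.mul_lt_top (ENNReal.inv_lt_top.mpr (pos_iff_ne_zero.mpr h0)) (hνf' S hS hS')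
  · exact ⟨ν, hν0, hνi', hνc', hνf', fun h => (hfin h).elim⟩

end Fibres
end Packets
end

theorem mainTheorem6 {k m : ℕ} (hk : 0 < k) (hm : 0 < m)
    (Q : QuadraticForm ℤ (Packets.Idx k m → ℤ)) (hQ : Q.PosDef)
    (L : Submodule ℚ (Packets.Idx k m → ℚ)) (hL : Module.finrank ℚ L = k)
    (d : Packets.GridData Q L) :
    Set.InjOn (Packets.toX Q) (Packets.packet d) ∧
    (∀ x ∈ Packets.packet d, ∃ (L' : Submodule ℚ (Packets.Idx k m → ℚ))
      (d' : Packets.GridData Q L'), Module.finrank ℚ L' = k ∧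
        Packets.toX Q x = Packets.gridPt Q d') ∧
    ∃ (hfin : (Packets.packet d).Finite) (w : Packets.DC Q → ℝ),
      (∀ x ∈ Packets.packet d, ∀ (L' : Submodule ℚ (Packets.Idx k m → ℚ))
        (d' : Packets.GridData Q L'), Packets.toX Q x = Packets.gridPt Q d' →
          Finite (Packets.stabZ Q L') ∧ w x = (Nat.card (Packets.stabZ Q L') : ℝ)⁻¹) ∧
      (∃ μ, Packets.IsOrbitHaar Q L d.g μ) ∧
      ∀ μ, Packets.IsOrbitHaar Q L d.g μ →
        Packets.gammaL d μ = ∑ x ∈ hfin.toFinset,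
          ENNReal.ofReal (w x / ∑ y ∈ hfin.toFinset, w y) • MeasureTheory.Measure.dirac x := by
  refine ⟨d.injOn_toX hQ, fun x hx => ?_, d.finite_packet hQ, Packets.wt, fun x _ L' d' h => ?_,
    Packets.exists_isOrbitHaar hQ d, fun μ hμ => Packets.gammaL_eq hQ d hμ _⟩
  · obtain ⟨b, hb, hbO, rfl⟩ := d.mem_packet_iff.mp hx
    obtain ⟨q, hq⟩ := Packets.mk_mem_orbitL_iff.mp hbO
    obtain ⟨d', hd'⟩ := d.exists_gridData hQ hb hq
    exact ⟨_, d', d'.finrank_eq, hd'⟩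
  · obtain ⟨u⟩ := Packets.exists_adaptedBasis hQ d.finrank_eq
    have := u.finite_spin_int
    exact ⟨inferInstance, Packets.wt_eq hQ d' h⟩
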